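/- Tiles and tile systems. A neighborhood is a finite set $N\subset\mathbb Z^2\setminus\{(0,0)\}$ with $N=-N$; $N_{vN}=\{(0,\pm1),(\pm1,0)\}$ and $N_n=\{(i,0)\mid 0<|i|\le n\}$. For a finite set $X$ of glues, a tile is a tuple $t=(t_v)_{v\in N}\in X^N$, a tile system is a finite set of tiles, and $t$ sticks at position $v\in N$ to $t'$ if $t_v=t'_{-v}$. Zippers and ribbons. A $T$-tiled path is a pair $(P,r)$, where $P:I\to\mathbb Z^2$ is defined on a (possibly empty or infinite) set $I\subset\mathbb Z$ of consecutive integers, $P(i+1)-P(i)\in N_{vN}$ whenever $i,i+1\in I$, and $r:\mathrm{range}(P)\to T$. It is a $(T,N)$-zipper if $P$ is injective and $r(x)_v=r(x+v)_{-v}$ whenever $v\in N$ and $x,x+v\in\mathrm{range}(P)$. For $N=N_{vN}$ it is a $T$-ribbon if $P$ is injective and each tile sticks to its successor along the path. Poly-ribbons. A poly-ribbon of scale $s$ is a pair $(P,r)$, with $P$ an injective path and $r$ assigning a finite ribbon to each position of $\mathrm{range}(P)$, such that the translates of $r(x)$ by $sx$ have pairwise disjoint domains and the last tile of each translated ribbon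 is adjacent and sticks to the first tile of the next one. Simulations. A zipper-simulation of a tile system $T$ in neighborhood $N$ by a tile system $T_\mu$ in neighborhood $N_{vN}$ consists of a scale $s\ge1$, a map $\varphi$ and a map $\psi$ as follows. The map $\varphi$ sends each $t\in T$ to a set of finite $T_\mu$-ribbons (its polyominoes) whose domains contain $(0,0)$, and no microtile of $T_\mu$ occurs in polyominoes of two different tiles. For a $T_\mu$-ribbon $\rho$, let $\chi_\varphi(\rho)$ be what remains after deleting all microtiles not in a complete polyomino with its reference point $(0,0)$ placed on $s\mathbb Z^2$. The map $\psi$ sends each $(T,N)$-zipper $(P,r)$ to a non-empty set of poly-ribbons $(P,r')$ of scale $s$ with $r'(x)\in\varphi(r(x))$ for all $x$, each of which is (as a catenation) $\chi_\varphi(\rho)$ for some $T_\mu$-ribbon $\rho$; and for every $T_\mu$-ribbon $\rho$ there is a $(T,N)$-zipper $z$, unique up to translation of the index set of its path, with $\chi_\varphi(\rho)\in\psi(z)$ (one says that $\rho$ simulates $z$). Proposition. There is an absolute constant $C$ such that for every $n\ge1$, every finite set of glues $X$ and every tile system $T$ in neighborhood $N_n$ with glues in $X$, there are a finite set of glues $X_\mu$,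 a tile system $T_\mu$ in neighborhood $N_{vN}$ with glues in $X_\mu$, and a zipper-simulation of $T$ by $T_\mu$ (so every $(T,N_n)$-zipper is simulated by a $T_\mu$-ribbon) such that \[ |T_\mu|\le C\,|T|\,|X|^2n^5,\qquad |X_\mu|\le C\,|T|\,|X|^2n^5, \] and every polyomino in every $\varphi(t)$, $t\in T$, consists of at most $C\,|X|\,n^3$ microtiles. -/

import Mathlib

universe u v

/-- Positions of the plane. -/
abbrev Pos : Type := ℤ × ℤ

/-- A neighborhood: a finite symmetric set of nonzero relative coordinates. -/
structure Neighborhood where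
  carrier : Set Pos
  finite : carrier.Finite
  zero_notMem : (0 : Pos) ∉ carrier
  neg_mem : ∀ {w : Pos}, w ∈ carrier → -w ∈ carrier

/-- The von Neumann neighborhood. -/
def vonNeumann : Neighborhood where
  carrier := {(0, 1), (1, 0), (0, -1), (-1, 0)}
  finite := by simp
  zero_notMem := by simp [Prod.ext_iff]
  neg_mem := by
    rintro w (rfl | rfl | rfl | rfl) <;> simp

/-- The connected linear neighborhood `N_n = {(i, 0) | 0 < |i| ≤ n}`. -/
def linearNeighborhood (n : ℕ) : Neighborhood where
  carrier := {w | w.2 = 0 ∧ 0 < |w.1| ∧ |w.1| ≤ (n : ℤ)}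
  finite := by
    apply ((Set.finite_Icc (-(n : ℤ)) n).prod (Set.finite_singleton (0 : ℤ))).subset
    rintro ⟨i, j⟩ ⟨hj, -, hi⟩
    exact ⟨abs_le.mp hi, hj⟩
  zero_notMem := by simp
  neg_mem := by
    rintro w ⟨h0, h1, h2⟩
    exact ⟨by simpa using h0, by simpa using h1, by simpa using h2⟩

/-- A tile in neighborhood `N` with glues in `X`: one glue for each neighbor.
A tile system is a `Finset` of such tiles. -/
abbrev Tile (N : Neighborhood) (X : Type u) : Type u := N.carrier → X

/-- The tile `t` sticks to the tile `t'` located at relative position `w`, that is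
`t_w = t'_{-w}` (no condition when `w` is not in the neighborhood). -/
def Sticks {N : Neighborhood} {X : Type u} (t t' : Tile N X) (w : Pos) : Prop :=
  ∀ h : w ∈ N.carrier, t ⟨w, h⟩ = t' ⟨-w, N.neg_mem h⟩

/-- A tiled path `(P, r)` with labels in `α`: a partial function `P` from a (possibly empty,
finite or infinite) set of consecutive integers to the plane, whose consecutive positions are
adjacent, and a labelling `r` whose domain is exactly the range of `P`. The value `none` means
that the index, or the position, is outside of the domain. -/
structure TiledPath (α : Type u) where
  path : ℤ → Option Pos
  tile : Pos → Option α
  ordConnected_dom : Set.OrdConnected {i : ℤ | (path i).isSome}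
  adjacent : ∀ (i : ℤ) (x y : Pos), path i = some x → path (i + 1) = some y →
    y - x ∈ vonNeumann.carrier
  dom_tile : ∀ x : Pos, (tile x).isSome ↔ ∃ i : ℤ, path i = some x

namespace TiledPath

variable {α : Type u}

/-- The index set of the path. -/
def dom (p : TiledPath α) : Set ℤ := {i | (p.path i).isSome}

/-- The path is injective (non-self-crossing). -/
def Injective (p : TiledPath α) : Prop :=
  ∀ (i j : ℤ) (x : Pos), p.path i = some x → p.path j = some x → i = j

/-- Equality up to a translation of the index set of the path. -/
def Reindexing (p q : TiledPath α) : Prop :=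
  (∃ d : ℤ, ∀ i : ℤ, p.path i = q.path (i + d)) ∧ p.tile = q.tile

/-- `π`, translated by `w`, is a segment of `p`; the index `j` of `π` becomes the index
`c + j` of `p`. -/
def OccursIn (π p : TiledPath α) (w : Pos) (c : ℤ) : Prop :=
  ∀ (j : ℤ) (x : Pos), π.path j = some x →
    p.path (c + j) = some (w + x) ∧ p.tile (w + x) = π.tile x

end TiledPath

/-- `(P, r)` is a `(T, N)`-zipper: `P` is injective and `r` is a `(T, N)`-tiling. -/
def IsZipper {N : Neighborhood} {X : Type u} {T : Finset (Tile N X)} (z : TiledPath T) : Prop :=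
  z.Injective ∧
    ∀ (x y : Pos) (t t' : T), z.tile x = some t → z.tile y = some t' →
      Sticks (t : Tile N X) (t' : Tile N X) (y - x)

/-- `(P, r)` is a `T`-ribbon: `P` is injective, and every tile sticks to its successor. -/
def IsRibbon {X : Type u} {T : Finset (Tile vonNeumann X)} (p : TiledPath T) : Prop :=
  p.Injective ∧
    ∀ (i : ℤ) (x y : Pos) (t t' : T), p.path i = some x → p.path (i + 1) = some y →
      p.tile x = some t → p.tile y = some t' →
      Sticks (t : Tile vonNeumann X) (t' : Tile vonNeumann X) (y - x)

/-- `R` is a poly-ribbon of scale `s`: an injective path of finite ribbons which, once translated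
to their positions on the grid of size `s`, do not overlap, and such that the end of each of them
is adjacent and sticks to the beginning of the next one. -/
structure IsPolyRibbon {X : Type u} {T : Finset (Tile vonNeumann X)} (s : ℕ)
    (R : TiledPath (TiledPath T)) : Prop where
  injective : R.Injective
  ribbon : ∀ (x : Pos) (π : TiledPath T), R.tile x = some π → IsRibbon π ∧ π.dom.Finite
  disjoint : ∀ (x y : Pos) (π π' : TiledPath T), x ≠ y → R.tile x = some π → R.tile y = some π' →
    ∀ a b : Pos, (π.tile a).isSome → (π'.tile b).isSome → (s : ℤ) • x + a ≠ (s : ℤ) • y + b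
  joined : ∀ (i : ℤ) (x y : Pos) (π π' : TiledPath T), R.path i = some x →
    R.path (i + 1) = some y → R.tile x = some π → R.tile y = some π' →
    ∃ (j j' : ℤ) (a b : Pos) (t t' : T),
      IsGreatest π.dom j ∧ π.path j = some a ∧ π.tile a = some t ∧
      IsLeast π'.dom j' ∧ π'.path j' = some b ∧ π'.tile b = some t' ∧
      ((s : ℤ) • y + b) - ((s : ℤ) • x + a) ∈ vonNeumann.carrier ∧
      Sticks (t : Tile vonNeumann X) (t' : Tile vonNeumann X)
        (((s : ℤ) • y + b) - ((s : ℤ) • x + a))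

/-- The indices of the tiled path `p` which survive when incomplete or misaligned polyominoes are
removed: those lying in a complete copy of a polyomino of some `φ t` whose reference tile (at
`(0, 0)` in the polyomino) is at a point of the grid of size `s`. -/
def keptIndices {ι : Type u} {α : Type v} (s : ℕ) (φ : ι → Set (TiledPath α))
    (p : TiledPath α) : Set ℤ :=
  {k | ∃ (t : ι) (π : TiledPath α) (x : Pos) (c j : ℤ),
    π ∈ φ t ∧ π.OccursIn p ((s : ℤ) • x) c ∧ j ∈ π.dom ∧ k = c + j}

/-- `R = χ_φ(p)`: after removing the incomplete and misaligned polyominoes from `p`, what is left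
is the catenation, in the order of the path of `R`, of the ribbons of `R` moved to the grid of
size `s`. The number `c i` is the shift of indices between the `i`-th ribbon of `R` and `p`. -/
def IsChi {ι : Type u} {α : Type v} (s : ℕ) (φ : ι → Set (TiledPath α))
    (p : TiledPath α) (R : TiledPath (TiledPath α)) : Prop :=
  ∃ c : ℤ → ℤ,
    (∀ (i : ℤ) (x : Pos) (π : TiledPath α), R.path i = some x → R.tile x = some π →
      π.OccursIn p ((s : ℤ) • x) (c i)) ∧
    (∀ (i : ℤ) (x y : Pos) (π π' : TiledPath α) (j j' : ℤ), R.path i = some x →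
      R.path (i + 1) = some y → R.tile x = some π → R.tile y = some π' →
      IsGreatest π.dom j → IsLeast π'.dom j' → c i + j + 1 = c (i + 1) + j') ∧
    ∀ k : ℤ, k ∈ keptIndices s φ p ↔
      ∃ (i : ℤ) (x : Pos) (π : TiledPath α) (j : ℤ),
        R.path i = some x ∧ R.tile x = some π ∧ j ∈ π.dom ∧ k = c i + j

/-- `ψ` is a zipper-simulation, of scale `s` and with polyominoes given by `φ`, of the tile
system `T` in neighborhood `N` by the tile system `T'` in the von Neumann neighborhood. -/
structure IsZipperSimulation {N : Neighborhood} {X : Type u} {X' : Type v}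
    (T : Finset (Tile N X)) (T' : Finset (Tile vonNeumann X')) (s : ℕ)
    (φ : T → Set (TiledPath T'))
    (ψ : {z : TiledPath T // IsZipper z} → Set (TiledPath (TiledPath T'))) : Prop where
  scale_pos : 0 < s
  /-- The polyominoes are finite ribbons with a reference tile at `(0, 0)`. -/
  polyomino : ∀ (t : T) (π : TiledPath T'), π ∈ φ t →
    IsRibbon π ∧ π.dom.Finite ∧ (π.tile 0).isSome
  /-- The microtiles occurring in the polyominoes of `t` are specific to `t`. -/
  specific : ∀ (t t' : T) (π π' : TiledPath T'), t ≠ t' → π ∈ φ t → π' ∈ φ t' →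
    ∀ (a b : Pos) (m m' : T'), π.tile a = some m → π'.tile b = some m' → m ≠ m'
  nonempty : ∀ z, (ψ z).Nonempty
  /-- The elements of `ψ z` are poly-ribbons along the path of `z`, in which every tile `t` of `z`
  is replaced by a polyomino of `φ t`. -/
  polyRibbon : ∀ z, ∀ R ∈ ψ z, IsPolyRibbon s R ∧ R.path = z.1.path ∧
    ∀ (x : Pos) (t : T) (π : TiledPath T'), z.1.tile x = some t → R.tile x = some π → π ∈ φ t
  /-- The elements of `ψ z` come from ribbons. -/
  fromRibbon : ∀ z, ∀ R ∈ ψ z, ∃ p : TiledPath T', IsRibbon p ∧ IsChi s φ p R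
  /-- Every ribbon simulates a valid zipper, unique up to a translation of the index set. -/
  decode : ∀ p : TiledPath T', IsRibbon p →
    ∃ z, (∃ R ∈ ψ z, IsChi s φ p R) ∧
      ∀ z', (∃ R ∈ ψ z', IsChi s φ p R) → z'.1.Reindexing z.1

/-! A ribbon enforces gluing only between successive tiles. All other constraints of the zipper must
come from injectivity: the polyominoes of two tiles must be able to avoid each other exactly when
the tiles match.

Combinatorial half. A `Blueprint` lists the geometric facts needed. The cells of a polyomino are
indexed along a route from one side to another, and each cell depends on a single bit, that of its
slot. A microtile is a tuple (tile, route, index, bit), and its glues hand the bit on only while the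
slot stays the same. The bits of distinct slots are thus chosen independently, while the number of
microtiles stays linear in the length of a polyomino. Two properties of a blueprint carry the
simulation. By `sound`, polyominoes of non-matching tiles overlap whatever the bits, so a ribbon
cannot contain both (`decode`). By `encode`, a zipper admits bits that make its polyominoes disjoint
(`simulations_nonempty`).

Geometric half. Let `d = dipDepth n`, `M = |X| + 1`, and let `s = 4 + 2 * d * (n * M)` be the scale.
A macrotile sends a leg over `n + 1` macrotile widths to the right. The leg follows a profile that
rises by 4 per width, so at a given place the leg of a tile `i` steps to the left lies `4 * i`
higher. The legs of a row are nested, the arms of a tile lying above the legs of the tiles on its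
right. A route to the top goes around the ends of the arms nested inside it and comes back along an
upper arm, which mirrors the profile without dips. Other routes come back just below their own leg.

After the ramp, each width has one slot per pair of a distance `i` and a glue `g`. In the slot for
`(i, g)`, the profile either dips or stays flat up to a zigzag. In the last width of the leg of a
tile `t`, the slot must dip exactly when the glue of `t` at `i` is `g`. For the tile `t'` located
`i` steps to the right, the same slot must dip exactly when its glue at `-i` is `g`. All other tiles
have a free bit there. If the glues agree, all legs of the row take the same bit and remain nested
(`exists_rowBits`, `region_disjoint`). If they differ, take for `g` the glue of `t`: the leg of `t`
dips, the lower leg of `t'` stays flat, and they meet (`exists_leg_overlap`).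

The scale is of order `|X| * n ^ 2` and the legs of order `|X| * n ^ 3`. This bounds the
polyominoes, and multiplied by `|T|` it bounds the microtiles and the glues, below the required
bounds. -/

/-! ### Ports and routes -/

/-- The four sides of a macrotile. -/
inductive Port
  | left | bottom | right | top
  deriving DecidableEq

namespace Port

instance : Fintype Port := ⟨{left, bottom, right, top}, by intro p; cases p <;> simp⟩

/-- The outward direction of a side. -/
def dir : Port → Pos
  | left => (-1, 0)
  | bottom => (0, -1)
  | right => (1, 0)
  | top => (0, 1)

/-- The opposite side. -/
def opp : Port → Port
  | left => right
  | bottom => top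
  | right => left
  | top => bottom

theorem dir_opp (p : Port) : p.opp.dir = -p.dir := by cases p <;> rfl

theorem dir_injective : Function.Injective dir := by
  intro p q h
  cases p <;> cases q <;> simp_all [dir]

end Port

theorem mem_vonNeumann_iff {w : Pos} : w ∈ vonNeumann.carrier ↔ ∃ p : Port, w = p.dir := by
  constructor
  · rintro (h | h | h | h)
    exacts [⟨.top, h⟩, ⟨.right, h⟩, ⟨.bottom, h⟩, ⟨.left, h⟩]
  · rintro ⟨p, rfl⟩
    cases p <;> simp [Port.dir, vonNeumann]

theorem Port.dir_mem (p : Port) : p.dir ∈ vonNeumann.carrier := mem_vonNeumann_iff.2 ⟨p, rfl⟩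

theorem neg_mem_vonNeumann {w : Pos} : -w ∈ vonNeumann.carrier ↔ w ∈ vonNeumann.carrier :=
  ⟨fun h => by simpa using vonNeumann.neg_mem h, fun h => vonNeumann.neg_mem h⟩

theorem mem_vonNeumann_sub_comm {a b : Pos} :
    a - b ∈ vonNeumann.carrier ↔ b - a ∈ vonNeumann.carrier := by
  rw [← neg_mem_vonNeumann, neg_sub]

theorem ne_neg_of_mem_vonNeumann {w : Pos} (h : w ∈ vonNeumann.carrier) : w ≠ -w := by
  obtain ⟨p, rfl⟩ := mem_vonNeumann_iff.1 h
  cases p <;> simp [Port.dir, Prod.ext_iff]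

theorem exists_mem_vonNeumann_ne (a b : Pos) : ∃ w ∈ vonNeumann.carrier, w ≠ a ∧ w ≠ b := by
  by_contra! h
  have hl := h _ Port.left.dir_mem
  have hr := h _ Port.right.dir_mem
  have ht := h _ Port.top.dir_mem
  simp only [Port.dir] at hl hr ht
  by_cases h1 : ((-1, 0) : Pos) = a
  · subst h1
    have h2 := hr (by simp)
    subst h2
    exact absurd (ht (by simp)) (by simp)
  · have h2 := hl h1
    subst h2
    by_cases h3 : ((1, 0) : Pos) = a
    · subst h3
      exact absurd (ht (by simp)) (by simp)
    · exact absurd (hr h3) (by simp)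

/-- The way a path crosses a macrotile: an entrance and a distinct exit. -/
abbrev Route : Type := {r : Port × Port // r.1 ≠ r.2}

/-- The side from which a route enters. -/
abbrev Route.src (r : Route) : Port := r.1.1

/-- The side by which a route leaves. -/
abbrev Route.dst (r : Route) : Port := r.1.2

/-! ### Blueprints -/

/-- The geometric data of a zipper-simulation by polyominoes. The polyomino of the tile `t` along
the route `r` has `len r` cells; its `j`-th cell depends on one bit only, shared by all cells in the
same slot. -/
structure Blueprint {N : Neighborhood} {X : Type} (T : Finset (Tile N X)) where
  s : ℕ
  s_pos : 0 < s
  port : Port → Pos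
  port_opp : ∀ p : Port, (s : ℤ) • p.dir + port p.opp = port p + p.dir
  size : ℕ
  len : Route → ℕ
  two_le_len : ∀ r, 2 ≤ len r
  len_le : ∀ r, len r ≤ size
  slot : Route → ℕ → ℤ × ℤ
  loc : T → Route → ℕ → Bool → Pos
  loc_first : ∀ t r b, loc t r 0 b = port r.src
  loc_last : ∀ t r b, loc t r (len r - 1) b = port r.dst
  step : ∀ t r j b, j + 1 < len r → loc t r (j + 1) b - loc t r j b ∈ vonNeumann.carrier
  indep : ∀ t r j b b', j + 1 < len r → slot r j ≠ slot r (j + 1) →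
    loc t r j b = loc t r j b' ∧ loc t r (j + 1) b = loc t r (j + 1) b'
  inj : ∀ t r (B : ℤ × ℤ → Bool) i j, i < len r → j < len r →
    loc t r i (B (slot r i)) = loc t r j (B (slot r j)) → i = j
  inside : ∀ t r j b p, j < len r → loc t r j b ≠ port p + p.dir
  ref : ∀ t r, ∃ j < len r, ∀ b, loc t r j b = 0
  encode : ∀ z : TiledPath T, IsZipper z → ∃ B : Pos → ℤ × ℤ → Bool,
    ∀ x y t t', x ≠ y → z.tile x = some t → z.tile y = some t' →
      ∀ r r' i j, i < len r → j < len r' →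
        (s : ℤ) • x + loc t r i (B x (slot r i)) ≠ (s : ℤ) • y + loc t' r' j (B y (slot r' j))
  sound : ∀ (t u : T) (w : Pos), ¬ Sticks (t : Tile N X) (u : Tile N X) w → ∀ r q,
    ∃ i < len r, ∃ j < len q, ∀ b c, loc t r i b = (s : ℤ) • w + loc u q j c

/-- The states of the microtiles: a cell of a polyomino, with its bit. -/
structure MicroState (α : Type) (L : ℕ) where
  t : α
  r : Route
  j : Fin L
  b : Bool

namespace MicroState

variable {α : Type} {L : ℕ}

/-- States as tuples. -/
def equivProd : MicroState α L ≃ α × Route × Fin L × Bool where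
  toFun σ := (σ.t, σ.r, σ.j, σ.b)
  invFun x := ⟨x.1, x.2.1, x.2.2.1, x.2.2.2⟩
  left_inv _ := rfl
  right_inv _ := rfl

noncomputable instance [Fintype α] : Fintype (MicroState α L) := Fintype.ofEquiv _ equivProd.symm

theorem card_le [Fintype α] :
    Fintype.card (MicroState α L) ≤ Fintype.card α * (16 * (L * 2)) := by
  rw [Fintype.card_congr equivProd]
  simp only [Fintype.card_prod, Fintype.card_fin, Fintype.card_bool]
  gcongr
  exact (Fintype.card_subtype_le _).trans (by decide)

end MicroState

/-! ### The microtiles of a blueprint and how they stick. -/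

namespace Blueprint

variable {N : Neighborhood} {X : Type} {T : Finset (Tile N X)} (D : Blueprint T)

/-- The states of the microtiles of a blueprint. -/
abbrev State : Type := MicroState T D.size

/-- The glues: a direction together with a connection between two consecutive states (`none` for
the passage from a polyomino to the next one), or with a state which marks an unused side. -/
abbrev Glue : Type := {_g : vonNeumann.carrier × (Option D.State ⊕ D.State) // Nonempty T}

/-- The position of a state in its polyomino. -/
def place (σ : D.State) : Pos := D.loc σ.t σ.r σ.j σ.b

/-- The direction of the successor. -/
def outDir (σ : D.State) : Pos :=
  if (σ.j : ℕ) + 1 < D.len σ.r then D.loc σ.t σ.r (σ.j + 1) σ.b - D.loc σ.t σ.r σ.j σ.b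
  else σ.r.dst.dir

/-- The direction of the move from the predecessor. -/
def inDir (σ : D.State) : Pos :=
  if (σ.j : ℕ) = 0 then -σ.r.src.dir
  else D.loc σ.t σ.r σ.j σ.b - D.loc σ.t σ.r (σ.j - 1) σ.b

/-- The bit shared by the `j`-th cell and the next one. -/
def linkBit (r : Route) (j : ℕ) (b : Bool) : Bool := b && decide (D.slot r j = D.slot r (j + 1))

/-- The connection with the successor. -/
def outLab (σ : D.State) : Option D.State :=
  if (σ.j : ℕ) + 1 < D.len σ.r then some ⟨σ.t, σ.r, σ.j, D.linkBit σ.r σ.j σ.b⟩ else none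

/-- The connection with the predecessor. -/
def inLab (σ : D.State) : Option D.State :=
  if (σ.j : ℕ) = 0 then none
  else some ⟨σ.t, σ.r, ⟨σ.j - 1, by omega⟩, D.linkBit σ.r (σ.j - 1) σ.b⟩

/-- The states which occur in the polyominoes. -/
def Valid (σ : D.State) : Prop := (σ.j : ℕ) < D.len σ.r

open Classical in
/-- The microtile of a state. -/
noncomputable def microtile (σ : D.State) : Tile vonNeumann D.Glue := fun w =>
  ⟨if w.1 = D.outDir σ then (w, .inl (D.outLab σ))
    else if w.1 = -D.inDir σ then (⟨-w.1, vonNeumann.neg_mem w.2⟩, .inl (D.inLab σ))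
    else (w, .inr σ), ⟨σ.t⟩⟩

open Classical in
/-- The tile system of a blueprint. -/
noncomputable def tiles : Finset (Tile vonNeumann D.Glue) :=
  (Finset.univ.filter D.Valid).image D.microtile

/-- Of the four sides only two are used for entering and leaving; any other one displays the whole
state. -/
theorem microtile_injective : Function.Injective D.microtile := by
  intro σ σ' h
  obtain ⟨w, hw, h1, h2⟩ := exists_mem_vonNeumann_ne (D.outDir σ) (-D.inDir σ)
  have := congrArg (fun g : D.Glue => g.1.2) (congrFun h ⟨w, hw⟩)
  simp only [microtile, if_neg h1, if_neg h2] at this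
  split_ifs at this
  simpa using this

theorem card_tiles_le : D.tiles.card ≤ T.card * (32 * D.size) := by
  classical
  calc D.tiles.card ≤ (Finset.univ.filter D.Valid).card := Finset.card_image_le
    _ ≤ Fintype.card D.State := Finset.card_le_univ _
    _ ≤ T.card * (16 * (D.size * 2)) := by simpa using MicroState.card_le (α := T) (L := D.size)
    _ = _ := by ring

noncomputable instance : Fintype vonNeumann.carrier := vonNeumann.finite.fintype

theorem card_vonNeumann_le : Fintype.card vonNeumann.carrier ≤ 4 := by
  rw [← Set.toFinset_card, ← Set.ncard_eq_toFinset_card']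
  refine (Set.ncard_insert_le _ _).trans ?_
  refine Nat.succ_le_succ ((Set.ncard_insert_le _ _).trans ?_)
  refine Nat.succ_le_succ ((Set.ncard_insert_le _ _).trans ?_)
  simp

open Classical in
noncomputable instance : Fintype D.Glue :=
  inferInstanceAs (Fintype {_g : vonNeumann.carrier × (Option D.State ⊕ D.State) // Nonempty T})

/-- There are 4 directions, and `1 + 2 * (32 * D.size * |T|)` labels at most. The `Nonempty T`
clause in `Glue` leaves no glue when `T` is empty, which makes a bound proportional to `|T|`
possible. -/
theorem card_glue_le : Fintype.card D.Glue ≤ T.card * (4 * (1 + 64 * D.size)) := by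
  by_cases hT : Nonempty T
  · have h1 := MicroState.card_le (α := T) (L := D.size)
    have h2 := card_vonNeumann_le
    have h3 : 1 ≤ T.card := by
      obtain ⟨t⟩ := hT
      exact Finset.card_pos.2 ⟨t.1, t.2⟩
    refine (Fintype.card_subtype_le _).trans ?_
    simp only [Fintype.card_prod, Fintype.card_sum, Fintype.card_option, Fintype.card_coe] at *
    calc _ ≤ 4 * (T.card * (16 * (D.size * 2)) + 1 + T.card * (16 * (D.size * 2))) := by gcongr
      _ ≤ 4 * (T.card * (16 * (D.size * 2)) + T.card + T.card * (16 * (D.size * 2))) := by gcongr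
      _ = _ := by ring
  · have : IsEmpty D.Glue := ⟨fun g => hT g.2⟩
    simp

theorem mem_tiles {m : Tile vonNeumann D.Glue} :
    m ∈ D.tiles ↔ ∃ σ, D.Valid σ ∧ D.microtile σ = m := by
  simp [tiles]

/-- The state of a microtile. -/
noncomputable def stateOf (m : D.tiles) : D.State := (D.mem_tiles.1 m.2).choose

theorem microtile_stateOf (m : D.tiles) : D.microtile (D.stateOf m) = m :=
  (D.mem_tiles.1 m.2).choose_spec.2

theorem valid_stateOf (m : D.tiles) : D.Valid (D.stateOf m) :=
  (D.mem_tiles.1 m.2).choose_spec.1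

theorem stateOf_injective : Function.Injective D.stateOf := by
  intro m m' h
  apply Subtype.ext
  rw [← D.microtile_stateOf, ← D.microtile_stateOf m', h]

theorem exists_stateOf {σ : D.State} (h : D.Valid σ) : ∃ m : D.tiles, D.stateOf m = σ := by
  refine ⟨⟨D.microtile σ, D.mem_tiles.2 ⟨σ, h, rfl⟩⟩, ?_⟩
  exact D.microtile_injective (D.microtile_stateOf _)

/-- The state `σ'` may follow `σ` in the direction `w`. -/
def Next (σ σ' : D.State) (w : Pos) : Prop :=
  w = D.outDir σ ∧ w = D.inDir σ' ∧ D.outLab σ = D.inLab σ'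

/-- A used side records the direction of travel, and an unused side its own outward direction. Two
exits, two entrances, or two unused sides that face each other therefore differ in direction; a used
and an unused side differ in the kind of label. Only an exit can match an entrance. -/
theorem next_of_sticks {m m' : D.tiles} {w : Pos} (hw : w ∈ vonNeumann.carrier)
    (h : Sticks (m : Tile vonNeumann D.Glue) (m' : Tile vonNeumann D.Glue) w) :
    D.Next (D.stateOf m) (D.stateOf m') w ∨ D.Next (D.stateOf m') (D.stateOf m) (-w) := by
  have h := h hw
  rw [← D.microtile_stateOf m, ← D.microtile_stateOf m'] at h
  generalize D.stateOf m = σ at *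
  generalize D.stateOf m' = σ' at *
  have hne := ne_neg_of_mem_vonNeumann hw
  simp only [microtile, Subtype.mk.injEq] at h
  unfold Next
  split_ifs at h with h1 h2 h2 h2 h2 h2 h2 <;>
    simp only [Prod.mk.injEq, Subtype.mk.injEq, Sum.inl.injEq, neg_neg, reduceCtorEq, and_false,
      hne, hne.symm, false_and] at h
  · left
    refine ⟨h1, ?_, h.2⟩
    have := congrArg (- ·) ‹-w = -_›
    simpa using this
  · right
    refine ⟨h2, ?_, h.2.symm⟩
    rw [‹w = -_›, neg_neg]

/-- Exit and entrance use different sides: in the middle of a polyomino because its cells are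
distinct, at its ends because no cell lies just beyond a port (`inside`). Without this, the exit,
which `microtile` tests first, would hide the entrance. -/
theorem outDir_ne {σ : D.State} (h : D.Valid σ) : D.outDir σ ≠ -D.inDir σ := by
  have h2 := D.two_le_len σ.r
  unfold Valid at h
  unfold outDir inDir
  split_ifs with h3 h4 h4
  · intro e
    refine D.inside σ.t σ.r 1 σ.b σ.r.src (by omega) ?_
    have h5 := D.loc_first σ.t σ.r σ.b
    rw [neg_neg, h4, h5, zero_add] at e
    rw [← e]
    abel
  · intro e
    have e' : D.loc σ.t σ.r (σ.j + 1) σ.b = D.loc σ.t σ.r (σ.j - 1) σ.b := by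
      rw [neg_sub] at e
      exact sub_left_injective e
    have := D.inj σ.t σ.r (fun _ => σ.b) _ _ h3 (by omega) e'
    omega
  · omega
  · intro e
    refine D.inside σ.t σ.r (σ.j - 1) σ.b σ.r.dst (by omega) ?_
    have h5 := D.loc_last σ.t σ.r σ.b
    have h6 : (σ.j : ℕ) = D.len σ.r - 1 := by omega
    rw [neg_sub] at e
    rw [e, ← h5, ← h6]
    abel

theorem sticks_of_next {m m' : D.tiles} {w : Pos}
    (h : D.Next (D.stateOf m) (D.stateOf m') w) :
    Sticks (m : Tile vonNeumann D.Glue) (m' : Tile vonNeumann D.Glue) w := by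
  intro hw
  rw [← D.microtile_stateOf m, ← D.microtile_stateOf m']
  have h' := D.outDir_ne (D.valid_stateOf m')
  obtain ⟨h1, h2, h3⟩ := h
  have h4 : -w ≠ D.outDir (D.stateOf m') := by rw [h2]; exact h'.symm
  have h5 : -w = -D.inDir (D.stateOf m') := by rw [h2]
  simp only [microtile, if_pos h1, if_neg h4, if_pos h5, h3, neg_neg]

/-- The displacement of the reference point from a state to its successor. -/
def shift (σ : D.State) : Pos := if (σ.j : ℕ) + 1 < D.len σ.r then 0 else σ.r.dst.dir

/-- The label of the link determines tile, route and index. It also carries the bit if both cells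
share a slot; otherwise `indep` makes the position of the second cell independent of the bit. -/
theorem next_inner {σ σ' : D.State} {w : Pos} (h : D.Next σ σ' w)
    (hj : (σ.j : ℕ) + 1 < D.len σ.r) :
    σ'.t = σ.t ∧ σ'.r = σ.r ∧ (σ'.j : ℕ) = σ.j + 1 ∧ D.place σ' = D.place σ + w := by
  obtain ⟨h1, h2, h3⟩ := h
  rw [outLab, if_pos hj, inLab] at h3
  split_ifs at h3 with h4
  obtain ⟨t, r, ⟨j, hjL⟩, b⟩ := σ
  obtain ⟨t', r', ⟨j', hjL'⟩, b'⟩ := σ'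
  simp only [Option.some.injEq, MicroState.mk.injEq, Fin.mk.injEq] at h3 h4 hj
  obtain ⟨rfl, rfl, rfl, h3⟩ := h3
  refine ⟨rfl, rfl, by simp; omega, ?_⟩
  obtain ⟨i, rfl⟩ : ∃ i, j' = i + 1 := ⟨j' - 1, by omega⟩
  simp only [Nat.add_sub_cancel] at h3 hj h1
  simp only [place]
  rw [h1, outDir, if_pos hj]
  simp only [Nat.add_sub_cancel, add_sub_cancel]
  by_cases hs : D.slot r i = D.slot r (i + 1)
  · simp only [linkBit, hs, decide_true, Bool.and_true] at h3
    rw [h3]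
  · exact (D.indep _ _ _ _ _ hj hs).2

/-- The label `none` says nothing about the next tile. Only the direction is transmitted, and it
forces the entrance of the next polyomino onto the opposite side. As ports are common to all tiles,
the new polyomino is aligned with the grid of macrotiles. -/
theorem next_outer {σ σ' : D.State} {w : Pos} (hσ : D.Valid σ) (h : D.Next σ σ' w)
    (hj : ¬ (σ.j : ℕ) + 1 < D.len σ.r) :
    w = σ.r.dst.dir ∧ σ'.r.src = σ.r.dst.opp ∧ (σ'.j : ℕ) = 0 ∧
      (D.s : ℤ) • w + D.place σ' = D.place σ + w := by
  obtain ⟨h1, h2, h3⟩ := h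
  rw [outLab, if_neg hj, inLab] at h3
  split_ifs at h3 with h4
  rw [outDir, if_neg hj] at h1
  rw [inDir, if_pos h4] at h2
  have h5 : σ'.r.src = σ.r.dst.opp := by
    apply Port.dir_injective
    rw [Port.dir_opp, ← h1, h2, neg_neg]
  refine ⟨h1, h5, h4, ?_⟩
  have h6 := D.loc_last σ.t σ.r σ.b
  unfold Valid at hσ
  have h7 : (σ.j : ℕ) = D.len σ.r - 1 := by omega
  rw [place, place, h4, D.loc_first, h7, h6, h5, h1, D.port_opp]

theorem next_place {σ σ' : D.State} {w : Pos} (hσ : D.Valid σ) (h : D.Next σ σ' w) :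
    (D.s : ℤ) • D.shift σ + D.place σ' = D.place σ + w := by
  unfold shift
  split_ifs with hj
  · simpa using (D.next_inner h hj).2.2.2
  · obtain ⟨h1, -, -, h2⟩ := D.next_outer hσ h hj
    rw [← h1, h2]

end Blueprint

/-! ### Tiled paths described by their visits. -/

namespace TiledPath

universe w

variable {α : Type w}

/-- At the index `k`, the path is at the position `y`, which is labelled by `a`. -/
def Visits (p : TiledPath α) (k : ℤ) (y : Pos) (a : α) : Prop :=
  p.path k = some y ∧ p.tile y = some a

theorem path_eq_some_iff {p : TiledPath α} {k : ℤ} {y : Pos} :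
    p.path k = some y ↔ ∃ a, p.Visits k y a := by
  constructor
  · intro h
    obtain ⟨a, ha⟩ := Option.isSome_iff_exists.1 ((p.dom_tile y).2 ⟨k, h⟩)
    exact ⟨a, h, ha⟩
  · rintro ⟨a, h, -⟩
    exact h

theorem tile_eq_some_iff {p : TiledPath α} {y : Pos} {a : α} :
    p.tile y = some a ↔ ∃ k, p.Visits k y a := by
  constructor
  · intro h
    obtain ⟨k, hk⟩ := (p.dom_tile y).1 (by simp [h])
    exact ⟨k, hk, h⟩
  · rintro ⟨k, -, h⟩
    exact h

theorem mem_dom_iff {p : TiledPath α} {k : ℤ} : k ∈ p.dom ↔ ∃ y a, p.Visits k y a := by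
  simp only [dom, Set.mem_ofPred_eq, Option.isSome_iff_exists, path_eq_some_iff]

theorem Visits.unique {p : TiledPath α} {k : ℤ} {y y' : Pos} {a a' : α} (h : p.Visits k y a)
    (h' : p.Visits k y' a') : y = y' ∧ a = a' := by
  have h1 : y = y' := Option.some_injective _ (h.1.symm.trans h'.1)
  subst h1
  exact ⟨rfl, Option.some_injective _ (h.2.symm.trans h'.2)⟩

theorem mem_dom_of_le {p : TiledPath α} {i j k : ℤ} (hi : i ∈ p.dom) (hk : k ∈ p.dom)
    (hij : i ≤ j) (hjk : j ≤ k) : j ∈ p.dom :=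
  p.ordConnected_dom.out hi hk ⟨hij, hjk⟩

/-- An injective tiled path from its set of visits. -/
theorem exists_of_rel (E : ℤ → Pos → α → Prop)
    (func : ∀ k y y' a a', E k y a → E k y' a' → y = y' ∧ a = a')
    (inj : ∀ k k' y a a', E k y a → E k' y a' → k = k')
    (ord : Set.OrdConnected {k : ℤ | ∃ y a, E k y a})
    (adj : ∀ k y y' a a', E k y a → E (k + 1) y' a' → y' - y ∈ vonNeumann.carrier) :
    ∃ p : TiledPath α, p.Injective ∧ ∀ k y a, p.Visits k y a ↔ E k y a := by
  classical
  have hpath : ∀ k, ∃ o : Option Pos, ∀ y, o = some y ↔ ∃ a, E k y a := by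
    intro k
    by_cases h : ∃ y a, E k y a
    · obtain ⟨y, a, h⟩ := h
      refine ⟨some y, fun y' => ⟨?_, ?_⟩⟩
      · rintro ⟨⟩
        exact ⟨a, h⟩
      · rintro ⟨a', h'⟩
        rw [(func _ _ _ _ _ h h').1]
    · refine ⟨none, fun y' => ⟨by simp, fun ⟨a, h'⟩ => (h ⟨y', a, h'⟩).elim⟩⟩
  have htile : ∀ y, ∃ o : Option α, ∀ a, o = some a ↔ ∃ k, E k y a := by
    intro y
    by_cases h : ∃ a k, E k y a
    · obtain ⟨a, k, h⟩ := h
      refine ⟨some a, fun a' => ⟨?_, ?_⟩⟩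
      · rintro ⟨⟩
        exact ⟨k, h⟩
      · rintro ⟨k', h'⟩
        obtain rfl := inj _ _ _ _ _ h h'
        rw [(func _ _ _ _ _ h h').2]
    · refine ⟨none, fun a' => ⟨by simp, fun ⟨k, h'⟩ => (h ⟨a', k, h'⟩).elim⟩⟩
  choose path hpath using hpath
  choose tile htile using htile
  refine ⟨⟨path, tile, ?_, ?_, ?_⟩, ?_, ?_⟩
  · simpa only [Option.isSome_iff_exists, hpath] using ord
  · intro k x y hx hy
    obtain ⟨a, ha⟩ := (hpath _ _).1 hx
    obtain ⟨a', ha'⟩ := (hpath _ _).1 hy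
    exact adj _ _ _ _ _ ha ha'
  · intro x
    simp only [Option.isSome_iff_exists, hpath, htile]
    exact ⟨fun ⟨a, k, h⟩ => ⟨k, a, h⟩, fun ⟨k, a, h⟩ => ⟨a, k, h⟩⟩
  · intro i j x hi hj
    obtain ⟨a, ha⟩ := (hpath _ _).1 hi
    obtain ⟨a', ha'⟩ := (hpath _ _).1 hj
    exact inj _ _ _ _ _ ha ha'
  · intro k y a
    change path k = some y ∧ tile y = some a ↔ _
    rw [hpath, htile]
    constructor
    · rintro ⟨⟨a', h⟩, ⟨k', h'⟩⟩
      obtain rfl := inj _ _ _ _ _ h h'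
      rw [(func _ _ _ _ _ h h').2] at h
      exact h
    · exact fun h => ⟨⟨a, h⟩, ⟨k, h⟩⟩

/-- The empty tiled path. -/
def empty (α : Type w) : TiledPath α where
  path _ := none
  tile _ := none
  ordConnected_dom := by simpa using Set.ordConnected_empty
  adjacent := by simp
  dom_tile := by simp

end TiledPath

theorem isRibbon_iff {X : Type} {T : Finset (Tile vonNeumann X)} {p : TiledPath T} :
    IsRibbon p ↔ p.Injective ∧ ∀ k y y' m m', p.Visits k y m → p.Visits (k + 1) y' m' →
      Sticks (m : Tile vonNeumann X) (m' : Tile vonNeumann X) (y' - y) :=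
  and_congr_right fun _ => ⟨fun h k y y' m m' h1 h2 => h k y y' m m' h1.1 h2.1 h1.2 h2.2,
    fun h k y y' m m' h1 h2 h3 h4 => h k y y' m m' ⟨h1, h3⟩ ⟨h2, h4⟩⟩

/-! ### Complete polyominoes inside a ribbon. -/

namespace Blueprint

open TiledPath

variable {N : Neighborhood} {X : Type} {T : Finset (Tile N X)} (D : Blueprint T)

theorem smul_injective {x y : Pos} (h : (D.s : ℤ) • x = (D.s : ℤ) • y) : x = y :=
  smul_right_injective Pos (by exact_mod_cast D.s_pos.ne' : (D.s : ℤ) ≠ 0) h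

/-- At the index `k`, the tiled path is at the position `y`, in the state `σ`. -/
def At (p : TiledPath D.tiles) (k : ℤ) (y : Pos) (σ : D.State) : Prop :=
  ∃ m, p.Visits k y m ∧ D.stateOf m = σ

variable {D}

theorem At.unique {p : TiledPath D.tiles} {k : ℤ} {y y' : Pos} {σ σ' : D.State}
    (h : D.At p k y σ) (h' : D.At p k y' σ') : y = y' ∧ σ = σ' := by
  obtain ⟨m, h, rfl⟩ := h
  obtain ⟨m', h', rfl⟩ := h'
  obtain ⟨rfl, rfl⟩ := h.unique h'
  exact ⟨rfl, rfl⟩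

theorem At.valid {p : TiledPath D.tiles} {k : ℤ} {y : Pos} {σ : D.State}
    (h : D.At p k y σ) : D.Valid σ := by
  obtain ⟨m, -, rfl⟩ := h
  exact D.valid_stateOf m

theorem At.path {p : TiledPath D.tiles} {k : ℤ} {y : Pos} {σ : D.State}
    (h : D.At p k y σ) : p.path k = some y := by
  obtain ⟨m, h, rfl⟩ := h
  exact h.1

theorem At.mem_dom {p : TiledPath D.tiles} {k : ℤ} {y : Pos} {σ : D.State}
    (h : D.At p k y σ) : k ∈ p.dom := by
  obtain ⟨m, h, rfl⟩ := h
  exact mem_dom_iff.2 ⟨_, _, h⟩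

theorem exists_at {p : TiledPath D.tiles} {k : ℤ} (h : k ∈ p.dom) : ∃ y σ, D.At p k y σ := by
  obtain ⟨y, m, h⟩ := mem_dom_iff.1 h
  exact ⟨y, _, m, h, rfl⟩

theorem At.index_eq {p : TiledPath D.tiles} (hp : p.Injective) {k k' : ℤ} {y : Pos}
    {σ σ' : D.State} (h : D.At p k y σ) (h' : D.At p k' y σ') : k = k' ∧ σ = σ' := by
  obtain rfl := hp _ _ _ h.path h'.path
  exact ⟨rfl, (h.unique h').2⟩

variable (D)

/-- A complete copy of the polyomino of `t` along `r`, with its reference point on the macrotile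
`x`, starts at the index `k` of `p`. -/
def Occ (p : TiledPath D.tiles) (k : ℤ) (x : Pos) (t : T) (r : Route) : Prop :=
  ∀ i < D.len r, ∃ σ : D.State, D.At p (k + i) ((D.s : ℤ) • x + D.place σ) σ ∧
    σ.t = t ∧ σ.r = r ∧ (σ.j : ℕ) = i

/-- The polyominoes of `t` along `r`. -/
def IsPolyomino (t : T) (r : Route) (π : TiledPath D.tiles) : Prop :=
  IsRibbon π ∧ π.dom = Set.Ico 0 (D.len r : ℤ) ∧ D.Occ π 0 0 t r

/-- The polyominoes of a tile. -/
def polyominoes (t : T) : Set (TiledPath D.tiles) := {π | ∃ r, D.IsPolyomino t r π}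

/-- The poly-ribbons which simulate a zipper. -/
def simulations (z : {z : TiledPath T // IsZipper z}) : Set (TiledPath (TiledPath D.tiles)) :=
  {R | IsPolyRibbon D.s R ∧ R.path = z.1.path ∧
    (∀ (x : Pos) (t : T) (π : TiledPath D.tiles), z.1.tile x = some t → R.tile x = some π →
      π ∈ D.polyominoes t) ∧
    ∃ p : TiledPath D.tiles, IsRibbon p ∧ IsChi D.s D.polyominoes p R}

variable {D} {p : TiledPath D.tiles} {k k' : ℤ} {x x' : Pos} {t t' : T} {r r' : Route}

theorem Occ.at_zero (h : D.Occ p k x t r) :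
    ∃ σ : D.State, D.At p k ((D.s : ℤ) • x + D.place σ) σ ∧
      σ.t = t ∧ σ.r = r ∧ (σ.j : ℕ) = 0 := by
  have h2 := D.two_le_len r
  simpa using h 0 (by omega)

theorem Occ.unique (h : D.Occ p k x t r) (h' : D.Occ p k x' t' r') :
    x = x' ∧ t = t' ∧ r = r' := by
  obtain ⟨σ, h1, h2, h3, h4⟩ := h.at_zero
  obtain ⟨σ', h1', h2', h3', h4'⟩ := h'.at_zero
  obtain ⟨h5, rfl⟩ := h1.unique h1'
  exact ⟨D.smul_injective (add_right_cancel h5), h2.symm.trans h2', h3.symm.trans h3'⟩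

/-- Every polyomino covers its reference point, whatever its route and bits, and an injective path
visits this point once. The state found there gives the offset to the start of the polyomino. -/
theorem Occ.index_eq (hp : p.Injective) (h : D.Occ p k x t r) (h' : D.Occ p k' x t' r') :
    k = k' := by
  obtain ⟨i, hi, hi0⟩ := D.ref t r
  obtain ⟨i', hi', hi0'⟩ := D.ref t' r'
  obtain ⟨σ, h1, rfl, rfl, rfl⟩ := h i hi
  obtain ⟨σ', h1', rfl, rfl, rfl⟩ := h' i' hi'
  rw [place, hi0] at h1
  rw [place, hi0'] at h1'
  obtain ⟨h2, rfl⟩ := h1.index_eq hp h1'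
  omega

theorem IsPolyomino.occ {π : TiledPath D.tiles} (h : D.IsPolyomino t r π)
    (ho : π.OccursIn p ((D.s : ℤ) • x) k) : D.Occ p k x t r := by
  intro i hi
  obtain ⟨σ, ⟨m, h1, rfl⟩, h2⟩ := h.2.2 i hi
  simp only [smul_zero, zero_add] at h1
  obtain ⟨h3, h4⟩ := ho _ _ h1.1
  exact ⟨_, ⟨m, ⟨h3, h4.trans h1.2⟩, rfl⟩, h2⟩

theorem Occ.exists_polyomino (hp : IsRibbon p) (h : D.Occ p k x t r) :
    ∃ π, D.IsPolyomino t r π ∧ π.OccursIn p ((D.s : ℤ) • x) k := by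
  have hp' := isRibbon_iff.1 hp
  have hdom : ∀ i : ℤ, 0 ≤ i → i < D.len r →
      ∃ y m, p.Visits (k + i) ((D.s : ℤ) • x + y) m := by
    intro i h0 hi
    obtain ⟨i, rfl⟩ := Int.eq_ofNat_of_zero_le h0
    obtain ⟨σ, ⟨m, h1, -⟩, -⟩ := h i (by exact_mod_cast hi)
    exact ⟨_, m, h1⟩
  obtain ⟨π, hπ, hE⟩ := exists_of_rel (α := D.tiles)
    (fun i y m => (0 ≤ i ∧ i < D.len r) ∧ p.Visits (k + i) ((D.s : ℤ) • x + y) m)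
    (fun i y y' m m' h1 h2 => by simpa using h1.2.unique h2.2)
    (fun i i' y m m' h1 h2 => by simpa using hp.1 _ _ _ h1.2.1 h2.2.1)
    (by
      constructor
      rintro i ⟨y, m, ⟨h1, h2⟩, h3⟩ i' ⟨y', m', ⟨h1', h2'⟩, h3'⟩ j ⟨hj, hj'⟩
      obtain ⟨y, m, h⟩ := hdom j (by omega) (by omega)
      exact ⟨y, m, ⟨by omega, by omega⟩, h⟩)
    (fun i y y' m m' h1 h2 => by
      have := p.adjacent (k + i) _ _ h1.2.1 (by rw [add_assoc]; exact h2.2.1)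
      simpa using this)
  refine ⟨π, ⟨isRibbon_iff.2 ⟨hπ, ?_⟩, ?_, ?_⟩, ?_⟩
  · intro i y y' m m' h1 h2
    rw [hE] at h1 h2
    have := hp'.2 (k + i) _ _ _ _ h1.2 (by rw [add_assoc]; exact h2.2)
    simpa using this
  · ext i
    simp only [mem_dom_iff, hE, Set.mem_Ico]
    exact ⟨fun ⟨_, _, h, _⟩ => h, fun ⟨h1, h2⟩ =>
      let ⟨y, m, h3⟩ := hdom i h1 h2
      ⟨y, m, ⟨h1, h2⟩, h3⟩⟩
  · intro i hi
    obtain ⟨σ, ⟨m, h1, h1'⟩, h2⟩ := h i hi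
    refine ⟨σ, ⟨m, (hE _ _ _).2 ⟨⟨by omega, by omega⟩, ?_⟩, h1'⟩, h2⟩
    simpa using h1
  · intro i y hy
    obtain ⟨m, hm⟩ := path_eq_some_iff.1 hy
    have := (hE _ _ _).1 hm
    exact ⟨this.2.1, this.2.2.trans hm.2.symm⟩

theorem mem_keptIndices (hp : IsRibbon p) {l : ℤ} :
    l ∈ keptIndices D.s D.polyominoes p ↔
      ∃ k x t r, D.Occ p k x t r ∧ ∃ i < D.len r, l = k + (i : ℕ) := by
  constructor
  · rintro ⟨t, π, x, k, j, ⟨r, hπ⟩, ho, hj, rfl⟩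
    refine ⟨k, x, t, r, hπ.occ ho, j.toNat, ?_⟩
    rw [hπ.2.1, Set.mem_Ico] at hj
    omega
  · rintro ⟨k, x, t, r, h, i, hi, rfl⟩
    obtain ⟨π, hπ, ho⟩ := h.exists_polyomino hp
    refine ⟨t, π, x, k, i, ⟨r, hπ⟩, ho, ?_, rfl⟩
    rw [hπ.2.1, Set.mem_Ico]
    omega

theorem isGreatest_dom {π : TiledPath D.tiles} (h : D.IsPolyomino t r π) :
    IsGreatest π.dom ((D.len r : ℤ) - 1) := by
  have h2 := D.two_le_len r
  rw [h.2.1]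
  exact ⟨by rw [Set.mem_Ico]; omega, fun i hi => by rw [Set.mem_Ico] at hi; omega⟩

theorem isLeast_dom {π : TiledPath D.tiles} (h : D.IsPolyomino t r π) : IsLeast π.dom 0 := by
  have h2 := D.two_le_len r
  rw [h.2.1]
  exact ⟨by rw [Set.mem_Ico]; omega, fun i hi => by rw [Set.mem_Ico] at hi; omega⟩

/-- If the complete polyominoes of a ribbon follow each other along a zipper, then the ribbon
simulates this zipper. -/
theorem exists_isChi (hp : IsRibbon p) (z : {z : TiledPath T // IsZipper z}) (c : ℤ → ℤ)
    (hc : ∀ i x t, z.1.Visits i x t → ∃ r, D.Occ p (c i) x t r ∧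
      ∀ y, z.1.path (i + 1) = some y → c (i + 1) = c i + D.len r)
    (hc' : ∀ k x t r, D.Occ p k x t r → ∃ i, z.1.path i = some x ∧ c i = k) :
    ∃ R ∈ D.simulations z, IsChi D.s D.polyominoes p R := by
  have hp' := isRibbon_iff.1 hp
  have hex : ∀ x, ∃ π, ∀ i t, z.1.Visits i x t → ∃ r, D.IsPolyomino t r π ∧
      π.OccursIn p ((D.s : ℤ) • x) (c i) ∧
      ∀ y, z.1.path (i + 1) = some y → c (i + 1) = c i + D.len r := by
    intro x
    by_cases h : ∃ i t, z.1.Visits i x t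
    · obtain ⟨i, t, h⟩ := h
      obtain ⟨r, h1, h2⟩ := hc _ _ _ h
      obtain ⟨π, h3, h4⟩ := h1.exists_polyomino hp
      refine ⟨π, fun i' t' h' => ?_⟩
      obtain rfl := z.2.1 _ _ _ h.1 h'.1
      obtain ⟨-, rfl⟩ := h.unique h'
      exact ⟨r, h3, h4, h2⟩
    · exact ⟨empty _, fun i t h' => (h ⟨i, t, h'⟩).elim⟩
  choose Q hQ using hex
  obtain ⟨R, hR, hE⟩ := exists_of_rel (α := TiledPath D.tiles)
    (fun i x π => z.1.path i = some x ∧ π = Q x)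
    (fun i y y' m m' h1 h2 => by
      have : y = y' := Option.some_injective _ (h1.1.symm.trans h2.1)
      subst this
      exact ⟨rfl, h1.2.trans h2.2.symm⟩)
    (fun i i' y m m' h1 h2 => z.2.1 _ _ _ h1.1 h2.1)
    (by
      have := z.1.ordConnected_dom
      simpa only [Option.isSome_iff_exists, exists_and_left, exists_eq, and_true] using this)
    (fun i y y' m m' h1 h2 => z.1.adjacent _ _ _ h1.1 h2.1)
  have hpath : R.path = z.1.path := by
    funext i
    ext x
    rw [path_eq_some_iff]
    simp [hE]
  have htile : ∀ x π, R.tile x = some π → ∃ i t r, z.1.Visits i x t ∧ D.IsPolyomino t r π ∧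
      π.OccursIn p ((D.s : ℤ) • x) (c i) ∧
      ∀ y, z.1.path (i + 1) = some y → c (i + 1) = c i + D.len r := by
    intro x π h
    obtain ⟨i, hi⟩ := tile_eq_some_iff.1 h
    obtain ⟨h1, rfl⟩ := (hE _ _ _).1 hi
    obtain ⟨t, ht⟩ := path_eq_some_iff.1 h1
    obtain ⟨r, h2⟩ := hQ _ _ _ ht
    exact ⟨i, t, r, ht, h2⟩
  have hvis : ∀ i x π, R.path i = some x → R.tile x = some π → ∃ t r, z.1.Visits i x t ∧
      D.IsPolyomino t r π ∧ π.OccursIn p ((D.s : ℤ) • x) (c i) ∧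
      ∀ y, z.1.path (i + 1) = some y → c (i + 1) = c i + D.len r := by
    intro i x π h h'
    obtain ⟨i', t, r, h1, h2⟩ := htile x π h'
    rw [hpath] at h
    obtain rfl := z.2.1 _ _ _ h h1.1
    exact ⟨t, r, h1, h2⟩
  have hchi : IsChi D.s D.polyominoes p R := by
    refine ⟨c, ?_, ?_, ?_⟩
    · intro i x π h h'
      obtain ⟨t, r, h1, h2, h3, -⟩ := hvis _ _ _ h h'
      exact h3
    · intro i x y π π' j j' hx hy hπ hπ' hj hj'
      obtain ⟨t, r, h1, h2, h3, h4⟩ := hvis _ _ _ hx hπ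
      obtain ⟨t', r', h1', h2', h3', h4'⟩ := hvis _ _ _ hy hπ'
      rw [hj.unique (isGreatest_dom h2), hj'.unique (isLeast_dom h2'), h4 y (hpath ▸ hy)]
      ring
    · intro l
      rw [mem_keptIndices hp]
      constructor
      · rintro ⟨k, x, t, r, h, i, hi, rfl⟩
        obtain ⟨a, h1, rfl⟩ := hc' _ _ _ _ h
        obtain ⟨t', ht'⟩ := path_eq_some_iff.1 h1
        obtain ⟨r', h2, h3, h4⟩ := hQ _ _ _ ht'
        obtain ⟨-, rfl, rfl⟩ := h.unique (h2.occ h3)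
        refine ⟨a, x, Q x, i, hpath ▸ h1, ((hE _ _ _).2 ⟨h1, rfl⟩).2, ?_, rfl⟩
        rw [h2.2.1, Set.mem_Ico]
        omega
      · rintro ⟨i, x, π, j, h, h', hj, rfl⟩
        obtain ⟨t, r, h1, h2, h3, -⟩ := hvis _ _ _ h h'
        rw [h2.2.1, Set.mem_Ico] at hj
        exact ⟨_, _, _, _, h2.occ h3, j.toNat, by omega, by omega⟩
  refine ⟨R, ⟨⟨hR, ?_, ?_, ?_⟩, hpath, ?_, p, hp, hchi⟩, hchi⟩
  · intro x π h
    obtain ⟨i, t, r, h1, h2, -⟩ := htile _ _ h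
    exact ⟨h2.1, h2.2.1 ▸ Set.finite_Ico _ _⟩
  -- A common cell has a single index in `p` and a single state, hence the same offset in both
  -- polyominoes. Both then start at the same index, and `Occ.unique` identifies their macrotiles.
  · intro x y π π' hxy hx hy a b ha hb e
    obtain ⟨i, t, r, h1, h2, h3, -⟩ := htile _ _ hx
    obtain ⟨i', t', r', h1', h2', h3', -⟩ := htile _ _ hy
    obtain ⟨j, hj⟩ := (π.dom_tile a).1 ha
    obtain ⟨j', hj'⟩ := (π'.dom_tile b).1 hb
    have h4 := (h3 _ _ hj).1
    have h4' := (h3' _ _ hj').1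
    rw [← e] at h4'
    have h5 := hp.1 _ _ _ h4 h4'
    have hj0 : j ∈ π.dom := by simp [dom, hj]
    have hj0' : j' ∈ π'.dom := by simp [dom, hj']
    rw [h2.2.1, Set.mem_Ico] at hj0
    rw [h2'.2.1, Set.mem_Ico] at hj0'
    obtain ⟨σ, h6, -, -, h7⟩ := (h2.occ h3) j.toNat (by omega)
    obtain ⟨σ', h6', -, -, h7'⟩ := (h2'.occ h3') j'.toNat (by omega)
    rw [Int.toNat_of_nonneg hj0.1] at h6
    rw [Int.toNat_of_nonneg hj0'.1, ← h5] at h6'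
    obtain ⟨-, rfl⟩ := h6.unique h6'
    have h8 : j = j' := by omega
    have h9 : c i = c i' := by omega
    have h10 := h2'.occ h3'
    rw [← h9] at h10
    exact hxy ((h2.occ h3).unique h10).1
  · intro i x y π π' hx hy hπ hπ'
    obtain ⟨t, r, h1, h2, h3, h4⟩ := hvis _ _ _ hx hπ
    obtain ⟨t', r', h1', h2', h3', h4'⟩ := hvis _ _ _ hy hπ'
    obtain ⟨a, m, ha⟩ := mem_dom_iff.1 (isGreatest_dom h2).1
    obtain ⟨b, m', hb⟩ := mem_dom_iff.1 (isLeast_dom h2').1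
    have h5 := h3 _ _ ha.1
    have h6 := h3' _ _ hb.1
    have h7 : c (i + 1) + 0 = c i + ((D.len r : ℤ) - 1) + 1 := by
      rw [h4 y (hpath ▸ hy)]
      ring
    rw [h7] at h6
    exact ⟨_, _, a, b, m, m', isGreatest_dom h2, ha.1, ha.2, isLeast_dom h2', hb.1, hb.2,
      p.adjacent _ _ _ h5.1 h6.1,
      hp'.2 _ _ _ _ _ ⟨h5.1, h5.2.trans ha.2⟩ ⟨h6.1, h6.2.trans hb.2⟩⟩
  · intro x t π hx hπ
    obtain ⟨i, t', r, h1, h2, -⟩ := htile _ _ hπ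
    have : t' = t := Option.some_injective _ (h1.2.symm.trans hx)
    subst this
    exact ⟨r, h2⟩

end Blueprint

/-! ### Integer sequences -/

/-- Paths may be infinite in both directions, so sums are taken from `0` upwards and downwards. This
yields the starting indices of polyominoes when encoding and a counter of polyominoes when decoding.
-/
theorem Int.exists_antidifference (δ : ℤ → ℤ) : ∃ f : ℤ → ℤ, ∀ k, f (k + 1) = f k + δ k := by
  refine ⟨fun k => ∑ i ∈ Finset.range k.toNat, δ i -
    ∑ i ∈ Finset.range (-k).toNat, δ (-(i + 1)), fun k => ?_⟩
  rcases le_or_gt 0 k with h | h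
  · have h1 : (k + 1).toNat = k.toNat + 1 := by omega
    have h2 : (-k).toNat = 0 := by omega
    have h3 : (-(k + 1)).toNat = 0 := by omega
    have h4 : ((k.toNat : ℕ) : ℤ) = k := by omega
    simp only [h1, h2, h3, Finset.sum_range_succ, h4]
    simp
  · have h1 : (k + 1).toNat = 0 := by omega
    have h2 : (-k).toNat = (-(k + 1)).toNat + 1 := by omega
    have h3 : k.toNat = 0 := by omega
    have h4 : -(((-(k + 1)).toNat : ℤ) + 1) = k := by omega
    simp only [h1, h2, h3, Finset.sum_range_succ, h4]
    simp

theorem Set.OrdConnected.int_propagate {S : Set ℤ} (hS : S.OrdConnected) {P : ℤ → Prop}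
    (h : ∀ k ∈ S, k + 1 ∈ S → (P k ↔ P (k + 1))) {k₀ : ℤ} (h₀ : k₀ ∈ S) (hP : P k₀) :
    ∀ k ∈ S, P k := by
  have hup : ∀ n : ℕ, k₀ + n ∈ S → P (k₀ + n) := by
    intro n
    induction n with
    | zero => simpa using fun _ : k₀ ∈ S => hP
    | succ n ih =>
      intro hn
      have h1 : k₀ + n ∈ S := hS.out h₀ hn ⟨by omega, by push_cast; omega⟩
      push_cast at hn ⊢
      rw [← add_assoc] at hn ⊢
      exact (h _ h1 hn).1 (ih h1)
  have hdown : ∀ n : ℕ, k₀ - n ∈ S → P (k₀ - n) := by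
    intro n
    induction n with
    | zero => simpa using fun _ : k₀ ∈ S => hP
    | succ n ih =>
      intro hn
      have h1 : k₀ - n ∈ S := hS.out hn h₀ ⟨by push_cast; omega, by omega⟩
      have h2 : k₀ - (n + 1 : ℕ) + 1 = k₀ - n := by push_cast; ring
      exact (h _ hn (by rwa [h2])).2 (by rw [h2]; exact ih h1)
  intro k hk
  rcases le_or_gt k₀ k with h1 | h1
  · obtain ⟨n, hn⟩ := Int.eq_ofNat_of_zero_le (sub_nonneg.2 h1)
    obtain rfl : k = k₀ + n := by omega
    exact hup n hk
  · obtain ⟨n, hn⟩ := Int.eq_ofNat_of_zero_le (sub_nonneg.2 h1.le)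
    obtain rfl : k = k₀ - n := by omega
    exact hdown n hk

theorem Set.OrdConnected.exists_eq_add {S : Set ℤ} (hS : S.OrdConnected) {f : ℤ → ℤ}
    (h : ∀ k ∈ S, k + 1 ∈ S → f (k + 1) = f k + 1) : ∃ d, ∀ k ∈ S, f k = k + d := by
  rcases S.eq_empty_or_nonempty with rfl | ⟨k₀, h₀⟩
  · exact ⟨0, by simp⟩
  · refine ⟨f k₀ - k₀, hS.int_propagate (fun k hk hk' => ?_) h₀ (by ring)⟩
    rw [h k hk hk']
    constructor <;> intro <;> omega

namespace Blueprint

open TiledPath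

variable {N : Neighborhood} {X : Type} {T : Finset (Tile N X)} {D : Blueprint T}
  {p : TiledPath D.tiles} {k k' : ℤ} {x x' y y' : Pos} {t t' : T} {r r' : Route} {σ σ' : D.State}

/-! ### Decoding -/

/-- A converse of `exists_isChi`: the shifts provided by `IsChi` are the starting indices of the
complete polyominoes, and every complete polyomino of `p` is among them because its first index is
kept. -/
theorem exists_of_isChi {z : {z : TiledPath T // IsZipper z}} (hp : IsRibbon p)
    (h : ∃ R ∈ D.simulations z, IsChi D.s D.polyominoes p R) : ∃ c : ℤ → ℤ,
    (∀ i x t, z.1.Visits i x t → ∃ r, D.Occ p (c i) x t r ∧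
      ∀ y, z.1.path (i + 1) = some y → c (i + 1) = c i + D.len r) ∧
    ∀ k x t r, D.Occ p k x t r → ∃ i, z.1.path i = some x ∧ c i = k := by
  obtain ⟨R, ⟨hR, hpath, hφ, -⟩, c, h1, h2, h3⟩ := h
  have hvis : ∀ i x t, z.1.Visits i x t → ∃ π r, R.path i = some x ∧ R.tile x = some π ∧
      D.IsPolyomino t r π ∧ D.Occ p (c i) x t r := by
    intro i x t h
    have hi : R.path i = some x := hpath ▸ h.1
    obtain ⟨π, hπ⟩ := path_eq_some_iff.1 hi
    obtain ⟨r, hr⟩ := hφ _ _ _ h.2 hπ.2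
    exact ⟨π, r, hi, hπ.2, hr, hr.occ (h1 _ _ _ hi hπ.2)⟩
  refine ⟨c, ?_, ?_⟩
  · intro i x t h
    obtain ⟨π, r, hi, hπ, hr, ho⟩ := hvis _ _ _ h
    refine ⟨r, ho, fun y hy => ?_⟩
    obtain ⟨t', ht'⟩ := path_eq_some_iff.1 hy
    obtain ⟨π', r', hi', hπ', hr', ho'⟩ := hvis _ _ _ ht'
    have := h2 _ _ _ _ _ _ _ hi hi' hπ hπ' (isGreatest_dom hr) (isLeast_dom hr')
    omega
  · intro k x t r ho
    have h4 := (D.two_le_len r)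
    obtain ⟨i, y, π, j, hi, hπ, hj, hk⟩ := (h3 k).1
      ((mem_keptIndices hp).2 ⟨k, x, t, r, ho, 0, by omega, by simp⟩)
    obtain ⟨t', ht'⟩ := path_eq_some_iff.1 (hpath ▸ hi : z.1.path i = some y)
    obtain ⟨π', r', hi', hπ', hr', ho'⟩ := hvis _ _ _ ht'
    obtain rfl : π = π' := Option.some_injective _ (hπ.symm.trans hπ')
    rw [hr'.2.1, Set.mem_Ico] at hj
    obtain ⟨σ, h5, -, -, h6⟩ := ho' j.toNat (by omega)
    obtain ⟨σ', h5', -, -, h6'⟩ := ho.at_zero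
    rw [Int.toNat_of_nonneg hj.1, ← hk] at h5
    obtain ⟨-, rfl⟩ := h5.unique h5'
    have h7 : c i = k := by omega
    rw [h7] at ho'
    obtain ⟨rfl, -⟩ := ho.unique ho'
    exact ⟨i, hpath ▸ hi, h7⟩

/-- The simulated zipper has at index `i` the tile of the complete polyomino whose counter is `i`.
The hypotheses say that counters number these polyominoes without repetition or gap, and that
successive numbers belong to polyominoes that follow each other in `p`. -/
theorem decode_of_counter (hp : IsRibbon p) (f : ℤ → ℤ)
    (hinj : ∀ k x t r k' x' t' r', D.Occ p k x t r → D.Occ p k' x' t' r' → f k = f k' → k = k')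
    (hnext : ∀ k x t r k' x' t' r', D.Occ p k x t r → D.Occ p k' x' t' r' → f k' = f k + 1 →
      k' = k + D.len r ∧ x' - x ∈ vonNeumann.carrier)
    (hlen : ∀ k x t r x' t' r', D.Occ p k x t r → D.Occ p (k + D.len r) x' t' r' →
      f (k + D.len r) = f k + 1)
    (hord : Set.OrdConnected {i | ∃ k x t r, D.Occ p k x t r ∧ f k = i}) :
    ∃ z, (∃ R ∈ D.simulations z, IsChi D.s D.polyominoes p R) ∧
      ∀ z', (∃ R ∈ D.simulations z', IsChi D.s D.polyominoes p R) → z'.1.Reindexing z.1 := by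
  obtain ⟨z, hz, hE⟩ := exists_of_rel (α := T)
    (fun i x t => ∃ k r, D.Occ p k x t r ∧ f k = i)
    (by
      rintro i x x' t t' ⟨k, r, h, rfl⟩ ⟨k', r', h', e⟩
      obtain rfl := hinj _ _ _ _ _ _ _ _ h' h e
      exact ⟨(h.unique h').1, (h.unique h').2.1⟩)
    (by
      rintro _ _ x t t' ⟨k, r, h, rfl⟩ ⟨k', r', h', rfl⟩
      rw [h.index_eq hp.1 h'])
    (by
      convert hord using 2
      ext i
      exact ⟨fun ⟨x, t, k, r, h⟩ => ⟨k, x, t, r, h⟩, fun ⟨k, x, t, r, h⟩ => ⟨x, t, k, r, h⟩⟩)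
    (by
      rintro _ x x' t t' ⟨k, r, h, rfl⟩ ⟨k', r', h', e⟩
      exact (hnext _ _ _ _ _ _ _ _ h h' e).2)
  have hzip : IsZipper z := by
    refine ⟨hz, fun x y t t' hx hy => ?_⟩
    obtain ⟨i, hi⟩ := tile_eq_some_iff.1 hx
    obtain ⟨i', hi'⟩ := tile_eq_some_iff.1 hy
    obtain ⟨k, r, h, -⟩ := (hE _ _ _).1 hi
    obtain ⟨k', r', h', -⟩ := (hE _ _ _).1 hi'
    by_contra hs
    -- Non-matching tiles would make `p` visit one position in both polyominoes. By injectivity the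
    -- two visits coincide, in index and in state.
    obtain ⟨a, ha, b, hb, hab⟩ := D.sound t t' (y - x) hs r r'
    obtain ⟨σ, h1, rfl, rfl, rfl⟩ := h a ha
    obtain ⟨σ', h1', rfl, rfl, rfl⟩ := h' b hb
    have e : (D.s : ℤ) • x + D.place σ = (D.s : ℤ) • y + D.place σ' := by
      rw [place, hab σ.b σ'.b, place, smul_sub]
      abel
    rw [e] at h1
    obtain ⟨h2, rfl⟩ := h1.index_eq hp.1 h1'
    rw [add_right_cancel_iff] at h2
    subst h2
    obtain ⟨rfl, -⟩ := h.unique h'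
    -- The two tiles are then at the same position, and the displacement zero, outside of `N`,
    -- imposes no condition.
    exact hs fun hw => (N.zero_notMem (by simpa using hw)).elim
  refine ⟨⟨z, hzip⟩, ?_, ?_⟩
  · have hex : ∀ i, ∃ k, ∀ x t, z.Visits i x t → ∃ r, D.Occ p k x t r ∧ f k = i := by
      intro i
      by_cases h : ∃ x t, z.Visits i x t
      · obtain ⟨x, t, h⟩ := h
        obtain ⟨k, r, h1, h2⟩ := (hE _ _ _).1 h
        refine ⟨k, fun x' t' h' => ?_⟩
        obtain ⟨rfl, rfl⟩ := h.unique h'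
        exact ⟨r, h1, h2⟩
      · exact ⟨0, fun x t h' => (h ⟨x, t, h'⟩).elim⟩
    choose c hc using hex
    refine exists_isChi hp ⟨z, hzip⟩ c ?_ ?_
    · intro i x t h
      obtain ⟨r, h1, h2⟩ := hc _ _ _ h
      refine ⟨r, h1, fun y hy => ?_⟩
      obtain ⟨t', ht'⟩ := path_eq_some_iff.1 hy
      obtain ⟨r', h1', h2'⟩ := hc _ _ _ ht'
      exact (hnext _ _ _ _ _ _ _ _ h1 h1' (by rw [h2, h2'])).1
    · intro k x t r h
      have h1 := (hE _ _ _).2 ⟨k, r, h, rfl⟩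
      obtain ⟨r', h2, h3⟩ := hc _ _ _ h1
      exact ⟨f k, h1.1, hinj _ _ _ _ _ _ _ _ h2 h h3⟩
  · intro z' hz'
    obtain ⟨c, hc, hc'⟩ := exists_of_isChi hp hz'
    -- Along any other simulated zipper the counter also grows by one per tile, so it differs from
    -- the index by a constant: the translation sought.
    obtain ⟨d, hd⟩ := z'.1.ordConnected_dom.exists_eq_add (f := fun i => f (c i)) (by
      intro i hi hi'
      obtain ⟨x, t, h⟩ := mem_dom_iff.1 hi
      obtain ⟨x', t', h'⟩ := mem_dom_iff.1 hi'
      obtain ⟨r, h1, h2⟩ := hc _ _ _ h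
      obtain ⟨r', h1', -⟩ := hc _ _ _ h'
      have h3 := h2 _ h'.1
      rw [h3] at h1'
      simp only [h3]
      exact hlen _ _ _ _ _ _ _ h1 h1')
    have hvis : ∀ i x t, z'.1.Visits i x t ↔ z.Visits (i + d) x t := by
      intro i x t
      rw [hE]
      constructor
      · intro h
        obtain ⟨r, h1, -⟩ := hc _ _ _ h
        exact ⟨_, r, h1, hd i (mem_dom_iff.2 ⟨_, _, h⟩)⟩
      · rintro ⟨k, r, h, e⟩
        obtain ⟨i', h1, rfl⟩ := hc' _ _ _ _ h
        obtain ⟨t', ht'⟩ := path_eq_some_iff.1 h1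
        have h2 := hd i' (mem_dom_iff.2 ⟨_, _, ht'⟩)
        obtain rfl : i' = i := by omega
        obtain ⟨r', h3, -⟩ := hc _ _ _ ht'
        obtain ⟨-, rfl, -⟩ := h.unique h3
        exact ht'
    refine ⟨⟨d, fun i => ?_⟩, ?_⟩
    · ext x
      rw [path_eq_some_iff, path_eq_some_iff]
      simp only [hvis]
    · funext x
      ext t
      rw [tile_eq_some_iff, tile_eq_some_iff]
      simp only [hvis]
      exact ⟨fun ⟨i, h⟩ => ⟨_, h⟩, fun ⟨i, h⟩ => ⟨i - d, by simpa using h⟩⟩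

theorem next_or_next (hp : IsRibbon p) (h : D.At p k y σ) (h' : D.At p (k + 1) y' σ') :
    D.Next σ σ' (y' - y) ∨ D.Next σ' σ (y - y') := by
  obtain ⟨m, h, rfl⟩ := h
  obtain ⟨m', h', rfl⟩ := h'
  have := D.next_of_sticks (p.adjacent _ _ _ h.1 h'.1) ((isRibbon_iff.1 hp).2 _ _ _ _ _ h h')
  rwa [neg_sub] at this

variable (p) in
/-- Consecutive microtiles follow each other in the order of the polyominoes. -/
def IsForward : Prop :=
  ∀ k y y' σ σ', D.At p k y σ → D.At p (k + 1) y' σ' → D.Next σ σ' (y' - y)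

/-- A link can be traversed in either direction, since sticking is symmetric. A change of direction
between two successive links would make the path leave a microtile through the side by which it
came, against injectivity. One forward link thus orients the whole ribbon. -/
theorem isForward_of_next (hp : IsRibbon p) (h : D.At p k y σ) (h' : D.At p (k + 1) y' σ')
    (hn : D.Next σ σ' (y' - y)) : IsForward p := by
  have hS : Set.OrdConnected {k | k ∈ p.dom ∧ k + 1 ∈ p.dom} := by
    constructor
    rintro a ⟨ha, ha'⟩ b ⟨hb, hb'⟩ c ⟨hc, hc'⟩
    exact ⟨mem_dom_of_le ha hb hc hc', mem_dom_of_le ha' hb' (by omega) (by omega)⟩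
  have key := hS.int_propagate
    (P := fun k => ∀ y y' σ σ', D.At p k y σ → D.At p (k + 1) y' σ' → D.Next σ σ' (y' - y))
    ?_ (k₀ := k) ⟨h.mem_dom, h'.mem_dom⟩ ?_
  · exact fun k y y' σ σ' h h' => key k ⟨h.mem_dom, h'.mem_dom⟩ _ _ _ _ h h'
  · rintro k ⟨hk0, hk1⟩ ⟨-, hk2⟩
    obtain ⟨y0, σ0, h0⟩ := exists_at hk0
    obtain ⟨y1, σ1, h1⟩ := exists_at hk1
    obtain ⟨y2, σ2, h2⟩ := exists_at hk2
    have hne : y0 ≠ y2 := by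
      rintro rfl
      have := hp.1 _ _ _ h0.path h2.path
      omega
    constructor
    · intro H y y' σ σ' h h'
      obtain ⟨rfl, rfl⟩ := h1.unique h
      obtain ⟨rfl, rfl⟩ := h2.unique h'
      refine (next_or_next hp h h').resolve_right fun hb => hne ?_
      exact sub_right_injective ((H _ _ _ _ h0 h1).2.1.trans hb.2.1.symm)
    · intro H y y' σ σ' h h'
      obtain ⟨rfl, rfl⟩ := h0.unique h
      obtain ⟨rfl, rfl⟩ := h1.unique h'
      refine (next_or_next hp h h').resolve_right fun hb => hne ?_
      exact sub_left_injective (hb.1.trans (H _ _ _ _ h1 h2).1.symm)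
  · intro a b τ τ' ha hb
    obtain ⟨rfl, rfl⟩ := h.unique ha
    obtain ⟨rfl, rfl⟩ := h'.unique hb
    exact hn

/-- The first two cells already give a forward link. Read backwards, the link from the second cell
to the first would pass from the end of a polyomino to the beginning of another, and the first cell
would lie just beyond a port, which `inside` excludes. -/
theorem Occ.isForward (hp : IsRibbon p) (h : D.Occ p k x t r) : IsForward p := by
  have h2 := D.two_le_len r
  obtain ⟨σ, h0, rfl, rfl, hj⟩ := h.at_zero
  obtain ⟨σ', h1, ht, hr, hj'⟩ := h 1 (by omega)
  refine isForward_of_next hp h0 h1 ((next_or_next hp h0 h1).resolve_right fun hb => ?_)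
  have h3 := hb.2.2
  rw [inLab, if_pos hj, outLab] at h3
  split_ifs at h3 with h4
  have h5 := D.next_outer h1.valid hb h4
  have h6 := D.inside σ.t σ.r 0 σ.b σ'.r.dst (by omega)
  apply h6
  have h7 := D.loc_last σ'.t σ'.r σ'.b
  have h8 := h1.valid
  unfold Valid at h8
  have h9 : (σ'.j : ℕ) = D.len σ'.r - 1 := by omega
  rw [← h5.1, ← h7, ← h9]
  simp only [place, hj]
  abel

theorem IsForward.run (hf : IsForward p) (h : D.At p k ((D.s : ℤ) • x + D.place σ) σ)
    (hj : (σ.j : ℕ) = 0) : ∀ i : ℕ, i < D.len σ.r → k + i ∈ p.dom →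
      ∃ σ' : D.State, D.At p (k + i) ((D.s : ℤ) • x + D.place σ') σ' ∧
        σ'.t = σ.t ∧ σ'.r = σ.r ∧ (σ'.j : ℕ) = i := by
  intro i
  induction i with
  | zero => exact fun _ _ => ⟨σ, by simpa using h, rfl, rfl, hj⟩
  | succ i ih =>
    intro hi hd
    obtain ⟨τ, h1, h2, h3, h4⟩ := ih (by omega)
      (mem_dom_of_le h.mem_dom hd (by omega) (by push_cast; omega))
    have e : k + ((i + 1 : ℕ) : ℤ) = k + i + 1 := by push_cast; ring
    rw [e] at hd ⊢
    obtain ⟨y, σ', h'⟩ := exists_at hd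
    obtain ⟨h5, h6, h7, h8⟩ := D.next_inner (hf _ _ _ _ _ h1 h') (by rw [h3]; omega)
    refine ⟨σ', ?_, h5.trans h2, h6.trans h3, by omega⟩
    convert h' using 1
    rw [h8]
    abel

/-- A later first cell cannot lie within the current polyomino, whose other cells have positive
index. The path therefore continues past its last cell, through a port, to the first cell of an
adjacent macrotile. -/
theorem IsForward.exists_next (hf : IsForward p) (h : D.Occ p k x t r) (hk : k < k')
    (h' : D.At p k' y' σ') (hj : (σ'.j : ℕ) = 0) :
    k + D.len r ≤ k' ∧ ∃ x' σ'', x' - x ∈ vonNeumann.carrier ∧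
      D.At p (k + D.len r) ((D.s : ℤ) • x' + D.place σ'') σ'' ∧ (σ''.j : ℕ) = 0 := by
  have h2 := D.two_le_len r
  have hle : k + D.len r ≤ k' := by
    by_contra hlt
    obtain ⟨τ, h3, -, -, h4⟩ := h (k' - k).toNat (by omega)
    rw [Int.toNat_of_nonneg (by omega), add_sub_cancel] at h3
    obtain ⟨-, rfl⟩ := h3.unique h'
    omega
  refine ⟨hle, ?_⟩
  obtain ⟨τ, h3, -, rfl, h4⟩ := h (D.len r - 1) (by omega)
  have e : k + ((D.len τ.r - 1 : ℕ) : ℤ) + 1 = k + D.len τ.r := by omega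
  obtain ⟨y, ρ, h5⟩ := exists_at (mem_dom_of_le h3.mem_dom h'.mem_dom
    (j := k + ((D.len τ.r - 1 : ℕ) : ℤ) + 1) (by omega) (by omega))
  have h6 := hf _ _ _ _ _ h3 h5
  obtain ⟨h7, -, h8, h9⟩ := D.next_outer h3.valid h6 (by omega)
  refine ⟨x + τ.r.dst.dir, ρ, by simpa using τ.r.dst.dir_mem, ?_, h8⟩
  rw [← e]
  convert h5 using 1
  rw [smul_add, ← h7, add_assoc, h9]
  abel

/-- Once begun, a polyomino can only be cut short by the end of the path. A complete polyomino later
on excludes this, so incomplete ones occur only at the ends of a ribbon. -/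
theorem IsForward.occ_of_next (hf : IsForward p) (h : D.At p k ((D.s : ℤ) • x + D.place σ) σ)
    (hj : (σ.j : ℕ) = 0) (hk : k ≤ k') (h' : D.Occ p k' x' t' r') :
    ∃ x t r, D.Occ p k x t r := by
  obtain ⟨τ, h1, -, -, h2⟩ := h'.at_zero
  rcases hk.eq_or_lt with rfl | hk
  · exact ⟨_, _, _, h'⟩
  · refine ⟨x, σ.t, σ.r, fun i hi => hf.run h hj i hi ?_⟩
    by_contra hi'
    have h3 : k' < k + i := by
      by_contra h3
      exact hi' (mem_dom_of_le h.mem_dom h1.mem_dom (by omega) (by omega))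
    obtain ⟨τ', h4, -, -, h5⟩ := hf.run h hj (k' - k).toNat (by omega) (by
      rw [Int.toNat_of_nonneg (by omega), add_sub_cancel]
      exact h1.mem_dom)
    rw [Int.toNat_of_nonneg (by omega), add_sub_cancel] at h4
    obtain ⟨-, rfl⟩ := h4.unique h1
    omega

-- The complete polyominoes are consecutive in a ribbon, so counting the first cells met along the
-- path numbers them consecutively.
open Classical in
theorem decode (p : TiledPath D.tiles) (hp : IsRibbon p) :
    ∃ z, (∃ R ∈ D.simulations z, IsChi D.s D.polyominoes p R) ∧
      ∀ z', (∃ R ∈ D.simulations z', IsChi D.s D.polyominoes p R) → z'.1.Reindexing z.1 := by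
  by_cases hex : ∃ k x t r, D.Occ p k x t r
  swap
  -- Without a complete polyomino, nothing is kept and the simulated zipper is empty; any counter
  -- will do.
  · refine decode_of_counter hp id (fun k x t r _ _ _ _ h => (hex ⟨k, x, t, r, h⟩).elim)
      (fun k x t r _ _ _ _ h => (hex ⟨k, x, t, r, h⟩).elim)
      (fun k x t r _ _ _ h => (hex ⟨k, x, t, r, h⟩).elim) ?_
    constructor
    rintro _ ⟨k, x, t, r, h, -⟩
    exact (hex ⟨k, x, t, r, h⟩).elim
  obtain ⟨k₀, x₀, t₀, r₀, h₀⟩ := hex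
  have hf := h₀.isForward hp
  set first : ℤ → Prop := fun k => ∃ y σ, D.At p k y σ ∧ (σ.j : ℕ) = 0 with hfirst
  -- The counter increases exactly on arrival at a first cell; it is constant on each polyomino and
  -- only its differences matter.
  obtain ⟨f, hfs⟩ := Int.exists_antidifference fun k => if first (k + 1) then 1 else 0
  have hmono : Monotone f := monotone_int_of_le_succ fun k => by
    rw [hfs]
    split_ifs <;> omega
  have hstrict : ∀ {k k'}, first k' → k < k' → f k < f k' := by
    intro k k' h hlt
    have h1 := hmono (show k ≤ k' - 1 by omega)
    have h2 := hfs (k' - 1)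
    rw [sub_add_cancel, if_pos h] at h2
    omega
  have hocc : ∀ {k x t r}, D.Occ p k x t r → first k := by
    intro k x t r h
    obtain ⟨σ, h1, -, -, h2⟩ := h.at_zero
    exact ⟨_, σ, h1, h2⟩
  have hconst : ∀ {k x t r}, D.Occ p k x t r → ∀ i : ℕ, i < D.len r → f (k + i) = f k := by
    intro k x t r h i
    induction i with
    | zero => simp
    | succ i ih =>
      intro hi
      rw [Nat.cast_succ, ← add_assoc, hfs, ih (by omega), if_neg, add_zero]
      rintro ⟨y, σ, h1, h2⟩
      obtain ⟨τ, h3, -, -, h4⟩ := h (i + 1) hi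
      rw [Nat.cast_succ, ← add_assoc] at h3
      obtain ⟨-, rfl⟩ := h1.unique h3
      omega
  have hlen : ∀ {k x t r}, D.Occ p k x t r → first (k + D.len r) → f (k + D.len r) = f k + 1 := by
    intro k x t r h h1
    have h2 := D.two_le_len r
    have h3 := hconst h (D.len r - 1) (by omega)
    have h4 := hfs (k + (D.len r - 1 : ℕ))
    have e : k + ((D.len r - 1 : ℕ) : ℤ) + 1 = k + D.len r := by omega
    rw [e, if_pos h1] at h4
    omega
  have hsucc : ∀ {k x t r k' x' t' r'}, D.Occ p k x t r → D.Occ p k' x' t' r' → k < k' →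
      k + D.len r ≤ k' ∧ f (k + D.len r) = f k + 1 ∧
      ∃ y u v, D.Occ p (k + D.len r) y u v ∧ y - x ∈ vonNeumann.carrier := by
    intro k x t r k' x' t' r' h h' hlt
    obtain ⟨τ, h1, -, -, h2⟩ := h'.at_zero
    obtain ⟨h3, y, ρ, h4, h5, h6⟩ := hf.exists_next h hlt h1 h2
    obtain ⟨y', u, v, h7⟩ := hf.occ_of_next h5 h6 h3 h'
    obtain ⟨ρ', h8, -⟩ := h7.at_zero
    obtain ⟨h9, rfl⟩ := h5.unique h8
    obtain rfl := D.smul_injective (add_right_cancel h9)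
    exact ⟨h3, hlen h ⟨_, _, h5, h6⟩, y, u, v, h7, h4⟩
  refine decode_of_counter hp f ?_ ?_ ?_ ?_
  · intro k x t r k' x' t' r' h h' e
    rcases lt_trichotomy k k' with hlt | heq | hlt
    · exact absurd e (hstrict (hocc h') hlt).ne
    · exact heq
    · exact absurd e (hstrict (hocc h) hlt).ne'
  · intro k x t r k' x' t' r' h h' e
    have hlt : k < k' := by
      by_contra hle
      have := hmono (not_lt.1 hle)
      omega
    obtain ⟨h1, h2, y, u, v, h3, h4⟩ := hsucc h h' hlt
    have h5 : k' = k + D.len r := by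
      by_contra hne
      have := hstrict (hocc h') (lt_of_le_of_ne h1 (Ne.symm hne))
      omega
    subst h5
    obtain ⟨rfl, -⟩ := h3.unique h'
    exact ⟨rfl, h4⟩
  · intro k x t r x' t' r' h h'
    exact hlen h (hocc h')
  · constructor
    rintro _ ⟨k, x, t, r, h, rfl⟩ _ ⟨k', x', t', r', h', rfl⟩ i ⟨h1, h2⟩
    have key : ∀ n : ℕ, f k + n ≤ f k' → ∃ l y u v, D.Occ p l y u v ∧ f l = f k + n := by
      intro n
      induction n with
      | zero => exact fun _ => ⟨k, x, t, r, h, by simp⟩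
      | succ n ih =>
        intro hn
        push_cast at hn ⊢
        obtain ⟨l, y, u, v, h3, h4⟩ := ih (by omega)
        have hlt : l < k' := by
          by_contra hle
          have := hmono (not_lt.1 hle)
          omega
        obtain ⟨-, h5, y', u', v', h6, -⟩ := hsucc h3 h' hlt
        exact ⟨_, y', u', v', h6, by omega⟩
    obtain ⟨l, y, u, v, h3, h4⟩ := key (i - f k).toNat (by omega)
    exact ⟨l, y, u, v, h3, by omega⟩

end Blueprint

/-! ### Blocks of indices and routes of zippers. -/

/-- For integers, `f i - i` is monotone, which makes `f` unbounded on both sides; the blocks `[f i,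
f (i + 1))` thus cover all indices. -/
theorem Int.exists_between_of_strictMono {f : ℤ → ℤ} (hf : StrictMono f) (k : ℤ) :
    ∃ i, f i ≤ k ∧ k < f (i + 1) := by
  have hg : Monotone fun i => f i - i := monotone_int_of_le_succ fun i => by
    have := hf (show i < i + 1 by omega)
    omega
  obtain ⟨i, h1, h2⟩ := Int.exists_greatest_of_bdd (P := fun i => f i ≤ k)
    ⟨max 0 (k - f 0), fun i hi => by
      rcases le_total 0 i with h | h
      · have := hg h
        simp only at this
        omega
      · omega⟩
    ⟨min 0 (k - f 0), by
      have := hg (min_le_left 0 (k - f 0))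
      simp only at this
      omega⟩
  refine ⟨i, h1, ?_⟩
  by_contra h
  have := h2 (i + 1) (not_lt.1 h)
  omega

theorem Int.index_unique_of_strictMono {f : ℤ → ℤ} (hf : StrictMono f) {i j k : ℤ} (h1 : f i ≤ k)
    (h2 : k < f (i + 1)) (h3 : f j ≤ k) (h4 : k < f (j + 1)) : i = j := by
  have h5 := hf.lt_iff_lt.1 (h1.trans_lt h4)
  have h6 := hf.lt_iff_lt.1 (h3.trans_lt h2)
  omega

/-- The route of a zipper through each of its tiles. -/
theorem TiledPath.exists_route {α : Type} {z : TiledPath α} (hz : z.Injective) (i : ℤ) :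
    ∃ r : Route, ∀ x, z.path i = some x → (∀ y, z.path (i - 1) = some y → r.src.dir = y - x) ∧
      ∀ y, z.path (i + 1) = some y → r.dst.dir = y - x := by
  have hopp : ∀ p : Port, p ≠ p.opp := by decide
  rcases hx : z.path i with _ | x
  · exact ⟨⟨(.left, .right), by decide⟩, by simp⟩
  have hprev : ∀ y, z.path (i - 1) = some y → ∃ a : Port, y - x = a.dir := fun y hy =>
    mem_vonNeumann_iff.1 (mem_vonNeumann_sub_comm.1 (z.adjacent (i - 1) y x hy (by simpa using hx)))
  have hnext : ∀ y, z.path (i + 1) = some y → ∃ a : Port, y - x = a.dir := fun y hy =>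
    mem_vonNeumann_iff.1 (z.adjacent i x y hx hy)
  rcases hy : z.path (i - 1) with _ | y <;> rcases hy' : z.path (i + 1) with _ | y'
  · exact ⟨⟨(.left, .right), by decide⟩, by simp⟩
  · obtain ⟨b, hb⟩ := hnext _ hy'
    -- At an end of the path the missing side is arbitrary; taking the opposite one makes it
    -- distinct from the other.
    refine ⟨⟨(b.opp, b), (hopp b).symm⟩, ?_⟩
    rintro _ ⟨⟩
    simp [hb]
  · obtain ⟨a, ha⟩ := hprev _ hy
    refine ⟨⟨(a, a.opp), hopp a⟩, ?_⟩
    rintro _ ⟨⟩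
    simp [ha]
  · obtain ⟨a, ha⟩ := hprev _ hy
    obtain ⟨b, hb⟩ := hnext _ hy'
    refine ⟨⟨(a, b), ?_⟩, ?_⟩
    -- Equal sides would mean that the predecessor and the successor have the same position.
    · intro (hab : a = b)
      subst hab
      rw [← hb] at ha
      have := sub_left_injective ha
      subst this
      have := hz _ _ _ hy hy'
      omega
    · rintro _ ⟨⟩
      simp [ha, hb]

namespace Blueprint

open TiledPath

variable {N : Neighborhood} {X : Type} {T : Finset (Tile N X)} (D : Blueprint T)

/-! ### Encoding -/

/-- Bits need to agree only within a slot. Across two slots the link carries no bit, and `indep`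
lets either bit be used to compute the displacement. -/
theorem next_succ (σ σ' : D.State) (ht : σ'.t = σ.t) (hr : σ'.r = σ.r) (hj : (σ'.j : ℕ) = σ.j + 1)
    (hσ' : D.Valid σ') (hb : D.slot σ.r σ.j = D.slot σ.r (σ.j + 1) → σ'.b = σ.b) :
    D.Next σ σ' (D.place σ' - D.place σ) := by
  obtain ⟨t, r, ⟨j, hjL⟩, b⟩ := σ
  obtain ⟨t', r', ⟨j', hjL'⟩, b'⟩ := σ'
  simp only [Valid] at *
  subst ht hr hj
  refine ⟨?_, ?_, ?_⟩
  · rw [outDir, if_pos hσ', place, place]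
    simp only
    by_cases hs : D.slot r' j = D.slot r' (j + 1)
    · rw [hb hs]
    · rw [(D.indep _ _ _ b' b hσ' hs).2]
  · rw [inDir, if_neg (by simp), place, place]
    simp only [Nat.add_sub_cancel]
    by_cases hs : D.slot r' j = D.slot r' (j + 1)
    · rw [hb hs]
    · rw [(D.indep _ _ _ b' b hσ' hs).1]
  · rw [outLab, if_pos hσ', inLab, if_neg (by simp)]
    simp only [Nat.add_sub_cancel, linkBit]
    by_cases hs : D.slot r' j = D.slot r' (j + 1)
    · rw [hb hs]
    · simp [hs]

theorem next_port (σ σ' : D.State) (hj : (σ.j : ℕ) = D.len σ.r - 1) (hj' : (σ'.j : ℕ) = 0)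
    (hr : σ'.r.src = σ.r.dst.opp) : D.Next σ σ' σ.r.dst.dir := by
  have h2 := D.two_le_len σ.r
  have h3 : ¬ (σ.j : ℕ) + 1 < D.len σ.r := by omega
  refine ⟨?_, ?_, ?_⟩
  · rw [outDir, if_neg h3]
  · rw [inDir, if_pos hj', hr, Port.dir_opp, neg_neg]
  · rw [outLab, if_neg h3, inLab, if_pos hj']

/-- The sides crossed by the zipper give the routes, the lengths of the routes give the starting
indices `c`, and `encode` gives the bits. Every index of the ribbon is `c i + j` for a unique
macrotile `i` and a unique offset `j`. -/
theorem simulations_nonempty (z : {z : TiledPath T // IsZipper z}) : (D.simulations z).Nonempty := by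
  obtain ⟨z, hz⟩ := z
  obtain ⟨B, hB⟩ := D.encode z hz
  choose ρ hρ using fun i => exists_route hz.1 i
  obtain ⟨c, hc⟩ := Int.exists_antidifference fun i => (D.len (ρ i) : ℤ)
  have hlen : ∀ i, 2 ≤ D.len (ρ i) := fun i => D.two_le_len _
  have hcm : StrictMono c := strictMono_int_of_lt_succ fun i => by
    have := hlen i
    have := hc i
    omega
  have hidx : ∀ {i i' : ℤ} {j j' : ℕ}, j < D.len (ρ i) → j' < D.len (ρ i') →
      c i + j = c i' + j' → i = i' ∧ j = j' := by
    intro i i' j j' hj hj' e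
    have h1 := hc i
    have h2 := hc i'
    obtain rfl := Int.index_unique_of_strictMono hcm (i := i) (j := i') (k := c i + j)
      (by omega) (by omega) (by omega) (by omega)
    exact ⟨rfl, by omega⟩
  set st : ℤ → Pos → T → (j : Fin D.size) → D.State := fun i x t j =>
    ⟨t, ρ i, j, B x (D.slot (ρ i) j)⟩ with hst
  obtain ⟨p, hp, hE⟩ := exists_of_rel (α := D.tiles)
    (fun k y m => ∃ i x t, z.Visits i x t ∧ ∃ j : Fin D.size, (j : ℕ) < D.len (ρ i) ∧
      k = c i + (j : ℕ) ∧ y = (D.s : ℤ) • x + D.place (st i x t j) ∧ D.stateOf m = st i x t j)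
    (by
      rintro k y y' m m' ⟨i, x, t, h, j, hj, rfl, rfl, hm⟩ ⟨i', x', t', h', j', hj', e, rfl, hm'⟩
      obtain ⟨rfl, hjj⟩ := hidx hj hj' e
      obtain rfl := Fin.ext hjj
      obtain ⟨rfl, rfl⟩ := h.unique h'
      exact ⟨rfl, D.stateOf_injective (hm.trans hm'.symm)⟩)
    (by
      rintro k k' y m m' ⟨i, x, t, h, j, hj, rfl, rfl, hm⟩ ⟨i', x', t', h', j', hj', rfl, e, hm'⟩
      by_cases hx : x = x'
      · subst hx
        obtain rfl := hz.1 _ _ _ h.1 h'.1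
        obtain ⟨-, rfl⟩ := h.unique h'
        rw [add_right_inj] at e
        rw [D.inj t (ρ i) (B x) _ _ hj hj' e]
      -- Polyominoes at distinct positions are disjoint by the choice of the bits; the case of one
      -- polyomino is `Blueprint.inj`.
      · exact (hB _ _ _ _ hx h.2 h'.2 _ _ _ _ hj hj' e).elim)
    (by
      constructor
      rintro k ⟨y, m, i, x, t, h, j, hj, rfl, -⟩ k' ⟨y', m', i', x', t', h', j', hj', rfl, -⟩ l
        ⟨hl, hl'⟩
      -- The index `l` falls into the block of some `a` between `i` and `i'`, which is in the domain
      -- of the zipper by convexity.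
      obtain ⟨a, ha, ha'⟩ := Int.exists_between_of_strictMono hcm l
      have h1 := hc a
      have h2 := hc i'
      obtain ⟨x'', t'', h''⟩ := mem_dom_iff.1 (mem_dom_of_le (mem_dom_iff.2 ⟨_, _, h⟩)
        (mem_dom_iff.2 ⟨_, _, h'⟩) (j := a)
        (by have := hcm.lt_iff_lt.1 (show c i < c (a + 1) by omega); omega)
        (by have := hcm.lt_iff_lt.1 (show c a < c (i' + 1) by omega); omega))
      have hj'' : (l - c a).toNat < D.len (ρ a) := by omega
      obtain ⟨m'', hm''⟩ := D.exists_stateOf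
        (σ := st a x'' t'' ⟨(l - c a).toNat, hj''.trans_le (D.len_le _)⟩) hj''
      exact ⟨_, m'', a, x'', t'', h'', _, hj'', by simp; omega, rfl, hm''⟩)
    (by
      rintro k y y' m m' ⟨i, x, t, h, j, hj, rfl, rfl, hm⟩ ⟨i', x', t', h', j', hj', e, rfl, hm'⟩
      have h1 := hc i
      by_cases hjl : (j : ℕ) + 1 < D.len (ρ i)
      · obtain ⟨rfl, hjj⟩ := hidx (j := j + 1) (i := i) hjl hj' (by push_cast; omega)
        obtain ⟨rfl, rfl⟩ := h.unique h'
        rw [add_sub_add_left_eq_sub]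
        simp only [place, hst, ← hjj]
        by_cases hs : D.slot (ρ i) j = D.slot (ρ i) (j + 1)
        · rw [hs]
          exact D.step _ _ _ _ hjl
        · rw [(D.indep t _ _ _ (B x (D.slot (ρ i) (j + 1))) hjl hs).1]
          exact D.step _ _ _ _ hjl
      · have h2 := hlen (i + 1)
        obtain ⟨rfl, hjj⟩ := hidx (i := i + 1) (j := 0) (by omega) hj' (by push_cast; omega)
        have h3 := (hρ i x h.1).2 _ h'.1
        have h4 := (hρ (i + 1) x' h'.1).1 x (by simpa using h.1)
        have h5 : (ρ (i + 1)).src = (ρ i).dst.opp := by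
          apply Port.dir_injective
          rw [Port.dir_opp, h3, h4, neg_sub]
        have h6 : (j : ℕ) = D.len (ρ i) - 1 := by omega
        have h7 := D.port_opp (ρ i).dst
        simp only [place, hst, ← hjj, D.loc_first, h6, D.loc_last, h5]
        rw [h3, smul_sub] at h7
        have : (D.s : ℤ) • x' + D.port (ρ i).dst.opp - ((D.s : ℤ) • x + D.port (ρ i).dst)
            = (D.s : ℤ) • x' - (D.s : ℤ) • x + D.port (ρ i).dst.opp - D.port (ρ i).dst := by abel
        rw [this, h7, add_sub_cancel_left, ← h3]
        exact Port.dir_mem _)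
  have hrib : IsRibbon p := by
    refine isRibbon_iff.2 ⟨hp, fun k y y' m m' h1 h2 => ?_⟩
    apply D.sticks_of_next
    have hadj := p.adjacent _ _ _ h1.1 h2.1
    obtain ⟨i, x, t, h, j, hj, rfl, rfl, hm⟩ := (hE _ _ _).1 h1
    obtain ⟨i', x', t', h', j', hj', e, rfl, hm'⟩ := (hE _ _ _).1 h2
    have h1 := hc i
    rw [hm, hm']
    by_cases hjl : (j : ℕ) + 1 < D.len (ρ i)
    · obtain ⟨rfl, hjj⟩ := hidx (j := j + 1) (i := i) hjl hj' (by push_cast; omega)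
      obtain ⟨rfl, rfl⟩ := h.unique h'
      rw [add_sub_add_left_eq_sub]
      exact D.next_succ _ _ rfl rfl hjj.symm hj' fun hs => by
        simp only [hst] at hs ⊢
        rw [hs, hjj]
    · have h2 := hlen (i + 1)
      obtain ⟨rfl, hjj⟩ := hidx (i := i + 1) (j := 0) (by omega) hj' (by push_cast; omega)
      have h3 := (hρ i x h.1).2 _ h'.1
      have h4 := (hρ (i + 1) x' h'.1).1 x (by simpa using h.1)
      have h5 : (ρ (i + 1)).src = (ρ i).dst.opp := by
        apply Port.dir_injective
        rw [Port.dir_opp, h3, h4, neg_sub]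
      have h6 : (j : ℕ) = D.len (ρ i) - 1 := by omega
      have hn := D.next_port (st i x t j) (st (i + 1) x' t' j') h6 hjj.symm h5
      have h7 := D.next_place (show D.Valid (st i x t j) from hj) hn
      have h8 : D.shift (st i x t j) = x' - x := by
        rw [shift, if_neg (by simpa [hst] using hjl)]
        exact h3
      convert hn using 1
      rw [h8, smul_sub] at h7
      have : (D.s : ℤ) • x' + D.place (st (i + 1) x' t' j') =
          (D.s : ℤ) • x + ((D.s : ℤ) • x' - (D.s : ℤ) • x + D.place (st (i + 1) x' t' j')) := by
        abel
      rw [this, h7]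
      abel
  have hat : ∀ i x t, z.Visits i x t → ∀ j : Fin D.size, (j : ℕ) < D.len (ρ i) →
      D.At p (c i + (j : ℕ)) ((D.s : ℤ) • x + D.place (st i x t j)) (st i x t j) := by
    intro i x t h j hj
    obtain ⟨m, hm⟩ := D.exists_stateOf (σ := st i x t j) hj
    exact ⟨m, (hE _ _ _).2 ⟨i, x, t, h, j, hj, rfl, rfl, hm⟩, hm⟩
  obtain ⟨R, hR, -⟩ := exists_isChi hrib ⟨z, hz⟩ c (by
    intro i x t h
    refine ⟨ρ i, fun j hj => ?_, fun _ _ => hc i⟩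
    exact ⟨_, hat i x t h ⟨j, hj.trans_le (D.len_le _)⟩ hj, rfl, rfl, rfl⟩) (by
    intro k x t r ho
    obtain ⟨σ, ⟨m, h1, h2⟩, -, -, h3⟩ := ho.at_zero
    obtain ⟨i, x', t', h, j, hj, rfl, e, hm⟩ := (hE _ _ _).1 h1
    rw [h2] at hm
    subst hm
    obtain rfl := D.smul_injective (add_right_cancel e)
    exact ⟨i, h.1, by simp only [hst] at h3; omega⟩)
  exact ⟨R, hR⟩

theorem isZipperSimulation :
    IsZipperSimulation T D.tiles D.s D.polyominoes D.simulations where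
  scale_pos := D.s_pos
  polyomino := by
    rintro t π ⟨r, h1, h2, h3⟩
    refine ⟨h1, h2 ▸ Set.finite_Ico _ _, ?_⟩
    obtain ⟨j, hj, h0⟩ := D.ref t r
    obtain ⟨σ, h4, rfl, rfl, rfl⟩ := h3 j hj
    have h5 := h4.path
    rw [place, h0, smul_zero, add_zero] at h5
    exact (π.dom_tile 0).2 ⟨_, h5⟩
  specific := by
    have key : ∀ (t : T) (π : TiledPath D.tiles) (a : Pos) (m : D.tiles), π ∈ D.polyominoes t →
        π.tile a = some m → (D.stateOf m).t = t := by
      rintro t π a m ⟨r, h1, h2, h3⟩ h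
      obtain ⟨k, hk⟩ := tile_eq_some_iff.1 h
      have hd : k ∈ π.dom := mem_dom_iff.2 ⟨_, _, hk⟩
      rw [h2, Set.mem_Ico] at hd
      obtain ⟨σ, ⟨m', h4, rfl⟩, h5, -⟩ := h3 k.toNat (by omega)
      rw [zero_add, Int.toNat_of_nonneg hd.1] at h4
      rw [(hk.unique h4).2, h5]
    rintro t t' π π' hne hπ hπ' a b m m' hm hm' rfl
    exact hne ((key _ _ _ _ hπ hm).symm.trans (key _ _ _ _ hπ' hm'))
  nonempty := D.simulations_nonempty
  polyRibbon := fun z R hR => ⟨hR.1, hR.2.1, hR.2.2.1⟩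
  fromRibbon := fun z R hR => hR.2.2.2
  decode := decode

theorem ncard_dom_le {t : T} {π : TiledPath D.tiles} (h : π ∈ D.polyominoes t) :
    π.dom.ncard ≤ D.size := by
  obtain ⟨r, -, h2, -⟩ := h
  rw [h2, ← Finset.coe_Ico, Set.ncard_coe_finset, Int.card_Ico]
  simpa using D.len_le r

end Blueprint

/-! ### The profile of the polyominoes -/

/-- The depth of the dips of the profile. -/
def dipDepth (n : ℕ) : ℤ := 8 * n + 12

/-- The scale: a ramp of length `4`, and one slot for every pair of a distance and a glue. -/
def macroScale (n M : ℕ) : ℤ := 4 + 2 * dipDepth n * (n * M)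

/-- The profile of a slot of width `2 * d`: a dip of depth `d` if the bit is set, and a flat zigzag
otherwise. -/
def dip (d : ℤ) (b : Bool) (r : ℤ) : ℤ := if b then min r (2 * d - r) else r % 2

/-- The slot of a column. -/
def slotAt (n M : ℕ) (u : ℤ) : ℤ × ℤ :=
  (u / macroScale n M, (u % macroScale n M - 4) / (2 * dipDepth n))

/-- The height of the profile in the column `w` of the `q`-th macrotile. -/
def profileIn (n : ℕ) (A : ℤ × ℤ → Bool) (q w : ℤ) : ℤ :=
  if w ≤ 4 then 4 * q + w
  else 4 * q + 4 - dip (dipDepth n) (A (q, (w - 4) / (2 * dipDepth n))) ((w - 4) % (2 * dipDepth n))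

/-- The profile with the dips given by `A`. -/
def profile (n M : ℕ) (A : ℤ × ℤ → Bool) (u : ℤ) : ℤ :=
  profileIn n A (u / macroScale n M) (u % macroScale n M)

section profile

variable {n M : ℕ}

theorem twelve_le_dipDepth : 12 ≤ dipDepth n := by unfold dipDepth; omega

theorem macroScale_ge (hn : 1 ≤ n) (hM : 1 ≤ M) : 4 + 2 * dipDepth n ≤ macroScale n M := by
  have h : (1 : ℤ) ≤ n * M := by exact_mod_cast Nat.mul_pos hn hM
  have h' := twelve_le_dipDepth (n := n)
  unfold macroScale
  nlinarith

theorem macroScale_pos : 0 < macroScale n M := by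
  have h' := twelve_le_dipDepth (n := n)
  unfold macroScale
  positivity

theorem dip_zero (d : ℤ) (hd : 0 ≤ d) (b : Bool) : dip d b 0 = 0 := by
  unfold dip; split_ifs <;> omega

theorem dip_two_mul (d : ℤ) (hd : 0 ≤ d) (b : Bool) : dip d b (2 * d) = 0 := by
  unfold dip; split_ifs <;> omega

/-- A leg has two cells per column, at the heights of the profile at both ends of the column. They
are adjacent because the profile always moves by one; hence a zigzag and not a constant for an unset
bit. -/
theorem dip_step (d : ℤ) (b : Bool) (r : ℤ) :
    dip d b (r + 1) = dip d b r + 1 ∨ dip d b (r + 1) = dip d b r - 1 := by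
  unfold dip; split_ifs <;> omega

theorem dip_bounds (d : ℤ) (hd : 1 ≤ d) (b : Bool) (r : ℤ) (h0 : 0 ≤ r) (h1 : r ≤ 2 * d) :
    0 ≤ dip d b r ∧ dip d b r ≤ d := by
  unfold dip; split_ifs <;> omega

theorem exists_column (M : ℕ) (u : ℤ) :
    ∃ q w, 0 ≤ w ∧ w < macroScale n M ∧ u = macroScale n M * q + w :=
  have h := macroScale_pos (n := n) (M := M)
  ⟨u / macroScale n M, u % macroScale n M, Int.emod_nonneg _ h.ne', Int.emod_lt_of_pos _ h,
    (Int.mul_ediv_add_emod _ _).symm⟩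

theorem column_div {q w : ℤ} (h0 : 0 ≤ w) (h1 : w < macroScale n M) :
    (macroScale n M * q + w) / macroScale n M = q := by
  rw [Int.mul_add_ediv_left _ _ (macroScale_pos (n := n) (M := M)).ne', Int.ediv_eq_zero_of_lt h0 h1,
    add_zero]

theorem column_mod {q w : ℤ} (h0 : 0 ≤ w) (h1 : w < macroScale n M) :
    (macroScale n M * q + w) % macroScale n M = w := by
  rw [Int.mul_add_emod_self_left, Int.emod_eq_of_lt h0 h1]

theorem profile_column (A : ℤ × ℤ → Bool) {q w : ℤ} (h0 : 0 ≤ w) (h1 : w < macroScale n M) :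
    profile n M A (macroScale n M * q + w) = profileIn n A q w := by
  rw [profile, column_div h0 h1, column_mod h0 h1]

theorem slotAt_column {q w : ℤ} (h0 : 0 ≤ w) (h1 : w < macroScale n M) :
    slotAt n M (macroScale n M * q + w) = (q, (w - 4) / (2 * dipDepth n)) := by
  rw [slotAt, column_div h0 h1, column_mod h0 h1]

theorem profileIn_slot (A : ℤ × ℤ → Bool) (q : ℤ) {m r : ℤ} (hm : 0 ≤ m) (h0 : 0 ≤ r)
    (h1 : r < 2 * dipDepth n) :
    profileIn n A q (4 + 2 * dipDepth n * m + r) = 4 * q + 4 - dip (dipDepth n) (A (q, m)) r := by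
  have hd := twelve_le_dipDepth (n := n)
  have e : 4 + 2 * dipDepth n * m + r - 4 = 2 * dipDepth n * m + r := by ring
  unfold profileIn
  rw [e, Int.mul_add_ediv_left _ _ (show 2 * dipDepth n ≠ 0 by omega),
    Int.ediv_eq_zero_of_lt h0 h1, add_zero,
    Int.mul_add_emod_self_left, Int.emod_eq_of_lt h0 h1]
  split_ifs with h
  · have h2 : 0 ≤ 2 * dipDepth n * m := by positivity
    have h3 : r = 0 := by omega
    have h4 : 2 * dipDepth n * m = 0 := by omega
    rw [h3, h4, dip_zero _ (by omega)]
    ring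
  · rfl

theorem profileIn_macroScale (A : ℤ × ℤ → Bool) (q : ℤ) :
    profileIn n A q (macroScale n M) = 4 * q + 4 := by
  have hd := twelve_le_dipDepth (n := n)
  have := profileIn_slot (n := n) A q (m := n * M) (r := 0) (by positivity) le_rfl (by omega)
  rw [dip_zero _ (by omega), add_zero, sub_zero] at this
  exact this

theorem profileIn_ramp (A : ℤ × ℤ → Bool) (q : ℤ) {w : ℤ} (h : w ≤ 4) :
    profileIn n A q w = 4 * q + w := by
  rw [profileIn, if_pos h]

theorem exists_slot {w : ℤ} (h : 4 ≤ w) : ∃ m r, 0 ≤ m ∧ 0 ≤ r ∧ r < 2 * dipDepth n ∧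
    w = 4 + 2 * dipDepth n * m + r := by
  have hd := twelve_le_dipDepth (n := n)
  refine ⟨(w - 4) / (2 * dipDepth n), (w - 4) % (2 * dipDepth n),
    Int.ediv_nonneg (by omega) (by omega), Int.emod_nonneg _ (by omega),
    Int.emod_lt_of_pos _ (by omega), ?_⟩
  have := Int.mul_ediv_add_emod (w - 4) (2 * dipDepth n)
  omega

theorem profileIn_slot_end (A : ℤ × ℤ → Bool) (q : ℤ) {m r : ℤ} (hm : 0 ≤ m) (h0 : 0 ≤ r)
    (h1 : r ≤ 2 * dipDepth n) :
    profileIn n A q (4 + 2 * dipDepth n * m + r) = 4 * q + 4 - dip (dipDepth n) (A (q, m)) r := by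
  have hd := twelve_le_dipDepth (n := n)
  rcases h1.eq_or_lt with rfl | h1
  · have e : 4 + 2 * dipDepth n * m + 2 * dipDepth n = 4 + 2 * dipDepth n * (m + 1) + 0 := by ring
    rw [e, profileIn_slot A q (by omega) le_rfl (by omega), dip_zero _ (by omega),
      dip_two_mul _ (by omega)]
  · exact profileIn_slot A q hm h0 h1

/-- The formula of one macrotile also holds at the first column of the next, where both give `4 * q
+ 4`. Successive columns can thus always be compared within a single macrotile. -/
theorem profile_column_end (A : ℤ × ℤ → Bool) {q w : ℤ} (h0 : 0 ≤ w) (h1 : w ≤ macroScale n M) :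
    profile n M A (macroScale n M * q + w) = profileIn n A q w := by
  rcases h1.eq_or_lt with rfl | h1
  · have e : macroScale n M * q + macroScale n M = macroScale n M * (q + 1) + 0 := by ring
    rw [profileIn_macroScale, e, profile_column A le_rfl macroScale_pos,
      profileIn_ramp A _ (by omega)]
    ring
  · exact profile_column A h0 h1

theorem profile_step (A : ℤ × ℤ → Bool) (u : ℤ) :
    profile n M A (u + 1) = profile n M A u + 1 ∨ profile n M A (u + 1) = profile n M A u - 1 := by
  obtain ⟨q, w, h0, h1, rfl⟩ := exists_column (n := n) M u
  rw [add_assoc, profile_column_end A h0 h1.le, profile_column_end A (by omega) (by omega)]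
  rcases lt_or_ge w 4 with h | h
  · left
    rw [profileIn_ramp A q (by omega), profileIn_ramp A q (by omega)]
    ring
  · obtain ⟨m, r, hm, hr0, hr1, rfl⟩ := exists_slot (n := n) h
    rw [add_assoc _ r, profileIn_slot_end A q hm hr0 hr1.le,
      profileIn_slot_end A q hm (by omega) (by omega)]
    have := dip_step (dipDepth n) (A (q, m)) r
    omega

/-- The bit of the slot of a column controls the profile at both ends of the column, as the dip
vanishes where the slot ends. -/
theorem profile_congr {A A' : ℤ × ℤ → Bool} {u v : ℤ} (h : A (slotAt n M u) = A' (slotAt n M u))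
    (hv : v = u ∨ v = u + 1) : profile n M A v = profile n M A' v := by
  have hd := twelve_le_dipDepth (n := n)
  obtain ⟨q, w, h0, h1, rfl⟩ := exists_column (n := n) M u
  rw [slotAt_column h0 h1] at h
  obtain ⟨w', rfl, hw'⟩ : ∃ w', v = macroScale n M * q + w' ∧ (w' = w ∨ w' = w + 1) := by
    rcases hv with rfl | rfl
    · exact ⟨w, rfl, .inl rfl⟩
    · exact ⟨w + 1, by ring, .inr rfl⟩
  rw [profile_column_end A (by omega) (by omega), profile_column_end A' (by omega) (by omega)]
  rcases lt_or_ge w 4 with h2 | h2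
  · rw [profileIn_ramp A q (by omega), profileIn_ramp A' q (by omega)]
  · obtain ⟨m, r, hm, hr0, hr1, rfl⟩ := exists_slot (n := n) h2
    have e : 4 + 2 * dipDepth n * m + r - 4 = 2 * dipDepth n * m + r := by ring
    rw [e, Int.mul_add_ediv_left _ _ (by omega), Int.ediv_eq_zero_of_lt hr0 hr1, add_zero] at h
    rcases hw' with rfl | rfl
    · rw [profileIn_slot_end A q hm hr0 hr1.le, profileIn_slot_end A' q hm hr0 hr1.le, h]
    · rw [add_assoc _ r, profileIn_slot_end A q hm (by omega) (by omega),
        profileIn_slot_end A' q hm (by omega) (by omega), h]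

/-- The profile does not depend on the dips at the ends of the slots. -/
theorem profile_eq_of_slotAt_ne {u : ℤ} (h : slotAt n M u ≠ slotAt n M (u + 1))
    (A A' : ℤ × ℤ → Bool) : profile n M A (u + 1) = profile n M A' (u + 1) := by
  set A'' : ℤ × ℤ → Bool := fun c => if c = slotAt n M u then A c else A' c with hA
  rw [profile_congr (A := A) (A' := A'') (u := u) (by simp [hA]) (.inr rfl)]
  exact profile_congr (u := u + 1) (by simp [hA, h.symm]) (.inl rfl)

theorem profile_ramp (A : ℤ × ℤ → Bool) (q : ℤ) {w : ℤ} (h0 : 0 ≤ w) (h1 : w ≤ 4) :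
    profile n M A (macroScale n M * q + w) = 4 * q + w := by
  have hd := twelve_le_dipDepth (n := n)
  have h2 : 4 ≤ macroScale n M := by
    unfold macroScale
    have : 0 ≤ 2 * dipDepth n * (n * M) := by positivity
    omega
  rw [profile_column_end A h0 (by omega), profileIn_ramp A q h1]

theorem profile_slot (A : ℤ × ℤ → Bool) (q : ℤ) {m r : ℤ} (hm : 0 ≤ m) (hm' : m < n * M)
    (h0 : 0 ≤ r) (h1 : r < 2 * dipDepth n) :
    profile n M A (macroScale n M * q + (4 + 2 * dipDepth n * m + r)) =
      4 * q + 4 - dip (dipDepth n) (A (q, m)) r := by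
  have hd := twelve_le_dipDepth (n := n)
  have h2 : 0 ≤ 2 * dipDepth n * m := by positivity
  have h3 : 2 * dipDepth n * (m + 1) ≤ 2 * dipDepth n * (n * M) := by gcongr; omega
  rw [profile_column A (by omega) (by unfold macroScale; linarith), profileIn_slot A q hm h0 h1]

theorem profile_bounds_column (A : ℤ × ℤ → Bool) {q w : ℤ} (h0 : 0 ≤ w)
    (h1 : w ≤ macroScale n M) : 4 * q + 4 - dipDepth n ≤ profile n M A (macroScale n M * q + w) ∧
      profile n M A (macroScale n M * q + w) ≤ 4 * q + 4 := by
  have hd := twelve_le_dipDepth (n := n)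
  rw [profile_column_end A h0 h1]
  rcases lt_or_ge w 4 with h2 | h2
  · rw [profileIn_ramp A q (by omega)]
    omega
  · obtain ⟨m, r, hm, hr0, hr1, rfl⟩ := exists_slot (n := n) h2
    rw [profileIn_slot A q hm hr0 hr1]
    have := dip_bounds (dipDepth n) (by omega) (A (q, m)) r hr0 hr1.le
    omega

theorem profile_ge (A : ℤ × ℤ → Bool) {u : ℤ} (hu : 0 ≤ u) :
    4 - dipDepth n ≤ profile n M A u := by
  obtain ⟨q, w, h0, h1, rfl⟩ := exists_column (n := n) M u
  have := (profile_bounds_column A (q := q) h0 h1.le).1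
  have hq : 0 ≤ q := by
    by_contra hq
    nlinarith
  omega

theorem profile_false_nonneg {u : ℤ} (hu : 0 ≤ u) : 0 ≤ profile n M (fun _ => false) u := by
  obtain ⟨q, w, h0, h1, rfl⟩ := exists_column (n := n) M u
  have hq : 0 ≤ q := by
    by_contra hq
    nlinarith
  rw [profile_column _ h0 h1]
  unfold profileIn dip
  split_ifs <;> simp_all <;> omega

theorem profile_le (A : ℤ × ℤ → Bool) {u : ℤ} {k : ℤ} (hu : u ≤ macroScale n M * (k + 1)) :
    profile n M A u ≤ 4 * (k + 1) := by
  rcases hu.eq_or_lt with rfl | hu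
  · have := profile_ramp (n := n) (M := M) A (k + 1) (w := 0) le_rfl (by omega)
    rw [add_zero] at this
    omega
  · obtain ⟨q, w, h0, h1, rfl⟩ := exists_column (n := n) M u
    have := (profile_bounds_column A (q := q) h0 h1.le).2
    have hq : q < k + 1 := by
      by_contra hq
      nlinarith
    omega

/-- The self-similarity behind the nesting: tiles of a row that read the same bits follow the same
curve, at heights that differ by 4 per step. -/
theorem profile_add (A : ℤ × ℤ → Bool) (u k : ℤ) :
    profile n M A (macroScale n M * k + u) =
      profile n M (fun c => A (c.1 + k, c.2)) u + 4 * k := by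
  obtain ⟨q, w, h0, h1, rfl⟩ := exists_column (n := n) M u
  have e : macroScale n M * k + (macroScale n M * q + w) = macroScale n M * (q + k) + w := by ring
  rw [e, profile_column A h0 h1, profile_column _ h0 h1]
  unfold profileIn
  split_ifs <;> ring

end profile

/-! ### Cells and pieces of paths -/

/-- A cell of a polyomino: its position depends on the bit of its slot. -/
structure Cell where
  slot : ℤ × ℤ
  pos : (ℤ × ℤ → Bool) → Pos

namespace Cell

/-- A cell at a fixed position. -/
def fixed (P : Pos) : Cell := ⟨0, fun _ => P⟩

/-- The position of a cell only depends on the bit of its slot. -/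
def IsLocal (c : Cell) : Prop := ∀ A B, A c.slot = B c.slot → c.pos A = c.pos B

/-- Two cells which may follow each other. -/
def Link (c c' : Cell) : Prop :=
  (∀ A, c'.pos A - c.pos A ∈ vonNeumann.carrier) ∧
    (c.slot ≠ c'.slot → ∀ A A', c.pos A = c.pos A' ∧ c'.pos A = c'.pos A')

theorem Link.symm {c c' : Cell} (h : Link c c') : Link c' c :=
  ⟨fun A => mem_vonNeumann_sub_comm.1 (h.1 A), fun hs A A' => (h.2 hs.symm A A').symm⟩

theorem link_of_const {c c' : Cell} {P P' : Pos} (h : ∀ A, c.pos A = P) (hc : ∀ A, c'.pos A = P')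
    (hP : P' - P ∈ vonNeumann.carrier) : Link c c' :=
  ⟨fun A => by rw [h, hc]; exact hP, fun _ A A' => by simp [h, hc]⟩

/-- A list of linked cells from `c` to `c'`. -/
def Piece (l : List Cell) (c c' : Cell) : Prop :=
  l.IsChain Link ∧ l.head? = some c ∧ l.getLast? = some c'

theorem Piece.append {l l' : List Cell} {a b c d : Cell} (h : Piece l a b) (h' : Piece l' c d)
    (hbc : Link b c) : Piece (l ++ l') a d := by
  refine ⟨List.isChain_append.2 ⟨h.1, h'.1, ?_⟩, ?_, ?_⟩
  · intro x hx y hy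
    rw [h.2.2] at hx
    rw [h'.2.1] at hy
    cases hx
    cases hy
    exact hbc
  · rw [List.head?_append, h.2.1]
    rfl
  · rw [List.getLast?_append, h'.2.2]
    rfl

theorem Piece.reverse {l : List Cell} {a b : Cell} (h : Piece l a b) : Piece l.reverse b a := by
  refine ⟨List.isChain_reverse.2 (h.1.imp fun _ _ => Link.symm), ?_, ?_⟩
  · rw [List.head?_reverse, h.2.2]
  · rw [List.getLast?_reverse, h.2.1]

theorem piece_singleton (c : Cell) : Piece [c] c c := ⟨List.isChain_singleton _, rfl, rfl⟩

/-- The list `f 0, …, f (m - 1)`. -/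
def seg (m : ℕ) (f : ℕ → Cell) : List Cell := (List.range m).map f

theorem mem_seg {m : ℕ} {f : ℕ → Cell} {c : Cell} : c ∈ seg m f ↔ ∃ j < m, f j = c := by
  simp [seg]

theorem length_seg (m : ℕ) (f : ℕ → Cell) : (seg m f).length = m := by simp [seg]

theorem piece_seg {m : ℕ} (f : ℕ → Cell) (h : ∀ j, j + 1 < m + 1 → Link (f j) (f (j + 1))) :
    Piece (seg (m + 1) f) (f 0) (f m) := by
  refine ⟨?_, ?_, ?_⟩
  · rw [seg, List.isChain_map, List.isChain_range_succ]
    exact fun j hj => h j (by omega)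
  · simp [seg, List.range_succ_eq_map]
  · simp [seg, List.range_succ]

/-- The cells of `l` have distinct positions, in the set `S`. -/
def Simple (A : ℤ × ℤ → Bool) (l : List Cell) (S : Set Pos) : Prop :=
  (l.map fun c => c.pos A).Nodup ∧ ∀ c ∈ l, c.pos A ∈ S

theorem Simple.append {A : ℤ × ℤ → Bool} {l l' : List Cell} {S S' : Set Pos} (h : Simple A l S)
    (h' : Simple A l' S') (hd : ∀ P ∈ S, P ∉ S') : Simple A (l ++ l') (S ∪ S') := by
  refine ⟨?_, ?_⟩
  · rw [List.map_append, List.nodup_append]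
    refine ⟨h.1, h'.1, ?_⟩
    intro a ha b hb e
    obtain ⟨c, hc, rfl⟩ := List.mem_map.1 ha
    obtain ⟨c', hc', rfl⟩ := List.mem_map.1 hb
    exact hd _ (h.2 c hc) (e ▸ h'.2 c' hc')
  · intro c hc
    rcases List.mem_append.1 hc with hc | hc
    exacts [.inl (h.2 c hc), .inr (h'.2 c hc)]

theorem Simple.reverse {A : ℤ × ℤ → Bool} {l : List Cell} {S : Set Pos} (h : Simple A l S) :
    Simple A l.reverse S :=
  ⟨by rw [List.map_reverse, List.nodup_reverse]; exact h.1,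
    fun c hc => h.2 c (List.mem_reverse.1 hc)⟩

theorem Simple.mono {A : ℤ × ℤ → Bool} {l : List Cell} {S S' : Set Pos} (h : Simple A l S)
    (hS : S ⊆ S') : Simple A l S' :=
  ⟨h.1, fun c hc => hS (h.2 c hc)⟩

theorem simple_singleton (A : ℤ × ℤ → Bool) (c : Cell) : Simple A [c] {c.pos A} := by
  simp [Simple]

theorem simple_seg {A : ℤ × ℤ → Bool} {m : ℕ} {f : ℕ → Cell} {S : Set Pos}
    (hinj : ∀ i < m, ∀ j < m, (f i).pos A = (f j).pos A → i = j)
    (hS : ∀ j < m, (f j).pos A ∈ S) : Simple A (seg m f) S := by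
  refine ⟨?_, ?_⟩
  · rw [seg, List.map_map]
    refine List.Nodup.map_on ?_ List.nodup_range
    intro i hi j hj e
    exact hinj i (List.mem_range.1 hi) j (List.mem_range.1 hj) e
  · intro c hc
    obtain ⟨j, hj, rfl⟩ := mem_seg.1 hc
    exact hS j hj

/-- A vertical line, upwards. -/
def vert (u v v' : ℤ) : List Cell := seg (v' - v + 1).toNat fun j => fixed (u, v + j)

/-- A horizontal line, rightwards. -/
def hor (u u' v : ℤ) : List Cell := seg (u' - u + 1).toNat fun j => fixed (u + j, v)

theorem piece_vert {u v v' : ℤ} (h : v ≤ v') :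
    Piece (vert u v v') (fixed (u, v)) (fixed (u, v')) := by
  obtain ⟨m, hm⟩ := Int.eq_ofNat_of_zero_le (sub_nonneg.2 h)
  have h1 : (v' - v + 1).toNat = m + 1 := by omega
  have h2 : v' = v + m := by omega
  rw [vert, h1, h2]
  convert piece_seg (m := m) (fun j => fixed (u, v + j)) ?_ using 2
  · simp
  · intro j _
    refine link_of_const (fun _ => rfl) (fun _ => rfl) (.inl ?_)
    simp

theorem piece_hor {u u' v : ℤ} (h : u ≤ u') :
    Piece (hor u u' v) (fixed (u, v)) (fixed (u', v)) := by
  obtain ⟨m, hm⟩ := Int.eq_ofNat_of_zero_le (sub_nonneg.2 h)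
  have h1 : (u' - u + 1).toNat = m + 1 := by omega
  have h2 : u' = u + m := by omega
  rw [hor, h1, h2]
  convert piece_seg (m := m) (fun j => fixed (u + j, v)) ?_ using 2
  · simp
  · intro j _
    refine link_of_const (fun _ => rfl) (fun _ => rfl) (.inr (.inl ?_))
    simp

theorem simple_vert (A : ℤ × ℤ → Bool) (u v v' : ℤ) :
    Simple A (vert u v v') {P | P.1 = u ∧ v ≤ P.2 ∧ P.2 ≤ v'} := by
  refine simple_seg (fun i _ j _ e => by simpa [fixed] using e) fun j hj => ?_
  change u = u ∧ v ≤ v + j ∧ v + j ≤ v'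
  omega

theorem simple_hor (A : ℤ × ℤ → Bool) (u u' v : ℤ) :
    Simple A (hor u u' v) {P | P.2 = v ∧ u ≤ P.1 ∧ P.1 ≤ u'} := by
  refine simple_seg (fun i _ j _ e => by simpa [fixed] using e) fun j hj => ?_
  change v = v ∧ u ≤ u + j ∧ u + j ≤ u'
  omega

theorem isLocal_fixed (P : Pos) : (fixed P).IsLocal := fun _ _ _ => rfl

theorem isLocal_vert {u v v' : ℤ} : ∀ c ∈ vert u v v', c.IsLocal := by
  intro c hc
  obtain ⟨j, -, rfl⟩ := mem_seg.1 hc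
  exact isLocal_fixed _

theorem isLocal_hor {u u' v : ℤ} : ∀ c ∈ hor u u' v, c.IsLocal := by
  intro c hc
  obtain ⟨j, -, rfl⟩ := mem_seg.1 hc
  exact isLocal_fixed _

theorem mem_vert {u v v' w : ℤ} (h : v ≤ w) (h' : w ≤ v') : fixed (u, w) ∈ vert u v v' :=
  mem_seg.2 ⟨(w - v).toNat, by omega, by rw [Int.toNat_of_nonneg (by omega), add_sub_cancel]⟩

theorem length_vert (u v v' : ℤ) : (vert u v v').length = (v' - v + 1).toNat := length_seg _ _

theorem length_hor (u u' v : ℤ) : (hor u u' v).length = (u' - u + 1).toNat := length_seg _ _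

/-! ### Legs -/

variable (n M : ℕ)

/-- The cells of a line which follows the profile at the height `o`. -/
def leg (o : ℤ) (j : ℕ) : Cell :=
  ⟨slotAt n M (j / 2 : ℕ), fun A => ((j / 2 : ℕ), o + profile n M A ((j + 1) / 2 : ℕ))⟩

/-- The cells of the upper arm. -/
def upperLeg (j : ℕ) : Cell :=
  fixed ((j / 2 : ℕ), dipDepth n - profile n M (fun _ => false) ((j + 1) / 2 : ℕ))

/-- The number of columns of a leg. -/
def legLength : ℕ := (n + 1) * (macroScale n M).toNat

variable {n M}

theorem leg_even (o : ℤ) (u : ℕ) (A : ℤ × ℤ → Bool) :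
    (leg n M o (2 * u)).pos A = ((u : ℤ), o + profile n M A u) := by
  have h1 : 2 * u / 2 = u := by omega
  have h2 : (2 * u + 1) / 2 = u := by omega
  rw [leg, h1, h2]

theorem leg_odd (o : ℤ) (u : ℕ) (A : ℤ × ℤ → Bool) :
    (leg n M o (2 * u + 1)).pos A = ((u : ℤ), o + profile n M A (u + 1)) := by
  have h1 : (2 * u + 1) / 2 = u := by omega
  have h2 : (2 * u + 1 + 1) / 2 = u + 1 := by omega
  rw [leg, h1, h2]
  push_cast
  rfl

theorem slot_leg_even (o : ℤ) (u : ℕ) : (leg n M o (2 * u)).slot = slotAt n M u := by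
  have h1 : 2 * u / 2 = u := by omega
  rw [leg, h1]

theorem slot_leg_odd (o : ℤ) (u : ℕ) : (leg n M o (2 * u + 1)).slot = slotAt n M u := by
  have h1 : (2 * u + 1) / 2 = u := by omega
  rw [leg, h1]

theorem upperLeg_even (u : ℕ) (A : ℤ × ℤ → Bool) : (upperLeg n M (2 * u)).pos A =
    ((u : ℤ), dipDepth n - profile n M (fun _ => false) u) := by
  have h1 : 2 * u / 2 = u := by omega
  have h2 : (2 * u + 1) / 2 = u := by omega
  rw [upperLeg, h1, h2, fixed]

theorem upperLeg_odd (u : ℕ) (A : ℤ × ℤ → Bool) : (upperLeg n M (2 * u + 1)).pos A =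
    ((u : ℤ), dipDepth n - profile n M (fun _ => false) (u + 1)) := by
  have h1 : (2 * u + 1) / 2 = u := by omega
  have h2 : (2 * u + 1 + 1) / 2 = u + 1 := by omega
  rw [upperLeg, h1, h2, fixed]
  push_cast
  rfl

theorem isLocal_leg (o : ℤ) (j : ℕ) : (leg n M o j).IsLocal := by
  intro A A' h
  obtain ⟨u, rfl | rfl⟩ := j.even_or_odd'
  · rw [slot_leg_even] at h
    rw [leg_even, leg_even, profile_congr h (.inl rfl)]
  · rw [slot_leg_odd] at h
    rw [leg_odd, leg_odd, profile_congr h (.inr rfl)]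

theorem vertical_mem_vonNeumann {a b b' : ℤ} (h : b' = b + 1 ∨ b' = b - 1) :
    ((a, b') : Pos) - (a, b) ∈ vonNeumann.carrier := by
  simp only [vonNeumann, Set.mem_insert_iff, Set.mem_singleton_iff, Prod.mk_sub_mk, Prod.mk.injEq]
  omega

theorem horizontal_mem_vonNeumann {a a' b : ℤ} (h : a' = a + 1 ∨ a' = a - 1) :
    ((a', b) : Pos) - (a, b) ∈ vonNeumann.carrier := by
  simp only [vonNeumann, Set.mem_insert_iff, Set.mem_singleton_iff, Prod.mk_sub_mk, Prod.mk.injEq]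
  omega

/-- Even to odd cells is a vertical step inside a column. Odd to even is the step to the next
column; only there may the slot change, and the profile then has no dip whatever the bits. -/
theorem link_leg (o : ℤ) (j : ℕ) : Link (leg n M o j) (leg n M o (j + 1)) := by
  obtain ⟨u, rfl | rfl⟩ := j.even_or_odd'
  · refine ⟨fun A => ?_, fun hs => ?_⟩
    · rw [leg_even, leg_odd]
      apply vertical_mem_vonNeumann
      have := profile_step (n := n) (M := M) A u
      omega
    · rw [slot_leg_even, slot_leg_odd] at hs
      exact (hs rfl).elim
  · have e : 2 * u + 1 + 1 = 2 * (u + 1) := by ring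
    rw [e]
    refine ⟨fun A => ?_, fun hs A A' => ?_⟩
    · rw [leg_even, leg_odd]
      push_cast
      exact horizontal_mem_vonNeumann (.inl rfl)
    · rw [slot_leg_even, slot_leg_odd] at hs
      push_cast at hs
      rw [leg_even, leg_even, leg_odd, leg_odd]
      push_cast
      rw [profile_eq_of_slotAt_ne hs A A']
      exact ⟨rfl, rfl⟩

theorem link_upperLeg (j : ℕ) : Link (upperLeg n M j) (upperLeg n M (j + 1)) := by
  refine link_of_const (fun _ => rfl) (fun _ => rfl) ?_
  change (upperLeg n M (j + 1)).pos (fun _ => false) - (upperLeg n M j).pos (fun _ => false) ∈ _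
  obtain ⟨u, rfl | rfl⟩ := j.even_or_odd'
  · rw [upperLeg_even, upperLeg_odd]
    apply vertical_mem_vonNeumann
    have := profile_step (n := n) (M := M) (fun _ => false) u
    omega
  · have e : 2 * u + 1 + 1 = 2 * (u + 1) := by ring
    rw [e, upperLeg_even, upperLeg_odd]
    push_cast
    exact horizontal_mem_vonNeumann (.inl rfl)

/-- Each column contains two cells of the leg, whose heights differ by one. -/
theorem leg_injective (o : ℤ) (A : ℤ × ℤ → Bool) :
    Function.Injective fun j => (leg n M o j).pos A := by
  intro i j h
  simp only at h
  obtain ⟨a, rfl | rfl⟩ := i.even_or_odd' <;> obtain ⟨b, rfl | rfl⟩ := j.even_or_odd' <;>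
    simp only [leg_even, leg_odd, Prod.mk.injEq, Nat.cast_inj] at h <;> obtain ⟨rfl, h⟩ := h
  · rfl
  · have := profile_step (n := n) (M := M) A a
    omega
  · have := profile_step (n := n) (M := M) A a
    omega
  · rfl

theorem upperLeg_injective (A : ℤ × ℤ → Bool) :
    Function.Injective fun j => (upperLeg n M j).pos A := by
  intro i j h
  simp only at h
  obtain ⟨a, rfl | rfl⟩ := i.even_or_odd' <;> obtain ⟨b, rfl | rfl⟩ := j.even_or_odd' <;>
    simp only [upperLeg_even, upperLeg_odd, Prod.mk.injEq, Nat.cast_inj] at h <;>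
    obtain ⟨rfl, h⟩ := h
  · rfl
  · have := profile_step (n := n) (M := M) (fun _ => false) a
    omega
  · have := profile_step (n := n) (M := M) (fun _ => false) a
    omega
  · rfl

/-- The positions of a leg from the column `a` on. -/
def legSet (n M : ℕ) (A : ℤ × ℤ → Bool) (o a : ℤ) : Set Pos :=
  {P | a ≤ P.1 ∧ P.1 < legLength n M ∧
    (P.2 = o + profile n M A P.1 ∨ P.2 = o + profile n M A (P.1 + 1))}

/-- The positions of the upper arm. -/
def upperSet (n M : ℕ) : Set Pos :=
  {P | 0 ≤ P.1 ∧ P.1 < legLength n M ∧ (P.2 = dipDepth n - profile n M (fun _ => false) P.1 ∨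
    P.2 = dipDepth n - profile n M (fun _ => false) (P.1 + 1))}

theorem leg_mem_legSet (A : ℤ × ℤ → Bool) (o : ℤ) {a j : ℕ} (ha : 2 * a ≤ j)
    (hj : j < 2 * legLength n M) : (leg n M o j).pos A ∈ legSet n M A o a := by
  obtain ⟨u, rfl | rfl⟩ := j.even_or_odd'
  · rw [leg_even]
    exact ⟨by simp; omega, by simp; omega, .inl rfl⟩
  · rw [leg_odd]
    exact ⟨by simp; omega, by simp; omega, .inr rfl⟩

theorem upperLeg_mem_upperSet (A : ℤ × ℤ → Bool) {j : ℕ} (hj : j < 2 * legLength n M) :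
    (upperLeg n M j).pos A ∈ upperSet n M := by
  obtain ⟨u, rfl | rfl⟩ := j.even_or_odd'
  · rw [upperLeg_even]
    exact ⟨by simp, by simp; omega, .inl rfl⟩
  · rw [upperLeg_odd]
    exact ⟨by simp, by simp; omega, .inr rfl⟩

end Cell

namespace Cell

/-! ### Polyominoes as lists of cells -/

/-- The position of the end of the polyominoes at each side. -/
def portCell (n M : ℕ) : Port → Pos
  | .left => (0, -dipDepth n)
  | .bottom => (0, dipDepth n + 1 - macroScale n M)
  | .right => (macroScale n M - 1, -dipDepth n)
  | .top => (0, dipDepth n)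

/-- The path from a side to the beginning of the first leg. -/
def entry (n M : ℕ) : Port → List Cell
  | .left => vert 0 (-dipDepth n) 1
  | .bottom => vert 0 (dipDepth n + 1 - macroScale n M) 1
  | .right => (hor 1 (macroScale n M - 1) (-dipDepth n)).reverse ++ vert 0 (-dipDepth n) 1
  | .top => []

/-- The path from the end of the leg below the first one to a side. -/
def exit (n M : ℕ) : Port → List Cell
  | .right => (vert 1 (-dipDepth n) 0).reverse ++ hor 2 (macroScale n M - 1) (-dipDepth n)
  | .bottom => (vert 1 (dipDepth n + 1 - macroScale n M) 0).reverse ++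
      [fixed (0, dipDepth n + 1 - macroScale n M)]
  | _ => []

/-- A polyomino between two of the sides `left`, `bottom` and `right`. -/
def doubled (n M : ℕ) (a b : Port) : List Cell :=
  entry n M a ++ (seg (2 * legLength n M) (leg n M 2) ++
    ((vert (legLength n M) (4 * (n + 1)) (4 * (n + 1) + 2)).reverse ++
      ((seg (2 * legLength n M - 2) fun j => leg n M 0 (j + 2)).reverse ++ exit n M b)))

/-- A polyomino from one of the sides `left`, `bottom` and `right` to the side `top`. -/
def single (n M : ℕ) (a : Port) : List Cell :=
  entry n M a ++ (seg (2 * legLength n M) (leg n M 2) ++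
    (vert (legLength n M) (4 * (n + 1) + 2) (4 * (n + 1) + 4) ++
      (seg (2 * legLength n M) (upperLeg n M)).reverse))

/-- The cells of the polyominoes of a route. -/
def template (n M : ℕ) : Port → Port → List Cell
  | .left, .bottom => doubled n M .left .bottom
  | .left, .right => doubled n M .left .right
  | .bottom, .right => doubled n M .bottom .right
  | .left, .top => single n M .left
  | .bottom, .top => single n M .bottom
  | .right, .top => single n M .right
  | .bottom, .left => (doubled n M .left .bottom).reverse
  | .right, .left => (doubled n M .left .right).reverse
  | .right, .bottom => (doubled n M .bottom .right).reverse
  | .top, .left => (single n M .left).reverse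
  | .top, .bottom => (single n M .bottom).reverse
  | .top, .right => (single n M .right).reverse
  | _, _ => []

/-- The region reserved to a macrotile: outside of the previous nested strip, and inside of the
next one. -/
def region (n M : ℕ) (A : ℤ × ℤ → Bool) : Set Pos :=
  {P | 0 ≤ P.1 ∧ dipDepth n + 1 - macroScale n M ≤ P.2 ∧ P.2 ≤ dipDepth n ∧
    (legLength n M ≤ P.1 ∨ P.2 < min (profile n M A P.1) (profile n M A (P.1 + 1)) + 4 ∨
      dipDepth n - min (profile n M (fun _ => false) P.1) (profile n M (fun _ => false) (P.1 + 1))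
        - 4 < P.2) ∧
    (P.1 < macroScale n M ∨ P.1 < legLength n M + macroScale n M ∧
      min (profile n M A P.1) (profile n M A (P.1 + 1)) ≤ P.2 ∧ P.2 ≤ dipDepth n -
        min (profile n M (fun _ => false) P.1) (profile n M (fun _ => false) (P.1 + 1)))}

/-- An upper bound for the number of cells of the polyominoes. -/
def sizeBound (n M : ℕ) : ℕ := 4 * legLength n M + 4 * (macroScale n M).toNat

/-- The properties of the lists of cells of the polyominoes between the sides `a` and `b`. -/
structure IsPath (n M : ℕ) (a b : Port) (l : List Cell) : Prop where
  piece : ∃ c c', Piece l c c' ∧ (∀ A, c.pos A = portCell n M a) ∧ ∀ A, c'.pos A = portCell n M b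
  simple : ∀ A, Simple A l (region n M A)
  isLocal : ∀ c ∈ l, c.IsLocal
  ref : fixed 0 ∈ l
  leg_mem : ∀ j < 2 * legLength n M, leg n M 2 j ∈ l
  length_le : l.length ≤ sizeBound n M

theorem IsPath.reverse {n M : ℕ} {a b : Port} {l : List Cell} (h : IsPath n M a b l) :
    IsPath n M b a l.reverse where
  piece := by
    obtain ⟨c, c', h1, h2, h3⟩ := h.piece
    exact ⟨c', c, h1.reverse, h3, h2⟩
  simple A := (h.simple A).reverse
  isLocal c hc := h.isLocal c (List.mem_reverse.1 hc)
  ref := List.mem_reverse.2 h.ref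
  leg_mem j hj := List.mem_reverse.2 (h.leg_mem j hj)
  length_le := by rw [List.length_reverse]; exact h.length_le

variable {n M : ℕ}

theorem cast_legLength : (legLength n M : ℤ) = macroScale n M * (n + 1) := by
  rw [legLength]
  push_cast
  rw [Int.toNat_of_nonneg (macroScale_pos (n := n) (M := M)).le]
  ring

theorem macroScale_le_legLength : macroScale n M ≤ legLength n M := by
  rw [cast_legLength]
  have := macroScale_pos (n := n) (M := M)
  nlinarith

theorem profile_ramp_zero (A : ℤ × ℤ → Bool) {w : ℤ} (h0 : 0 ≤ w) (h1 : w ≤ 4) :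
    profile n M A w = w := by
  simpa using profile_ramp (n := n) (M := M) A 0 h0 h1

theorem profile_legLength (A : ℤ × ℤ → Bool) {w : ℤ} (h0 : 0 ≤ w) (h1 : w ≤ 4) :
    profile n M A (legLength n M + w) = 4 * (n + 1) + w := by
  rw [cast_legLength]
  exact profile_ramp (n := n) (M := M) A (n + 1) h0 h1

theorem profile_le_of_le (A : ℤ × ℤ → Bool) {u : ℤ} (hu : u ≤ legLength n M) :
    profile n M A u ≤ 4 * (n + 1) :=
  profile_le A (by rwa [cast_legLength] at hu)

/-! ### The polyominoes are simple paths within their regions. -/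

/-- The positions of the entries. -/
def entrySet (n M : ℕ) (a : Port) : Set Pos :=
  {P | (P.1 = 0 ∧ P.2 ≤ 1 ∧
      (-dipDepth n ≤ P.2 ∨ a = .bottom ∧ dipDepth n + 1 - macroScale n M ≤ P.2)) ∨
    (a = .right ∧ 1 ≤ P.1 ∧ P.1 < macroScale n M ∧ P.2 = -dipDepth n)}

/-- The positions of the exits. -/
def exitSet (n M : ℕ) (b : Port) : Set Pos :=
  {P | (P.1 = 1 ∧ P.2 ≤ 0 ∧ dipDepth n + 1 - macroScale n M ≤ P.2) ∨
    (b = .right ∧ 2 ≤ P.1 ∧ P.1 < macroScale n M ∧ P.2 = -dipDepth n) ∨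
    (b = .bottom ∧ P.1 = 0 ∧ P.2 = dipDepth n + 1 - macroScale n M)}

theorem piece_entry (hn : 1 ≤ n) (hM : 1 ≤ M) {a : Port} (ha : a ≠ .top) :
    Piece (entry n M a) (fixed (portCell n M a)) (fixed (0, 1)) := by
  have hd := twelve_le_dipDepth (n := n)
  have hs := macroScale_ge hn hM
  cases a
  · exact piece_vert (by omega)
  · exact piece_vert (by omega)
  · refine (piece_hor (by omega)).reverse.append (piece_vert (by omega)) ?_
    exact link_of_const (fun _ => rfl) (fun _ => rfl) (horizontal_mem_vonNeumann (.inr rfl))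
  · exact (ha rfl).elim

theorem simple_entry (A : ℤ × ℤ → Bool) {a : Port} :
    Simple A (entry n M a) (entrySet n M a) := by
  cases a
  · refine (simple_vert A _ _ _).mono fun P hP => ?_
    simp only [Set.mem_ofPred_eq, entrySet] at hP ⊢
    omega
  · refine (simple_vert A _ _ _).mono fun P hP => ?_
    simp only [Set.mem_ofPred_eq, entrySet, true_and] at hP ⊢
    omega
  · refine ((simple_hor A _ _ _).reverse.append (simple_vert A _ _ _) fun P hP => ?_).mono
      fun P hP => ?_
    · simp only [Set.mem_ofPred_eq] at hP ⊢
      omega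
    · simp only [Set.mem_union, Set.mem_ofPred_eq, entrySet, true_and] at hP ⊢
      omega
  · simp [Simple, entry]

theorem piece_exit (hn : 1 ≤ n) (hM : 1 ≤ M) {b : Port} (hb : b = .bottom ∨ b = .right) :
    Piece (exit n M b) (fixed (1, 0)) (fixed (portCell n M b)) := by
  have hd := twelve_le_dipDepth (n := n)
  have hs := macroScale_ge hn hM
  rcases hb with rfl | rfl
  · refine (piece_vert (by omega)).reverse.append (piece_singleton _) ?_
    exact link_of_const (fun _ => rfl) (fun _ => rfl) (horizontal_mem_vonNeumann (.inr rfl))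
  · refine (piece_vert (by omega)).reverse.append (piece_hor (by omega)) ?_
    exact link_of_const (fun _ => rfl) (fun _ => rfl) (horizontal_mem_vonNeumann (.inl rfl))

theorem simple_exit (hn : 1 ≤ n) (hM : 1 ≤ M) (A : ℤ × ℤ → Bool) {b : Port} :
    Simple A (exit n M b) (exitSet n M b) := by
  have hd := twelve_le_dipDepth (n := n)
  have hs := macroScale_ge hn hM
  cases b
  · simp [Simple, exit]
  · refine ((simple_vert A _ _ _).reverse.append (simple_singleton A _) fun P hP => ?_).mono
      fun P hP => ?_
    · simp only [Set.mem_ofPred_eq, Set.mem_singleton_iff, fixed, Prod.ext_iff] at hP ⊢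
      omega
    · simp only [Set.mem_union, Set.mem_ofPred_eq, Set.mem_singleton_iff, fixed, Prod.ext_iff,
        exitSet, true_and] at hP ⊢
      omega
  · refine ((simple_vert A _ _ _).reverse.append (simple_hor A _ _ _) fun P hP => ?_).mono
      fun P hP => ?_
    · simp only [Set.mem_ofPred_eq] at hP ⊢
      omega
    · simp only [Set.mem_union, Set.mem_ofPred_eq, exitSet, true_and] at hP ⊢
      omega
  · simp [Simple, exit]

theorem length_entry_le (hn : 1 ≤ n) (hM : 1 ≤ M) (a : Port) :
    (entry n M a).length ≤ 2 * (macroScale n M).toNat - 5 := by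
  have hd := twelve_le_dipDepth (n := n)
  have hs := macroScale_ge hn hM
  cases a <;> simp only [entry, List.length_append, List.length_reverse, length_vert, length_hor,
    List.length_nil] <;> omega

theorem length_exit_le (hn : 1 ≤ n) (hM : 1 ≤ M) (b : Port) :
    (exit n M b).length ≤ 2 * (macroScale n M).toNat := by
  have hd := twelve_le_dipDepth (n := n)
  have hs := macroScale_ge hn hM
  cases b <;> simp only [exit, List.length_append, List.length_reverse, length_vert, length_hor,
    List.length_nil, List.length_singleton] <;> omega

theorem isLocal_entry {a : Port} : ∀ c ∈ entry n M a, c.IsLocal := by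
  cases a <;> simp only [entry, List.mem_append, List.mem_reverse, List.not_mem_nil] <;>
    intro c hc
  · exact isLocal_vert c hc
  · exact isLocal_vert c hc
  · exact hc.elim (isLocal_hor c) (isLocal_vert c)
  · exact hc.elim

theorem isLocal_exit {b : Port} : ∀ c ∈ exit n M b, c.IsLocal := by
  cases b <;> simp only [exit, List.mem_append, List.mem_reverse, List.not_mem_nil,
    List.mem_singleton] <;> intro c hc
  · exact hc.elim
  · exact hc.elim (isLocal_vert c) fun h => h ▸ isLocal_fixed _
  · exact hc.elim (isLocal_vert c) (isLocal_hor c)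
  · exact hc.elim

theorem fixed_zero_mem_entry (hn : 1 ≤ n) (hM : 1 ≤ M) {a : Port} (ha : a ≠ .top) :
    fixed 0 ∈ entry n M a := by
  have hd := twelve_le_dipDepth (n := n)
  have hs := macroScale_ge hn hM
  cases a
  · exact mem_vert (by omega) (by omega)
  · exact mem_vert (by omega) (by omega)
  · exact List.mem_append_right _ (mem_vert (by omega) (by omega))
  · exact (ha rfl).elim

theorem exists_legLength_eq (hn : 1 ≤ n) (hM : 1 ≤ M) : ∃ W, legLength n M = W + 2 := by
  have hd := twelve_le_dipDepth (n := n)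
  have hs := macroScale_ge hn hM
  have := macroScale_le_legLength (n := n) (M := M)
  exact ⟨legLength n M - 2, by omega⟩

/-- The first leg: its ends. -/
theorem piece_outward (hn : 1 ≤ n) (hM : 1 ≤ M) : ∃ c c',
    Piece (seg (2 * legLength n M) (leg n M 2)) c c' ∧ (∀ A, c.pos A = (0, 2)) ∧
      ∀ A, c'.pos A = ((legLength n M : ℤ) - 1, 4 * ((n : ℤ) + 1) + 2) := by
  obtain ⟨W, hW⟩ := exists_legLength_eq hn hM
  have e : 2 * legLength n M = 2 * (W + 1) + 1 + 1 := by omega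
  refine ⟨leg n M 2 (2 * 0), leg n M 2 (2 * (W + 1) + 1), ?_, fun A => ?_, fun A => ?_⟩
  · rw [e]
    exact piece_seg _ fun j _ => link_leg _ _
  · rw [leg_even, Nat.cast_zero, profile_ramp_zero A le_rfl (by omega)]
    rfl
  · have := profile_legLength (n := n) (M := M) A (w := 0) le_rfl (by omega)
    rw [hW] at this ⊢
    push_cast at this ⊢
    rw [leg_odd]
    push_cast
    rw [show (W : ℤ) + 1 + 1 = W + 2 + 0 by ring, this]
    ext <;> simp <;> ring

theorem piece_inward (hn : 1 ≤ n) (hM : 1 ≤ M) : ∃ c c',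
    Piece (seg (2 * legLength n M - 2) fun j => leg n M 0 (j + 2)).reverse c c' ∧
      (∀ A, c.pos A = ((legLength n M : ℤ) - 1, 4 * ((n : ℤ) + 1))) ∧ ∀ A, c'.pos A = (1, 1) := by
  obtain ⟨W, hW⟩ := exists_legLength_eq hn hM
  have e : 2 * legLength n M - 2 = 2 * W + 1 + 1 := by omega
  refine ⟨leg n M 0 (2 * (W + 1) + 1), leg n M 0 (2 * 1), ?_, fun A => ?_, fun A => ?_⟩
  · rw [e]
    have := piece_seg (m := 2 * W + 1) (fun j => leg n M 0 (j + 2)) fun j _ => link_leg _ _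
    exact this.reverse
  · have := profile_legLength (n := n) (M := M) A (w := 0) le_rfl (by omega)
    rw [hW] at this ⊢
    push_cast at this ⊢
    rw [leg_odd]
    push_cast
    rw [show (W : ℤ) + 1 + 1 = W + 2 + 0 by ring, this]
    ext
    · simp; ring
    · simp
  · rw [leg_even, Nat.cast_one, profile_ramp_zero A (by omega) (by omega)]
    rfl

theorem piece_upper (hn : 1 ≤ n) (hM : 1 ≤ M) : ∃ c c',
    Piece (seg (2 * legLength n M) (upperLeg n M)).reverse c c' ∧
      (∀ A, c.pos A = ((legLength n M : ℤ) - 1, 4 * ((n : ℤ) + 1) + 4)) ∧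
      ∀ A, c'.pos A = (0, dipDepth n) := by
  obtain ⟨W, hW⟩ := exists_legLength_eq hn hM
  have e : 2 * legLength n M = 2 * (W + 1) + 1 + 1 := by omega
  refine ⟨upperLeg n M (2 * (W + 1) + 1), upperLeg n M (2 * 0), ?_, fun A => ?_, fun A => ?_⟩
  · rw [e]
    exact (piece_seg (upperLeg n M) fun j _ => link_upperLeg j).reverse
  · have := profile_legLength (n := n) (M := M) (fun _ => false) (w := 0) le_rfl (by omega)
    rw [hW] at this ⊢
    push_cast at this ⊢
    rw [upperLeg_odd]
    push_cast
    rw [show (W : ℤ) + 1 + 1 = W + 2 + 0 by ring, this, dipDepth]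
    ext <;> simp <;> ring
  · rw [upperLeg_even, Nat.cast_zero, profile_ramp_zero _ le_rfl (by omega)]
    simp

theorem simple_outward (A : ℤ × ℤ → Bool) :
    Simple A (seg (2 * legLength n M) (leg n M 2)) (legSet n M A 2 0) :=
  simple_seg (fun _ _ _ _ e => leg_injective _ _ e) fun _ hj => leg_mem_legSet A 2 (a := 0)
    (by omega) hj

theorem simple_inward (A : ℤ × ℤ → Bool) :
    Simple A (seg (2 * legLength n M - 2) fun j => leg n M 0 (j + 2)) (legSet n M A 0 1) :=
  simple_seg (fun i _ j _ e => by
    have := leg_injective (n := n) (M := M) 0 A (a₁ := i + 2) (a₂ := j + 2) e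
    omega) fun _ hj => leg_mem_legSet A 0 (a := 1) (by omega) (by omega)

theorem simple_upper (A : ℤ × ℤ → Bool) :
    Simple A (seg (2 * legLength n M) (upperLeg n M)) (upperSet n M) :=
  simple_seg (fun _ _ _ _ e => upperLeg_injective A e) fun _ hj => upperLeg_mem_upperSet A hj

theorem isLocal_seg_leg {m : ℕ} {o : ℤ} {i : ℕ} :
    ∀ c ∈ seg m (fun j => leg n M o (j + i)), c.IsLocal := by
  intro c hc
  obtain ⟨j, -, rfl⟩ := mem_seg.1 hc
  exact isLocal_leg _ _

theorem isLocal_seg_upperLeg {m : ℕ} : ∀ c ∈ seg m (upperLeg n M), c.IsLocal := by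
  intro c hc
  obtain ⟨j, -, rfl⟩ := mem_seg.1 hc
  exact isLocal_fixed _

/-- The positions of the end of a macrotile, where its legs meet. -/
def tipSet (n M : ℕ) : Set Pos :=
  {P | P.1 = legLength n M ∧ 4 * (n + 1) ≤ P.2 ∧ P.2 ≤ 4 * (n + 1) + 4}

theorem profile_bounds (A : ℤ × ℤ → Bool) {u : ℤ} (h0 : 0 ≤ u) (h1 : u < legLength n M) :
    4 - dipDepth n ≤ profile n M A u ∧ 4 - dipDepth n ≤ profile n M A (u + 1) ∧
      profile n M A u ≤ 4 * (n + 1) ∧ profile n M A (u + 1) ≤ 4 * (n + 1) :=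
  ⟨profile_ge A h0, profile_ge A (by omega), profile_le_of_le A h1.le, profile_le_of_le A h1⟩

theorem entrySet_subset_region (hn : 1 ≤ n) (hM : 1 ≤ M) (A : ℤ × ℤ → Bool) (a : Port) :
    entrySet n M a ⊆ region n M A := by
  have hd := twelve_le_dipDepth (n := n)
  have hs := macroScale_ge hn hM
  rintro ⟨u, v⟩ h
  simp only [entrySet, region, Set.mem_ofPred_eq] at h ⊢
  have h0 : 0 ≤ u := by omega
  have h1 := profile_ge (n := n) (M := M) A h0
  have h2 := profile_ge (n := n) (M := M) A (u := u + 1) (by omega)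
  rcases h with ⟨rfl, h⟩ | h
  · rw [profile_ramp_zero A le_rfl (by omega), profile_ramp_zero A (w := 0 + 1) (by omega) (by omega)]
    omega
  · omega

theorem exitSet_subset_region (hn : 1 ≤ n) (hM : 1 ≤ M) (A : ℤ × ℤ → Bool) (b : Port) :
    exitSet n M b ⊆ region n M A := by
  have hd := twelve_le_dipDepth (n := n)
  have hs := macroScale_ge hn hM
  rintro ⟨u, v⟩ h
  simp only [exitSet, region, Set.mem_ofPred_eq] at h ⊢
  have h0 : 0 ≤ u := by omega
  have h1 := profile_ge (n := n) (M := M) A h0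
  have h2 := profile_ge (n := n) (M := M) A (u := u + 1) (by omega)
  rcases h with ⟨rfl, h⟩ | h
  · rw [profile_ramp_zero A (w := 1) (by omega) (by omega),
      profile_ramp_zero A (w := 1 + 1) (by omega) (by omega)]
    omega
  · omega

theorem legSet_subset_region (hn : 1 ≤ n) (hM : 1 ≤ M) (A : ℤ × ℤ → Bool) {o a : ℤ} (ho : 0 ≤ o)
    (ho' : o ≤ 2) (ha : 0 ≤ a) : legSet n M A o a ⊆ region n M A := by
  -- As `d = 2 * (4 * (n + 1)) + 4`, the upper arm stays at height at least `4 * (n + 1) + 4`, above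
  -- the legs, which stay at most at `4 * (n + 1) + 2`.
  have hN : dipDepth n = 8 * n + 12 := rfl
  have hs := macroScale_ge hn hM
  rintro ⟨u, v⟩ h
  simp only [legSet, region, Set.mem_ofPred_eq] at h ⊢
  have h1 := profile_bounds (n := n) (M := M) A (u := u) (by omega) (by omega)
  have h2 := profile_bounds (n := n) (M := M) (fun _ => false) (u := u) (by omega) (by omega)
  have h3 := profile_step (n := n) (M := M) A u
  omega

theorem upperSet_subset_region (hn : 1 ≤ n) (hM : 1 ≤ M) (A : ℤ × ℤ → Bool) :
    upperSet n M ⊆ region n M A := by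
  have hN : dipDepth n = 8 * n + 12 := rfl
  have hs := macroScale_ge hn hM
  rintro ⟨u, v⟩ h
  simp only [upperSet, region, Set.mem_ofPred_eq] at h ⊢
  have h1 := profile_bounds (n := n) (M := M) A (u := u) (by omega) (by omega)
  have h2 := profile_bounds (n := n) (M := M) (fun _ => false) (u := u) (by omega) (by omega)
  have h3 := profile_step (n := n) (M := M) (fun _ => false) u
  have h4 := profile_false_nonneg (n := n) (M := M) (u := u) (by omega)
  have h5 := profile_false_nonneg (n := n) (M := M) (u := u + 1) (by omega)
  omega

theorem tipSet_subset_region (hn : 1 ≤ n) (hM : 1 ≤ M) (A : ℤ × ℤ → Bool) :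
    tipSet n M ⊆ region n M A := by
  have hN : dipDepth n = 8 * n + 12 := rfl
  have hs := macroScale_ge hn hM
  have fW := profile_legLength (n := n) (M := M) A (w := 0) le_rfl (by omega)
  have fW' := profile_legLength (n := n) (M := M) A (w := 1) (by omega) (by omega)
  have gW := profile_legLength (n := n) (M := M) (fun _ => false) (w := 0) le_rfl (by omega)
  have gW' := profile_legLength (n := n) (M := M) (fun _ => false) (w := 1) (by omega) (by omega)
  rw [add_zero] at fW gW
  rintro ⟨u, v⟩ h
  simp only [tipSet, region, Set.mem_ofPred_eq] at h ⊢
  obtain ⟨rfl, h⟩ := h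
  rw [fW, fW', gW, gW']
  omega

/-- The entry climbs column 0 up to height 1, the leg at offset 2 goes out from `(0, 2)`, and the
leg at offset 0 comes back to `(1, 1)`; it omits column 0, taken by the entry. The exit goes down
column 1. The horizontal corridor at height `-dipDepth n` lies below all dips, which stop at `4 -
dipDepth n`. -/
theorem isPath_doubled (hn : 1 ≤ n) (hM : 1 ≤ M) {a b : Port} (ha : a ≠ .top)
    (hab : a = .left ∧ b = .bottom ∨ a ≠ .right ∧ b = .right) :
    IsPath n M a b (doubled n M a b) := by
  have hd := twelve_le_dipDepth (n := n)
  have hs := macroScale_ge hn hM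
  have hW := macroScale_le_legLength (n := n) (M := M)
  have hb : b = .bottom ∨ b = .right := by tauto
  constructor
  · obtain ⟨c1, c1', h1, h1c, h1c'⟩ := piece_outward hn hM
    obtain ⟨c2, c2', h2, h2c, h2c'⟩ := piece_inward hn hM
    have h3 := (piece_vert (u := legLength n M) (v := 4 * ((n : ℤ) + 1))
      (v' := 4 * ((n : ℤ) + 1) + 2) (by omega)).reverse
    refine ⟨_, _, (piece_entry hn hM ha).append (h1.append (h3.append (h2.append
      (piece_exit hn hM hb) ?_) ?_) ?_) ?_, fun _ => rfl, fun _ => rfl⟩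
    · exact link_of_const h2c' (fun _ => rfl) (vertical_mem_vonNeumann (.inr rfl))
    · exact link_of_const (fun _ => rfl) h2c (horizontal_mem_vonNeumann (.inr rfl))
    · exact link_of_const h1c' (fun _ => rfl) (horizontal_mem_vonNeumann (.inl (by ring)))
    · exact link_of_const (fun _ => rfl) h1c (vertical_mem_vonNeumann (.inl rfl))
  · intro A
    have f0 : profile n M A 0 = 0 := profile_ramp_zero A le_rfl (by omega)
    have f1 : profile n M A 1 = 1 := profile_ramp_zero A (by omega) (by omega)
    have f2 : profile n M A 2 = 2 := profile_ramp_zero A (by omega) (by omega)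
    have hcap : Simple A (vert (legLength n M) (4 * (n + 1)) (4 * (n + 1) + 2)).reverse
        (tipSet n M) := (simple_vert A _ _ _).reverse.mono fun P hP => by
      simp only [Set.mem_ofPred_eq, tipSet] at hP ⊢
      omega
    refine ((simple_entry A).append ((simple_outward A).append (hcap.append
      ((simple_inward A).reverse.append (simple_exit hn hM A) ?_) ?_) ?_) ?_).mono
      (Set.union_subset (entrySet_subset_region hn hM A _) (Set.union_subset
        (legSet_subset_region hn hM A (by omega) le_rfl le_rfl) (Set.union_subset
        (tipSet_subset_region hn hM A) (Set.union_subset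
        (legSet_subset_region hn hM A le_rfl (by omega) (by omega))
        (exitSet_subset_region hn hM A _)))))
    · rintro ⟨u, v⟩ h3 h4
      simp only [Set.mem_ofPred_eq, exitSet, legSet] at h3 h4
      have := profile_bounds (n := n) (M := M) A (u := u) (by omega) (by omega)
      rcases h4 with ⟨rfl, h4⟩ | h4 | h4
      · norm_num [f1, f2] at h3
        omega
      · omega
      · omega
    · rintro ⟨u, v⟩ h3 h4
      simp only [Set.mem_union, Set.mem_ofPred_eq, exitSet, legSet, tipSet] at h3 h4
      omega
    · rintro ⟨u, v⟩ h3 h4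
      simp only [Set.mem_union, Set.mem_ofPred_eq, exitSet, legSet, tipSet] at h3 h4
      have := profile_bounds (n := n) (M := M) A (u := u) (by omega) (by omega)
      -- In each column a leg occupies two consecutive heights, so legs at offsets 0 and 2 do not
      -- meet and together fill the four levels available between nested legs.
      have := profile_step (n := n) (M := M) A u
      rcases h4 with h4 | h4 | ⟨rfl, h4⟩ | h4 | ⟨-, rfl, h4⟩
      · omega
      · omega
      · norm_num [f1, f2] at h3
        omega
      · omega
      · norm_num [f1, f0] at h3
        omega
    · rintro ⟨u, v⟩ h3 h4
      simp only [Set.mem_union, Set.mem_ofPred_eq, exitSet, legSet, entrySet, tipSet] at h3 h4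
      have h5 : a ≠ .right := by
        rintro rfl
        simp at hab
      rcases h3 with ⟨rfl, h3⟩ | h3
      · norm_num [f1, f0] at h4
        rcases hab with ⟨rfl, rfl⟩ | ⟨-, rfl⟩ <;> simp only [reduceCtorEq, false_and, true_and,
          or_false] at h3 h4 <;> omega
      · exact h5 h3.1
  · intro c hc
    simp only [doubled, List.mem_append, List.mem_reverse] at hc
    rcases hc with hc | hc | hc | hc | hc
    exacts [isLocal_entry c hc, isLocal_seg_leg (i := 0) c hc, isLocal_vert c hc,
      isLocal_seg_leg c hc, isLocal_exit c hc]
  · exact List.mem_append_left _ (fixed_zero_mem_entry hn hM ha)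
  · exact fun j hj => List.mem_append_right _ (List.mem_append_left _ (mem_seg.2 ⟨j, hj, rfl⟩))
  · have h1 := length_entry_le hn hM a
    have h2 := length_exit_le hn hM b
    simp only [doubled, sizeBound, List.length_append, List.length_reverse, length_seg,
      length_vert]
    omega

/-- The return is along the upper arm, which is at `4 * (n + 1) + 4` at the tip, two above the leg,
and ends at the top port in column 0. What it encloses with the leg is left to the tiles on the
left. -/
theorem isPath_single (hn : 1 ≤ n) (hM : 1 ≤ M) {a : Port} (ha : a ≠ .top) :
    IsPath n M a .top (single n M a) := by
  have hd := twelve_le_dipDepth (n := n)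
  have hs := macroScale_ge hn hM
  have hW := macroScale_le_legLength (n := n) (M := M)
  have hN : dipDepth n = 8 * n + 12 := rfl
  constructor
  · obtain ⟨c1, c1', h1, h1c, h1c'⟩ := piece_outward hn hM
    obtain ⟨c2, c2', h2, h2c, h2c'⟩ := piece_upper hn hM
    have h3 := piece_vert (u := legLength n M) (v := 4 * ((n : ℤ) + 1) + 2)
      (v' := 4 * ((n : ℤ) + 1) + 4) (by omega)
    refine ⟨_, _, (piece_entry hn hM ha).append (h1.append (h3.append h2 ?_) ?_) ?_,
      fun _ => rfl, h2c'⟩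
    · exact link_of_const (fun _ => rfl) h2c (horizontal_mem_vonNeumann (.inr rfl))
    · exact link_of_const h1c' (fun _ => rfl) (horizontal_mem_vonNeumann (.inl (by ring)))
    · exact link_of_const (fun _ => rfl) h1c (vertical_mem_vonNeumann (.inl rfl))
  · intro A
    have f0 : profile n M A 0 = 0 := profile_ramp_zero A le_rfl (by omega)
    have f1 : profile n M A 1 = 1 := profile_ramp_zero A (by omega) (by omega)
    have htip : Simple A (vert (legLength n M) (4 * (n + 1) + 2) (4 * (n + 1) + 4))
        (tipSet n M) := (simple_vert A _ _ _).mono fun P hP => by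
      simp only [Set.mem_ofPred_eq, tipSet] at hP ⊢
      omega
    refine ((simple_entry A).append ((simple_outward A).append (htip.append
      (simple_upper A).reverse ?_) ?_) ?_).mono
      (Set.union_subset (entrySet_subset_region hn hM A _) (Set.union_subset
        (legSet_subset_region hn hM A (by omega) le_rfl le_rfl) (Set.union_subset
        (tipSet_subset_region hn hM A) (upperSet_subset_region hn hM A))))
    · rintro ⟨u, v⟩ h3 h4
      simp only [Set.mem_ofPred_eq, tipSet, upperSet] at h3 h4
      omega
    · rintro ⟨u, v⟩ h3 h4
      simp only [Set.mem_union, Set.mem_ofPred_eq, upperSet, legSet, tipSet] at h3 h4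
      have := profile_bounds (n := n) (M := M) A (u := u) (by omega) (by omega)
      have := profile_bounds (n := n) (M := M) (fun _ => false) (u := u) (by omega) (by omega)
      omega
    · rintro ⟨u, v⟩ h3 h4
      simp only [Set.mem_union, Set.mem_ofPred_eq, upperSet, legSet, entrySet, tipSet] at h3 h4
      rcases h4 with h4 | h4 | h4
      · have := profile_bounds (n := n) (M := M) A (u := u) (by omega) (by omega)
        rcases h3 with ⟨rfl, h3⟩ | h3
        · norm_num [f1, f0] at h4
          omega
        · omega
      · omega
      · have := profile_bounds (n := n) (M := M) (fun _ => false) (u := u) (by omega) (by omega)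
        omega
  · intro c hc
    simp only [single, List.mem_append, List.mem_reverse] at hc
    rcases hc with hc | hc | hc | hc
    exacts [isLocal_entry c hc, isLocal_seg_leg (i := 0) c hc, isLocal_vert c hc,
      isLocal_seg_upperLeg c hc]
  · exact List.mem_append_left _ (fixed_zero_mem_entry hn hM ha)
  · exact fun j hj => List.mem_append_right _ (List.mem_append_left _ (mem_seg.2 ⟨j, hj, rfl⟩))
  · have h1 := length_entry_le hn hM a
    simp only [single, sizeBound, List.length_append, List.length_reverse, length_seg,
      length_vert]
    omega

theorem isPath_template (hn : 1 ≤ n) (hM : 1 ≤ M) {a b : Port} (hab : a ≠ b) :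
    IsPath n M a b (template n M a b) := by
  cases a <;> cases b <;> first
    | exact (hab rfl).elim
    | exact isPath_doubled hn hM (by decide) (by decide)
    | exact isPath_single hn hM (by decide)
    | exact (isPath_doubled hn hM (by decide) (by decide)).reverse
    | exact (isPath_single hn hM (by decide)).reverse

end Cell

/-! ### The blueprint of a tile system in a linear neighborhood -/

section tileBit

variable {n : ℕ} {X : Type} [Fintype X]

/-- The number of the glue of `t` at the position `(i, 0)`. -/
noncomputable def glueIndex (t : Tile (linearNeighborhood n) X) (i : ℤ) : ℤ :=
  open Classical in
  if h : ((i, 0) : Pos) ∈ (linearNeighborhood n).carrier then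
    ((Fintype.equivFin X (t ⟨_, h⟩) : ℕ) : ℤ) else 0

theorem glueIndex_nonneg (t : Tile (linearNeighborhood n) X) (i : ℤ) : 0 ≤ glueIndex t i := by
  unfold glueIndex
  split_ifs <;> omega

theorem glueIndex_lt (t : Tile (linearNeighborhood n) X) (i : ℤ) :
    glueIndex t i < (Fintype.card X + 1 : ℕ) := by
  unfold glueIndex
  split_ifs with h
  · have := (Fintype.equivFin X (t ⟨_, h⟩)).2
    omega
  · omega

theorem glueIndex_eq_of_sticks {t t' : Tile (linearNeighborhood n) X} {i : ℤ}
    (h : Sticks t t' (i, 0)) : glueIndex t i = glueIndex t' (-i) := by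
  have e : ((-i, 0) : Pos) = -(i, 0) := by simp
  unfold glueIndex
  by_cases hi : ((i, 0) : Pos) ∈ (linearNeighborhood n).carrier
  · have hi' : ((-i, 0) : Pos) ∈ (linearNeighborhood n).carrier :=
      e ▸ (linearNeighborhood n).neg_mem hi
    rw [dif_pos hi, dif_pos hi', h hi]
    simp only [e]
  · have hi' : ((-i, 0) : Pos) ∉ (linearNeighborhood n).carrier := fun h' =>
      hi (by simpa using (linearNeighborhood n).neg_mem h')
    rw [dif_neg hi, dif_neg hi']

theorem glueIndex_ne_of_not_sticks {t t' : Tile (linearNeighborhood n) X} {w : Pos}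
    (h : ¬ Sticks t t' w) : ∃ i : ℤ, w = (i, 0) ∧ 0 < |i| ∧ |i| ≤ n ∧
      glueIndex t i ≠ glueIndex t' (-i) := by
  unfold Sticks at h
  push Not at h
  obtain ⟨hw, hne⟩ := h
  obtain ⟨i, j⟩ := w
  have hw' := hw
  obtain ⟨hj, h1, h2⟩ := hw'
  obtain rfl : j = 0 := hj
  refine ⟨i, rfl, h1, h2, ?_⟩
  have e : ((-i, 0) : Pos) = -(i, 0) := by simp
  have hi' : ((-i, 0) : Pos) ∈ (linearNeighborhood n).carrier :=
    e ▸ (linearNeighborhood n).neg_mem hw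
  unfold glueIndex
  rw [dif_pos hw, dif_pos hi']
  simp only [e]
  intro h3
  exact hne ((Fintype.equivFin X).injective (Fin.ext (by exact_mod_cast h3)))

/-- The bit of a slot in the polyominoes of `t`. In the column `c.1`, the slot `c.2` compares the
glues of the tile `n` columns to the left with those of another tile: the bit is free except in
the polyominoes of these two tiles. -/
noncomputable def tileBit (t : Tile (linearNeighborhood n) X) (c : ℤ × ℤ) (b : Bool) : Bool :=
  if 0 ≤ c.2 ∧ c.2 < n * (Fintype.card X + 1 : ℕ) then
    if c.1 = n then
      decide (glueIndex t (c.2 / (Fintype.card X + 1 : ℕ) + 1) = c.2 % (Fintype.card X + 1 : ℕ))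
    else if c.1 = n - (c.2 / (Fintype.card X + 1 : ℕ) + 1) then
      decide (glueIndex t (-(c.2 / (Fintype.card X + 1 : ℕ) + 1)) =
        c.2 % (Fintype.card X + 1 : ℕ))
    else b
  else b

/-- The common bits of a row of a zipper. -/
theorem exists_rowBits {T : Finset (Tile (linearNeighborhood n) X)} {z : TiledPath T}
    (hz : IsZipper z) : ∃ G : ℤ → ℤ × ℤ → Bool, ∀ (x : Pos) (t : T), z.tile x = some t →
      ∀ c : ℤ × ℤ, tileBit (t : Tile (linearNeighborhood n) X) c (G x.2 (c.1 + x.1, c.2)) =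
        G x.2 (c.1 + x.1, c.2) := by
  classical
  set M : ℤ := ((Fintype.card X + 1 : ℕ) : ℤ) with hM
  -- In absolute coordinates, a slot is constrained by two positions only: the one `n` columns to
  -- its left and the one `c.2 / M + 1` steps right of that. If both carry tiles of the zipper,
  -- these stick and their requirements agree; a slot with neither takes `false`.
  have key : ∀ (y : ℤ) (c : ℤ × ℤ), ∃ b : Bool,
      (∀ t : T, z.tile (c.1 - n, y) = some t →
        b = decide (glueIndex (t : Tile (linearNeighborhood n) X) (c.2 / M + 1) = c.2 % M)) ∧
      ∀ t : T, z.tile (c.1 - n + (c.2 / M + 1), y) = some t →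
        b = decide (glueIndex (t : Tile (linearNeighborhood n) X) (-(c.2 / M + 1)) = c.2 % M) := by
    intro y c
    rcases h1 : z.tile (c.1 - n, y) with _ | t
    · rcases h2 : z.tile (c.1 - n + (c.2 / M + 1), y) with _ | t'
      · exact ⟨false, by simp⟩
      · exact ⟨decide (glueIndex (t' : Tile (linearNeighborhood n) X) (-(c.2 / M + 1)) = c.2 % M),
          by simp, fun t h => by cases h; rfl⟩
    · refine ⟨_, fun t' h => by cases h; rfl, fun t' h => ?_⟩
      have h3 := hz.2 _ _ _ _ h1 h
      have h4 : ((c.1 - n + (c.2 / M + 1), y) : Pos) - (c.1 - n, y) = (c.2 / M + 1, 0) := by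
        simp
      rw [h4] at h3
      rw [glueIndex_eq_of_sticks h3]
  choose G h1 h2 using key
  refine ⟨G, fun x t ht c => ?_⟩
  unfold tileBit
  rw [← hM]
  split_ifs with h3 h4 h5
  · refine (h1 x.2 (c.1 + x.1, c.2) t ?_).symm
    rw [← ht]
    congr 1
    ext <;> simp [h4]
  · refine (h2 x.2 (c.1 + x.1, c.2) t ?_).symm
    rw [← ht]
    congr 1
    ext
    · simp only [h5]
      ring
    · rfl
  · rfl
  · rfl

end tileBit

/-! ### Disjointness of the regions of distinct macrotiles. -/

namespace Cell

variable {n M : ℕ}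

/-- Over the columns of the right macrotile `b`, the left one `a` lies between its own leg and its
own upper arm. By `profile_add` these are at least 4 above the leg and 4 below the upper arm of `b`,
while `b` stays outside of that strip. Where `b` is past its legs, `a` has already ended. -/
theorem region_disjoint_row (A : ℤ × ℤ → Bool) {a b : ℤ} (hab : a < b) {P Q : Pos}
    (hP : P ∈ region n M fun c => A (c.1 + a, c.2)) (hQ : Q ∈ region n M fun c => A (c.1 + b, c.2))
    (h1 : macroScale n M * a + P.1 = macroScale n M * b + Q.1) (h2 : P.2 = Q.2) : False := by
  obtain ⟨-, -, -, -, hP⟩ := hP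
  obtain ⟨hQ0, -, -, hQ, -⟩ := hQ
  have hs := macroScale_pos (n := n) (M := M)
  have hs' : macroScale n M * a + macroScale n M ≤ macroScale n M * b := by nlinarith
  have e1 := profile_add (n := n) (M := M) A P.1 a
  have e2 := profile_add (n := n) (M := M) A (P.1 + 1) a
  have e3 := profile_add (n := n) (M := M) A Q.1 b
  have e4 := profile_add (n := n) (M := M) A (Q.1 + 1) b
  have e5 := profile_add (n := n) (M := M) (fun _ => false) P.1 a
  have e6 := profile_add (n := n) (M := M) (fun _ => false) (P.1 + 1) a
  have e7 := profile_add (n := n) (M := M) (fun _ => false) Q.1 b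
  have e8 := profile_add (n := n) (M := M) (fun _ => false) (Q.1 + 1) b
  rw [← add_assoc] at e2 e4 e6 e8
  rw [h1] at e1 e2 e5 e6
  omega

/-- Regions are exactly one scale high, so only macrotiles of the same row can meet; each row has
its own bits. -/
theorem region_disjoint (G : ℤ → ℤ × ℤ → Bool) {x y : Pos} (hxy : x ≠ y) {P Q : Pos}
    (hP : P ∈ region n M fun c => G x.2 (c.1 + x.1, c.2))
    (hQ : Q ∈ region n M fun c => G y.2 (c.1 + y.1, c.2)) :
    macroScale n M • x + P ≠ macroScale n M • y + Q := by
  intro e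
  obtain ⟨x1, x2⟩ := x
  obtain ⟨y1, y2⟩ := y
  have h1 : macroScale n M * x1 + P.1 = macroScale n M * y1 + Q.1 := congrArg Prod.fst e
  have h2 : macroScale n M * x2 + P.2 = macroScale n M * y2 + Q.2 := congrArg Prod.snd e
  have hP' := hP.2
  have hQ' := hQ.2
  have h3 : x2 = y2 := by
    rcases lt_trichotomy x2 y2 with h | h | h
    · have : macroScale n M * x2 + macroScale n M ≤ macroScale n M * y2 := by
        have := macroScale_pos (n := n) (M := M)
        nlinarith
      omega
    · exact h
    · have : macroScale n M * y2 + macroScale n M ≤ macroScale n M * x2 := by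
        have := macroScale_pos (n := n) (M := M)
        nlinarith
      omega
  subst h3
  rcases lt_trichotomy x1 y1 with h | h | h
  · exact region_disjoint_row (G x2) h hP hQ h1 (by omega)
  · exact hxy (by rw [h])
  · exact region_disjoint_row (G x2) h hQ hP h1.symm (by omega)

/-- Left, top and bottom are outside of the bounding box. On the right, the column `macroScale n M`
may only be entered above the leg, at height 4 or more, while the port is at `-dipDepth n`. -/
theorem portCell_add_dir_notMem_region (hn : 1 ≤ n) (hM : 1 ≤ M) (A : ℤ × ℤ → Bool) (p : Port) :
    portCell n M p + p.dir ∉ region n M A := by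
  have hd := twelve_le_dipDepth (n := n)
  have hs := macroScale_ge hn hM
  have f0 := profile_ramp (n := n) (M := M) A 1 (w := 0) le_rfl (by omega)
  have f1 := profile_ramp (n := n) (M := M) A 1 (w := 1) (by omega) (by omega)
  rw [mul_one] at f0 f1
  rw [add_zero] at f0
  intro h
  cases p <;> simp only [region, portCell, Port.dir, Prod.mk_add_mk, Set.mem_ofPred_eq,
    sub_add_cancel, add_zero, f0, f1] at h <;> omega

theorem portCell_opp (p : Port) :
    macroScale n M • p.dir + portCell n M p.opp = portCell n M p + p.dir := by
  cases p <;> ext <;> simp [Port.dir, Port.opp, portCell] <;> omega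

/-- The `j`-th cell of the polyominoes of a route. -/
def cellAt (n M : ℕ) (r : Route) (j : ℕ) : Cell := (template n M r.src r.dst).getD j (fixed 0)

theorem cellAt_eq_getElem {r : Route} {j : ℕ} (h : j < (template n M r.src r.dst).length) :
    cellAt n M r j = (template n M r.src r.dst)[j] := by
  simp [cellAt, h]

theorem cellAt_mem {r : Route} {j : ℕ} (h : j < (template n M r.src r.dst).length) :
    cellAt n M r j ∈ template n M r.src r.dst := by
  rw [cellAt_eq_getElem h]
  exact List.getElem_mem h

theorem exists_cellAt_eq {r : Route} {c : Cell} (h : c ∈ template n M r.src r.dst) :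
    ∃ j < (template n M r.src r.dst).length, cellAt n M r j = c := by
  obtain ⟨j, hj, rfl⟩ := List.getElem_of_mem h
  exact ⟨j, hj, cellAt_eq_getElem hj⟩

theorem link_cellAt (hn : 1 ≤ n) (hM : 1 ≤ M) (r : Route) {j : ℕ}
    (h : j + 1 < (template n M r.src r.dst).length) :
    Link (cellAt n M r j) (cellAt n M r (j + 1)) := by
  obtain ⟨c, c', hp, -⟩ := (isPath_template hn hM r.2).piece
  rw [cellAt_eq_getElem h, cellAt_eq_getElem (by omega)]
  exact List.isChain_iff_getElem.1 hp.1 j h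

theorem two_le_length_template (hn : 1 ≤ n) (hM : 1 ≤ M) (r : Route) :
    2 ≤ (template n M r.src r.dst).length := by
  have h := isPath_template (n := n) (M := M) hn hM r.2
  obtain ⟨W, hW⟩ := exists_legLength_eq hn hM
  obtain ⟨i, hi, hi'⟩ := exists_cellAt_eq (h.leg_mem 0 (by omega))
  obtain ⟨j, hj, hj'⟩ := exists_cellAt_eq (h.leg_mem 1 (by omega))
  have hij : i ≠ j := by
    rintro rfl
    have := leg_injective (n := n) (M := M) 2 (fun _ => false)
      (congrArg (fun c => c.pos fun _ => false) (hi'.symm.trans hj'))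
    omega
  omega

end Cell

/-! ### Overlap of non-matching tiles, the blueprint, and the bounds. -/

open Cell

variable {n : ℕ} {X : Type} [Fintype X]

/-- The polyominoes of two tiles whose glues do not match overlap. -/
theorem exists_leg_overlap {t t' : Tile (linearNeighborhood n) X} {i : ℤ} (hi : 0 < i)
    (hin : i ≤ n) (h : glueIndex t i ≠ glueIndex t' (-i)) :
    ∃ j < 2 * legLength n (Fintype.card X + 1), ∃ j' < 2 * legLength n (Fintype.card X + 1),
      ∀ b b', (leg n (Fintype.card X + 1) 2 j).pos (fun c => tileBit t c b) =
        macroScale n (Fintype.card X + 1) • ((i, 0) : Pos) +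
          (leg n (Fintype.card X + 1) 2 j').pos fun c => tileBit t' c b' := by
  have hg0 := glueIndex_nonneg t i
  have hg1 := glueIndex_lt t i
  have hd : dipDepth n = 8 * n + 12 := rfl
  have hW := cast_legLength (n := n) (M := Fintype.card X + 1)
  set M : ℕ := Fintype.card X + 1 with hM
  set g := glueIndex t i with hg
  -- The slot which tests the glue `g` of `t` at distance `i`: the leg of `t` has to dip in it, and
  -- that of `t'` must not.
  set m : ℤ := M * (i - 1) + g with hm
  have hm0 : 0 ≤ m := by
    have : 0 ≤ (M : ℤ) * (i - 1) := by
      apply mul_nonneg <;> omega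
    omega
  have hm1 : m < n * M := by nlinarith
  have hmd : m / M = i - 1 := by
    rw [hm, Int.mul_add_ediv_left _ _ (by omega), Int.ediv_eq_zero_of_lt hg0 hg1, add_zero]
  have hmm : m % M = g := by
    rw [hm, Int.mul_add_emod_self_left, Int.emod_eq_of_lt hg0 hg1]
  -- At `4 * i` columns into the slot, the leg of `t` has gone down by `4 * i`, its initial lead
  -- over the leg of `t'`. The zigzag of the latter is at `0` there, since `4 * i` is even, so both
  -- legs contain the same cell.
  set w : ℤ := 4 + 2 * dipDepth n * m + 4 * i with hw
  have hw0 : 0 ≤ w := by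
    have : 0 ≤ 2 * dipDepth n * m := by
      apply mul_nonneg <;> omega
    omega
  have hw1 : w < macroScale n M := by
    have : 2 * dipDepth n * (m + 1) ≤ 2 * dipDepth n * (n * M) := 
      mul_le_mul_of_nonneg_left (Int.add_one_le_iff.2 hm1) (by omega)
    unfold macroScale
    linarith
  have hs := macroScale_pos (n := n) (M := M)
  -- The same place is in the width `n` of the leg of `t` and in the width `n - i` of that of `t'`.
  obtain ⟨u, hu⟩ := Int.eq_ofNat_of_zero_le (show 0 ≤ macroScale n M * n + w by positivity)
  obtain ⟨u', hu'⟩ := Int.eq_ofNat_of_zero_le (show 0 ≤ macroScale n M * (n - i) + w by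
    have : 0 ≤ (n : ℤ) - i := by omega
    positivity)
  refine ⟨2 * u, ?_, 2 * u', ?_, fun b b' => ?_⟩
  · rw [mul_add, mul_one] at hW
    omega
  · have : macroScale n M * (n - i) ≤ macroScale n M * n := by
      apply mul_le_mul_of_nonneg_left _ hs.le
      omega
    rw [mul_add, mul_one] at hW
    omega
  · have h1 : tileBit t (n, m) b = true := by
      unfold tileBit
      rw [if_pos ⟨hm0, hm1⟩, if_pos rfl]
      simp only [← hM, hmd, hmm, sub_add_cancel]
      exact decide_eq_true rfl
    have h2 : tileBit t' (n - i, m) b' = false := by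
      unfold tileBit
      simp only [← hM, hmd, hmm, sub_add_cancel]
      rw [if_pos ⟨hm0, hm1⟩, if_neg (by omega)]
      simpa using h.symm
    rw [leg_even, leg_even, ← hu, ← hu', profile_slot _ _ hm0 hm1 (by omega) (by omega),
      profile_slot _ _ hm0 hm1 (by omega) (by omega), h1, h2]
    unfold dip
    ext
    · simp
      ring
    · simp
      omega

/-- The blueprint of a tile system in a linear neighborhood. -/
noncomputable def linearBlueprint (hn : 1 ≤ n) (T : Finset (Tile (linearNeighborhood n) X)) :
    Blueprint T where
  s := (macroScale n (Fintype.card X + 1)).toNat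
  s_pos := by
    have := macroScale_pos (n := n) (M := Fintype.card X + 1)
    omega
  port := portCell n (Fintype.card X + 1)
  port_opp p := by
    rw [Int.toNat_of_nonneg macroScale_pos.le]
    exact portCell_opp p
  size := sizeBound n (Fintype.card X + 1)
  len r := (template n (Fintype.card X + 1) r.src r.dst).length
  two_le_len := two_le_length_template hn (by omega)
  len_le r := (isPath_template hn (by omega) r.2).length_le
  slot r j := (cellAt n (Fintype.card X + 1) r j).slot
  loc t r j b := (cellAt n (Fintype.card X + 1) r j).pos fun c =>
    tileBit (t : Tile (linearNeighborhood n) X) c b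
  loc_first t r b := by
    obtain ⟨c, c', hp, h, -⟩ := (isPath_template (M := Fintype.card X + 1) hn (by omega) r.2).piece
    have h1 := hp.2.1
    rw [List.head?_eq_getElem?] at h1
    rw [cellAt, List.getD_eq_getElem?_getD, h1]
    exact h _
  loc_last t r b := by
    obtain ⟨c, c', hp, -, h⟩ := (isPath_template (M := Fintype.card X + 1) hn (by omega) r.2).piece
    have h1 := hp.2.2
    rw [List.getLast?_eq_getElem?] at h1
    rw [cellAt, List.getD_eq_getElem?_getD, h1]
    exact h _
  step t r j b hj := (link_cellAt hn (by omega) r hj).1 _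
  indep t r j b b' hj hs := (link_cellAt hn (by omega) r hj).2 hs _ _
  inj t r B i j hi hj e := by
    have h := isPath_template (M := Fintype.card X + 1) hn (by omega) r.2
    -- Each cell is computed with its own bit extended to all slots. By locality all of them may be
    -- computed with the single assignment `A`, to which the simplicity of the path applies.
    set A : ℤ × ℤ → Bool := fun c => tileBit (t : Tile (linearNeighborhood n) X) c (B c)
    have e' : (cellAt n (Fintype.card X + 1) r i).pos A =
        (cellAt n (Fintype.card X + 1) r j).pos A := by
      rw [← h.isLocal _ (cellAt_mem hi) (fun c => tileBit (t : Tile (linearNeighborhood n) X) c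
        (B (cellAt n (Fintype.card X + 1) r i).slot)) A rfl, ← h.isLocal _ (cellAt_mem hj)
        (fun c => tileBit (t : Tile (linearNeighborhood n) X) c
        (B (cellAt n (Fintype.card X + 1) r j).slot)) A rfl]
      exact e
    rw [cellAt_eq_getElem hi, cellAt_eq_getElem hj] at e'
    have hnd := (h.simple A).1
    exact (hnd.getElem_inj_iff (hi := by simpa using hi) (hj := by simpa using hj)).1
      (by simpa using e')
  inside t r j b p hj e :=
    portCell_add_dir_notMem_region hn (by omega) _ p
      (e ▸ ((isPath_template hn (by omega) r.2).simple _).2 _ (cellAt_mem hj))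
  ref t r := by
    obtain ⟨j, hj, h⟩ := exists_cellAt_eq
      (isPath_template (M := Fintype.card X + 1) hn (by omega) r.2).ref
    exact ⟨j, hj, fun b => by rw [h]; rfl⟩
  encode z hz := by
    -- The bits imposed by a tile of the zipper are those of its row, so its cells are in the region
    -- defined by the bits of the row, and regions are disjoint.
    obtain ⟨G, hG⟩ := exists_rowBits hz
    refine ⟨fun x c => G x.2 (c.1 + x.1, c.2), fun x y t t' hxy hx hy r r' i j hi hj => ?_⟩
    rw [Int.toNat_of_nonneg macroScale_pos.le]
    have key : ∀ (x : Pos) (t : T) (r : Route) (i : ℕ), z.tile x = some t →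
        i < (template n (Fintype.card X + 1) r.src r.dst).length →
        ((cellAt n (Fintype.card X + 1) r i).pos fun c =>
          tileBit (t : Tile (linearNeighborhood n) X) c
            (G x.2 ((cellAt n (Fintype.card X + 1) r i).slot.1 + x.1,
              (cellAt n (Fintype.card X + 1) r i).slot.2))) ∈
          region n (Fintype.card X + 1) fun c => G x.2 (c.1 + x.1, c.2) := by
      intro x t r i hx hi
      have h := isPath_template (M := Fintype.card X + 1) hn (by omega) r.2
      rw [h.isLocal _ (cellAt_mem hi) _ (fun c => G x.2 (c.1 + x.1, c.2)) (hG x t hx _)]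
      exact (h.simple _).2 _ (cellAt_mem hi)
    exact region_disjoint G hxy (key x t r i hx hi) (key y t' r' j hy hj)
  sound t t' w hw r r' := by
    rw [Int.toNat_of_nonneg macroScale_pos.le]
    obtain ⟨i, rfl, h0, h1, hne⟩ := glueIndex_ne_of_not_sticks hw
    have hp := isPath_template (M := Fintype.card X + 1) hn (by omega) r.2
    have hp' := isPath_template (M := Fintype.card X + 1) hn (by omega) r'.2
    -- The overlap lemma assumes that the second tile is on the right; for negative `i` the two
    -- tiles are exchanged.
    rcases le_or_gt i 0 with hi | hi
    · have h2 : 0 < -i := by rw [abs_of_nonpos hi] at h0; exact h0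
      obtain ⟨a, ha, b, hb, h⟩ := exists_leg_overlap (t := (t' : Tile (linearNeighborhood n) X))
        (t' := (t : Tile (linearNeighborhood n) X)) h2 (by rwa [abs_of_nonpos hi] at h1)
        (by rw [neg_neg]; exact hne.symm)
      obtain ⟨j, hj, ej⟩ := exists_cellAt_eq (hp.leg_mem b hb)
      obtain ⟨j', hj', ej'⟩ := exists_cellAt_eq (hp'.leg_mem a ha)
      refine ⟨j, hj, j', hj', fun c c' => ?_⟩
      rw [ej, ej', h c' c]
      ext <;> simp
    · obtain ⟨a, ha, b, hb, h⟩ := exists_leg_overlap hi (by rwa [abs_of_pos hi] at h1) hne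
      obtain ⟨j, hj, ej⟩ := exists_cellAt_eq (hp.leg_mem a ha)
      obtain ⟨j', hj', ej'⟩ := exists_cellAt_eq (hp'.leg_mem b hb)
      refine ⟨j, hj, j', hj', fun c c' => ?_⟩
      rw [ej, ej', h c c']

theorem sizeBound_le (hn : 1 ≤ n) {M : ℕ} (hM : 1 ≤ M) : sizeBound n M ≤ 528 * M * n ^ 3 := by
  have h1 : (macroScale n M).toNat ≤ 44 * M * n ^ 2 := by
    have h2 : (1 : ℤ) ≤ M * n ^ 2 := by exact_mod_cast Nat.mul_pos hM (pow_pos hn 2)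
    have h3 : 2 * dipDepth n * (n * M) ≤ 40 * (M * n ^ 2) := by
      have : dipDepth n ≤ 20 * n := by unfold dipDepth; omega
      calc 2 * dipDepth n * (n * M) ≤ 2 * (20 * n) * (n * M) := by gcongr
        _ = _ := by ring
    have h4 : macroScale n M ≤ 44 * (M * n ^ 2) := by unfold macroScale; linarith
    zify
    rw [Int.toNat_of_nonneg macroScale_pos.le]
    linarith
  calc sizeBound n M = 4 * (n + 2) * (macroScale n M).toNat := by
        unfold sizeBound legLength; ring
    _ ≤ 4 * (3 * n) * (44 * M * n ^ 2) := by gcongr; omega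
    _ = _ := by ring

theorem mainTheorem10 :
    ∃ C : ℕ, ∀ (n : ℕ), 1 ≤ n → ∀ (X : Type) [Fintype X]
      (T : Finset (Tile (linearNeighborhood n) X)),
      ∃ (Xμ : Type) (_ : Fintype Xμ) (Tμ : Finset (Tile vonNeumann Xμ)) (s : ℕ)
        (φ : T → Set (TiledPath Tμ))
        (ψ : {z : TiledPath T // IsZipper z} → Set (TiledPath (TiledPath Tμ))),
        IsZipperSimulation T Tμ s φ ψ ∧
        Tμ.card ≤ C * T.card * Fintype.card X ^ 2 * n ^ 5 ∧
        Fintype.card Xμ ≤ C * T.card * Fintype.card X ^ 2 * n ^ 5 ∧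
        ∀ (t : T) (π : TiledPath Tμ), π ∈ φ t →
          π.dom.ncard ≤ C * Fintype.card X * n ^ 3 := by
  -- The constant only has to exceed `4 * (1 + 64 * 1056) = 270340`, where `1056 = 2 * 528` comes
  -- from the size bound and `|X| + 1 ≤ 2 * |X|`.
  refine ⟨300000, fun n hn X _ T => ?_⟩
  -- Since `n ≥ 1`, the neighborhood contains `(1, 0)`, so a tile has at least one glue.
  have hX : T.Nonempty → 1 ≤ Fintype.card X := by
    rintro ⟨t, -⟩
    exact Fintype.card_pos_iff.2 ⟨t ⟨(1, 0), rfl, by simp, by simpa using hn⟩⟩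
  have hsize : T.Nonempty → (linearBlueprint hn T).size ≤ 1056 * Fintype.card X * n ^ 3 := by
    intro h
    have := hX h
    calc (linearBlueprint hn T).size ≤ 528 * (Fintype.card X + 1) * n ^ 3 :=
          sizeBound_le hn (by omega)
      _ ≤ 528 * (2 * Fintype.card X) * n ^ 3 := by gcongr; omega
      _ = _ := by ring
  have hcount : ∀ k : ℕ, k ≤ T.card * (4 * (1 + 64 * (linearBlueprint hn T).size)) →
      k ≤ 300000 * T.card * Fintype.card X ^ 2 * n ^ 5 := by
    intro k hk
    refine hk.trans ?_
    rcases T.eq_empty_or_nonempty with rfl | h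
    · simp
    · have h1 := hX h
      have h2 : 1 ≤ Fintype.card X * n ^ 3 := Nat.mul_pos h1 (pow_pos hn 3)
      calc T.card * (4 * (1 + 64 * (linearBlueprint hn T).size))
          ≤ T.card * (4 * (Fintype.card X * n ^ 3 + 64 * (1056 * Fintype.card X * n ^ 3))) := by
            gcongr
            exact hsize h
        _ = 270340 * T.card * Fintype.card X ^ 1 * n ^ 3 := by ring
        _ ≤ 300000 * T.card * Fintype.card X ^ 2 * n ^ 5 := by gcongr <;> omega
  refine ⟨_, inferInstance, (linearBlueprint hn T).tiles, (linearBlueprint hn T).s,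
    (linearBlueprint hn T).polyominoes, (linearBlueprint hn T).simulations,
    (linearBlueprint hn T).isZipperSimulation,
    hcount _ ((linearBlueprint hn T).card_tiles_le.trans (Nat.mul_le_mul_left _ (by omega))),
    hcount _ (linearBlueprint hn T).card_glue_le, fun t π hπ => ?_⟩
  refine ((linearBlueprint hn T).ncard_dom_le hπ).trans ((hsize ⟨t.1, t.2⟩).trans ?_)
  gcongr
  omega
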